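/- Let $M,K\colon[0,\infty)\to(0,\infty)$ be continuous and non-decreasing, and put $$\Omega_M=\{s\in\mathbb C: |\operatorname{Re}s|\le 1/M(|\operatorname{Im}s|)\},\quad M_K(t)=M(t)\bigl(\log t+\log K(t)\bigr),\quad M_{K,\log}(t)=M(t)\bigl(\log t+\log\log t+\log K(t)\bigr).$$ For $x>0$ let $M_K^{-1}(x)$ be the unique $t>0$ with $M_K(t)=x$ and $M_{K,\log}^{-1}(x)$ the unique $t>1$ with $M_{K,\log}(t)=x$. For $S\colon[0,\infty)\to\mathbb R$ write $\mathcal L\{S;s\}=\int_0^\infty e^{-sx}S(x)\,dx$. An analytic extension of $\mathcal L\{S;s\}$ to $\Omega_M$ is a continuous function $g$ on $\Omega_M$, analytic in the interior of $\Omega_M$, with $g(s)=\mathcal L\{S;s\}$ for $s\in\Omega_M$, $\operatorname{Re}s>0$. A function $V$ is of $\eta$-regular growth if there are $C',t_0>0$ with $V(C't)/V(t)\ge 1+1/\eta(t)$ for all $t\ge t_0$. The function $K$ is of positive increase if there are $a,t_0>0$ and a constant $A$ with $t^{-a}K(t)\le A\,R^{-a}K(R)$ whenever $t_0\le t\le R$.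 **(I)** Let $S\colon[0,\infty)\to\mathbb R$ be such that $S(x)+Cx$ is non-decreasing for some constant $C>0$, that $\mathcal L\{S;s\}$ converges for $\operatorname{Re}s>0$, and that $\mathcal L\{S;s\}$ has an analytic extension $g$ to $\Omega_M$ with $|g(s)|\le K(|s|)/|s|$ for all $s\in\Omega_M$ with $|s|$ sufficiently large. All implicit constants below may depend on $S,M,K$ (and on $c$ in the first estimate). 1. For every $0<c<1$, $\;S(x)\ll 1/M_{K,\log}^{-1}(cx)$ as $x\to\infty$. 2. If $M_{K,\log}$ is of $M(t)t/675$-regular growth, then $S(x)\ll 1/M_{K,\log}^{-1}(x)$ as $x\to\infty$. 3. If, in addition to the hypothesis of 2, either $K$ is of positive increase, or $M(t)/\log^\beta t$ is eventually non-decreasing for some $\beta>0$ and $M_{K,\log}$ is of $M(t)t/1350$-regular growth, then $S(x)\ll 1/M_K^{-1}(x)$ as $x\to\infty$. **(II)** Suppose that for some $C''>0$ one has $K(t)\le\exp(\exp(C''tM(t)))$ for all sufficiently large $t$. Then the decay rate cannot be improved beyond $1/M_K^{-1}(x)$, even in the following smaller class: if $r\colon\mathbb R\to\mathbb R$ is such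 that $S(x)=O_S(r(x))$ as $x\to\infty$ for every Lipschitz continuous $S\colon[0,\infty)\to\mathbb R$ whose Laplace transform has an analytic extension $g$ to $\Omega_M$ with $|g(s)|\le K(|s|)/(1+|s|)$ for all $s\in\Omega_M$, then $1/M_K^{-1}(x)=O(r(x))$ as $x\to\infty$. -/

import Mathlib

open Set Filter Asymptotics MeasureTheory Topology

namespace QuantTauber

noncomputable section

/-- The Laplace transform `∫₀^∞ e^{-s x} S(x) dx` of a real function on `[0, ∞)`
(only the values of `S` on `[0, ∞)` matter). -/
def laplace (S : ℝ → ℝ) (s : ℂ) : ℂ :=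
  ∫ x in Ioi (0 : ℝ), Complex.exp (-s * (x : ℂ)) * (S x : ℂ)

/-- The Laplace integral of `S` converges on the open half-plane `Re s > 0`. -/
def LaplaceConverges (S : ℝ → ℝ) : Prop :=
  ∀ s : ℂ, 0 < s.re →
    IntegrableOn (fun x : ℝ => Complex.exp (-s * (x : ℂ)) * (S x : ℂ)) (Ioi (0 : ℝ))

/-- The functions `M` and `K`: positive, continuous and non-decreasing on `[0, ∞)`. -/
structure IsGrowthFunction (M : ℝ → ℝ) : Prop where
  continuousOn : ContinuousOn M (Ici 0)
  monotoneOn : MonotoneOn M (Ici 0)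
  pos : ∀ t, 0 ≤ t → 0 < M t

/-- The closed region `Ω_M = {s : |Re s| ≤ 1 / M(|Im s|)}`. -/
def Omega (M : ℝ → ℝ) : Set ℂ := {s : ℂ | |s.re| ≤ 1 / M |s.im|}

/-- `g` is an analytic extension of the Laplace transform of `S` to the closed region `Ω_M`:
it is continuous on `Ω_M`, analytic in the interior of `Ω_M`, and it agrees with the
Laplace transform on the part of `Ω_M` in the half-plane `Re s > 0`. -/
structure IsLaplaceExtension (M S : ℝ → ℝ) (g : ℂ → ℂ) : Prop where
  continuousOn : ContinuousOn g (Omega M)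
  differentiableOn : DifferentiableOn ℂ g (interior (Omega M))
  eq_laplace : ∀ s ∈ Omega M, 0 < s.re → g s = laplace S s

/-- `M_K(t) = M(t) (log t + log K(t))`, considered for `t > 0`. -/
def MK (M K : ℝ → ℝ) (t : ℝ) : ℝ := M t * (Real.log t + Real.log (K t))

/-- `M_{K,log}(t) = M(t) (log t + log log t + log K(t))`, considered for `t > 1`. -/
def MKlog (M K : ℝ → ℝ) (t : ℝ) : ℝ :=
  M t * (Real.log t + Real.log (Real.log t) + Real.log (K t))

/-- The inverse function of `M_K` on `(0, ∞)`; for `x > 0` the equation `M_K(t) = x` has exactly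
one solution `t > 0`, see `existsUnique_MK`. -/
def MKInv (M K : ℝ → ℝ) (x : ℝ) : ℝ := Function.invFunOn (MK M K) (Ioi 0) x

/-- The inverse function of `M_{K,log}` on `(1, ∞)`; for `x > 0` the equation `M_{K,log}(t) = x`
has exactly one solution `t > 1`, see `existsUnique_MKlog`. -/
def MKlogInv (M K : ℝ → ℝ) (x : ℝ) : ℝ := Function.invFunOn (MKlog M K) (Ioi 1) x

/-- `K` is of positive increase: `t^{-a} K(t) ≪ R^{-a} K(R)` for `t₀ ≤ t ≤ R`. -/
def PositiveIncrease (K : ℝ → ℝ) : Prop :=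
  ∃ a : ℝ, 0 < a ∧ ∃ t₀ : ℝ, 0 < t₀ ∧ ∃ A : ℝ, ∀ t R : ℝ, t₀ ≤ t → t ≤ R →
    t ^ (-a) * K t ≤ A * (R ^ (-a) * K R)

/-- `V` is of `η`-regular growth: `V(C' t) / V(t) ≥ 1 + 1 / η(t)` for `t ≥ t₀`. -/
def RegularGrowth (η V : ℝ → ℝ) : Prop :=
  ∃ C' : ℝ, 0 < C' ∧ ∃ t₀ : ℝ, 0 < t₀ ∧ ∀ t : ℝ, t₀ ≤ t → 1 + 1 / η t ≤ V (C' * t) / V t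

/-- `M(t) / log^β t` is eventually non-decreasing for some `β > 0`. -/
def LogPowerIncrease (M : ℝ → ℝ) : Prop :=
  ∃ β : ℝ, 0 < β ∧ ∃ t₁ : ℝ, MonotoneOn (fun t : ℝ => M t / Real.log t ^ β) (Ici t₁)

/-- The hypotheses of the Tauberian theorem on `S`: the one-sided Tauberian condition, and the
analytic extension of the Laplace transform to `Ω_M` with the bound `K(|s|)/|s|` as
`|s| → ∞`. -/
structure TauberianClass (M K S : ℝ → ℝ) : Prop where
  tauberian : ∃ C : ℝ, 0 < C ∧ MonotoneOn (fun x : ℝ => S x + C * x) (Ici 0)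
  converges : LaplaceConverges S
  extension : ∃ g : ℂ → ℂ, IsLaplaceExtension M S g ∧
    ∃ R : ℝ, ∀ s ∈ Omega M, R ≤ ‖s‖ → ‖g s‖ ≤ K ‖s‖ / ‖s‖

/-- The smaller class of Lipschitz functions on `[0, ∞)` whose Laplace transform extends
analytically to `Ω_M` with the bound `K(|s|)/(1+|s|)` on all of `Ω_M`. -/
structure LipschitzClass (M K S : ℝ → ℝ) : Prop where
  lipschitz : ∃ L : NNReal, LipschitzOnWith L S (Ici 0)
  extension : ∃ g : ℂ → ℂ, IsLaplaceExtension M S g ∧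
    ∀ s ∈ Omega M, ‖g s‖ ≤ K ‖s‖ / (1 + ‖s‖)

/-! The inverse functions are well defined on `(0, ∞)`. -/

theorem existsUnique_aux {M L : ℝ → ℝ} {b x : ℝ} (hb : 0 ≤ b) (hM : IsGrowthFunction M)
    (hLc : ContinuousOn L (Ioi b)) (hLm : StrictMonoOn L (Ioi b)) (hx : 0 < x)
    (h1 : ∃ t ∈ Ioi b, L t ≤ 0) (h2 : ∃ t ∈ Ioi b, x / M 0 ≤ L t) :
    ∃! t, t ∈ Ioi b ∧ M t * L t = x := by
  have key : ∀ u ∈ Ioi b, ∀ v ∈ Ioi b, M u * L u = x → M v * L v = x → ¬ u < v := by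
    intro u hu v hv hu' hv' huv
    have hu0 : 0 ≤ u := hb.trans (le_of_lt hu)
    have hv0 : 0 ≤ v := hb.trans (le_of_lt hv)
    have hLu : 0 < L u := by
      by_contra h
      have := mul_nonpos_of_nonneg_of_nonpos (hM.pos u hu0).le (not_lt.1 h)
      linarith
    have hL := hLm hu hv huv
    have hMM := hM.monotoneOn hu0 hv0 huv.le
    have : M u * L u < M v * L v :=
      mul_lt_mul_of_le_of_lt_of_nonneg_of_pos hMM hL hLu.le (hM.pos v hv0)
    linarith
  obtain ⟨t1, ht1, h1⟩ := h1
  obtain ⟨t2, ht2, h2⟩ := h2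
  have hM0 := hM.pos 0 le_rfl
  have ht10 : 0 ≤ t1 := hb.trans (le_of_lt ht1)
  have ht20 : 0 ≤ t2 := hb.trans (le_of_lt ht2)
  have hf : ContinuousOn (fun t => M t * L t) (Ioi b) :=
    (hM.continuousOn.mono fun t ht => hb.trans (le_of_lt ht)).mul hLc
  have hlo : M t1 * L t1 ≤ x :=
    (mul_nonpos_of_nonneg_of_nonpos (hM.pos t1 ht10).le h1).trans hx.le
  have hhi : x ≤ M t2 * L t2 := by
    have hMM : M 0 ≤ M t2 := hM.monotoneOn (mem_Ici.2 le_rfl) ht20 ht20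
    have h0 : 0 ≤ L t2 := (div_pos hx hM0).le.trans h2
    calc x = M 0 * (x / M 0) := by field_simp
      _ ≤ M 0 * L t2 := by gcongr
      _ ≤ M t2 * L t2 := by gcongr
  obtain ⟨t, ht, htx⟩ := isPreconnected_Ioi.intermediate_value ht1 ht2 hf ⟨hlo, hhi⟩
  refine ⟨t, ⟨ht, htx⟩, ?_⟩
  rintro u ⟨hu, hux⟩
  exact le_antisymm (not_lt.1 (key t ht u hu htx hux)) (not_lt.1 (key u hu t ht hux htx))

theorem log_growth_monotoneOn {K : ℝ → ℝ} (hK : IsGrowthFunction K) :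
    MonotoneOn (fun t => Real.log (K t)) (Ici 0) := fun u hu _ hv huv =>
  Real.log_le_log (hK.pos u hu) (hK.monotoneOn hu hv huv)

theorem log_growth_continuousOn {K : ℝ → ℝ} (hK : IsGrowthFunction K) :
    ContinuousOn (fun t => Real.log (K t)) (Ici 0) :=
  hK.continuousOn.log fun t ht => (hK.pos t ht).ne'

/-- For `x > 0` the equation `M_K(t) = x` has exactly one solution `t > 0`. -/
theorem existsUnique_MK {M K : ℝ → ℝ} (hM : IsGrowthFunction M) (hK : IsGrowthFunction K)
    {x : ℝ} (hx : 0 < x) : ∃! t, t ∈ Ioi (0 : ℝ) ∧ MK M K t = x := by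
  have hsub : Ioi (0 : ℝ) ⊆ Ici 0 := Ioi_subset_Ici_self
  refine existsUnique_aux (L := fun t => Real.log t + Real.log (K t)) le_rfl hM ?_ ?_ hx ?_ ?_
  · exact (Real.continuousOn_log.mono fun t ht => (ne_of_gt ht)).add
      ((log_growth_continuousOn hK).mono hsub)
  · exact (Real.strictMonoOn_log).add_monotone ((log_growth_monotoneOn hK).mono hsub)
  · refine ⟨min 1 (1 / K 1), ?_, ?_⟩
    · exact lt_min one_pos (one_div_pos.2 (hK.pos 1 zero_le_one))
    · have hK1 := hK.pos 1 zero_le_one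
      have hp : 0 < min 1 (1 / K 1) := lt_min one_pos (one_div_pos.2 hK1)
      have h1 : Real.log (min 1 (1 / K 1)) ≤ Real.log (1 / K 1) :=
        Real.log_le_log hp (min_le_right _ _)
      have h2 : Real.log (K (min 1 (1 / K 1))) ≤ Real.log (K 1) :=
        log_growth_monotoneOn hK hp.le (mem_Ici.2 zero_le_one) (min_le_left _ _)
      rw [one_div, Real.log_inv] at h1
      rw [one_div] at h2
      simp only [one_div]
      linarith
  · have hK0 := hK.pos 0 le_rfl
    refine ⟨Real.exp (x / M 0 - Real.log (K 0)), Real.exp_pos _, ?_⟩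
    have h2 := log_growth_monotoneOn hK (mem_Ici.2 le_rfl)
      (mem_Ici.2 (Real.exp_pos (x / M 0 - Real.log (K 0))).le)
      (Real.exp_pos (x / M 0 - Real.log (K 0))).le
    simp only [Real.log_exp] at h2 ⊢
    linarith

/-- For `x > 0` the equation `M_{K,log}(t) = x` has exactly one solution `t > 1`. -/
theorem existsUnique_MKlog {M K : ℝ → ℝ} (hM : IsGrowthFunction M) (hK : IsGrowthFunction K)
    {x : ℝ} (hx : 0 < x) : ∃! t, t ∈ Ioi (1 : ℝ) ∧ MKlog M K t = x := by
  have hsub : Ioi (1 : ℝ) ⊆ Ici 0 := fun t ht => mem_Ici.2 (zero_le_one.trans (le_of_lt (mem_Ioi.1 ht)))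
  have hlog : ∀ t ∈ Ioi (1 : ℝ), 0 < Real.log t := fun t ht => Real.log_pos ht
  have hlogc : ContinuousOn Real.log (Ioi (1 : ℝ)) :=
    Real.continuousOn_log.mono fun t ht => (ne_of_gt (zero_lt_one.trans ht))
  have hlogm : StrictMonoOn Real.log (Ioi (1 : ℝ)) :=
    Real.strictMonoOn_log.mono fun t ht => mem_Ioi.2 (zero_lt_one.trans (mem_Ioi.1 ht))
  refine existsUnique_aux
    (L := fun t => Real.log t + Real.log (Real.log t) + Real.log (K t))
    zero_le_one hM ?_ ?_ hx ?_ ?_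
  · exact (hlogc.add (hlogc.log fun t ht => (hlog t ht).ne')).add
      ((log_growth_continuousOn hK).mono hsub)
  · refine StrictMonoOn.add_monotone (hlogm.add ?_) ((log_growth_monotoneOn hK).mono hsub)
    intro u hu v hv huv
    exact Real.log_lt_log (hlog u hu) (hlogm hu hv huv)
  · set e := Real.exp 1
    have he : (0 : ℝ) ≤ e := (Real.exp_pos 1).le
    set u := min 1 (Real.exp (-1 - Real.log (K e))) with hu
    have hupos : 0 < u := lt_min one_pos (Real.exp_pos _)
    refine ⟨Real.exp u, Real.one_lt_exp_iff.2 hupos, ?_⟩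
    have h1 : u ≤ 1 := min_le_left _ _
    have h2 : Real.log u ≤ -1 - Real.log (K e) := by
      rw [Real.log_le_iff_le_exp hupos]
      exact min_le_right _ _
    have h3 := log_growth_monotoneOn hK (mem_Ici.2 (Real.exp_pos u).le) (mem_Ici.2 he)
      (Real.exp_le_exp.2 h1)
    simp only [Real.log_exp] at h3 ⊢
    linarith
  · set y := max 1 (x / M 0 - Real.log (K 0)) with hy
    have hy1 : 1 ≤ y := le_max_left _ _
    have hy2 : x / M 0 - Real.log (K 0) ≤ y := le_max_right _ _
    refine ⟨Real.exp y, Real.one_lt_exp_iff.2 (by linarith), ?_⟩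
    have h2 := log_growth_monotoneOn hK (mem_Ici.2 le_rfl)
      (mem_Ici.2 (Real.exp_pos y).le) (Real.exp_pos y).le
    have h3 := Real.log_nonneg hy1
    simp only [Real.log_exp] at h2 ⊢
    linarith

theorem MKInv_spec {M K : ℝ → ℝ} (hM : IsGrowthFunction M) (hK : IsGrowthFunction K)
    {x : ℝ} (hx : 0 < x) : 0 < MKInv M K x ∧ MK M K (MKInv M K x) = x :=
  have h : ∃ t ∈ Ioi (0 : ℝ), MK M K t = x := (existsUnique_MK hM hK hx).exists
  ⟨Function.invFunOn_mem h, Function.invFunOn_eq h⟩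

theorem MKlogInv_spec {M K : ℝ → ℝ} (hM : IsGrowthFunction M) (hK : IsGrowthFunction K)
    {x : ℝ} (hx : 0 < x) : 1 < MKlogInv M K x ∧ MKlog M K (MKlogInv M K x) = x :=
  have h : ∃ t ∈ Ioi (1 : ℝ), MKlog M K t = x := (existsUnique_MKlog hM hK hx).exists
  ⟨Function.invFunOn_mem h, Function.invFunOn_eq h⟩

end

end QuantTauber

open QuantTauber

/-!
**Upper bounds.** The idea is to smooth `S` with a nonnegative band-limited kernel at the scale
`1 / t`, to bound the smoothed function by shifting a contour to the boundary of `Ω_M` up to a height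
of order `t`, and to undo the smoothing with the one-sided Tauberian condition.

The kernel is `sincKernel`, that is `φ(y) = sinc(w y)^4 sinc(h y)^N` with `w` and `N h` of order
`t`. Since a factor `sinc` is the Fourier transform of an average over an interval, the integral
`∫ S(v) φ(x - v) dv` is the value at `s = 0` of `N + 4` successive averages of `g(s) e^{s x}` along
vertical segments (`iterate_vavg_smoothedLaplace`). By Cauchy's theorem an average over `Re s = r`
differs from one over `Re s = c` by the horizontal sides, on which one averaging fewer has been
performed and which carry the factor `1 / (2 h)`. Iterating, the shift from `0` to the line
`Re s = -1 / M(t)` costs the factor `exp(1 / (M(t) h))`, and a remainder with the factor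
`(1 / (M(t) h))^N / N!` (`norm_iterate_vavg_le_exp`, `norm_smoothedLaplace_le`). The factor amounts
to a translation of `x` by `1 / h`, which is of order `N / t`, and for `N` of the size of
`log (t K(t) log t)` the remainder is negligible. What is left is the integral of `g(s) e^{s x}`
over the boundary line. It is at most a multiple of `K(t) log t · e^{-x / M(t)}` in general, and the
logarithm disappears if `K` is of positive increase, or if `M` grows like a power of the logarithm,
when dyadic parts of low frequency are moved further to the left
(`boundary_integral_general`, `boundary_integral_positiveIncrease`, `boundary_integral_logPower`).

The Laplace transform is known only for `Re s > 0`; the passage to `Re s = 0` is by monotone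
convergence, because `S` is bounded below by an affine function
(`integrableOn_mul_kernel_of_bounded`). The increments of the non-decreasing function `S(x) + C x`
are nonnegative, so that their smoothed means bound them (`IsKernelAt.increment_le`); then the
smoothed value of `S` bounds `S` itself (`IsKernelAt.abs_le_of_increment`). This gives
`S(x) = O(1 / t)` as soon as `x ≥ M(t) Λ + 100 L / t`, where `L = log (t K(t) log t)`, and `Λ` is
`L` or `log (t K(t))` (`exists_decay`). The slack `100 L / t` is negligible compared with
`(1 / c - 1) M_{K,log}(t)`. If `M_{K,log}` is of `M(t) t / 675`-regular growth, replacing `t` by a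
constant multiple gains `675 L / t` in `M_{K,log}`, hence at least half of it in `M_K`, and so
absorbs the slack.

**Optimality.** For every large `t` there is a Lipschitz function in the class, with constants that
do not depend on `t`, which is at least a multiple of `1 / t` at `X = M_K(t)`. It is the wave packet
`n^{-2} Re ∫ ω(w) e^{w (x - X)} dτ` over the segment `w = -2 / M(t) + iτ`, `n ≤ τ ≤ 7 n`, where `n`
is a large multiple of `t`, and the entire function `ω` (`cutoff`) is of size one in the middle of
the strip and double exponentially small near the ends of the segment. The bound
`K(t) ≤ exp (exp (C'' t M(t)))` ensures that this smallness outweighs `e^{2 X / M(t)} = (t K(t))^2`,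
so the segment may be moved horizontally without loss. On the imaginary axis one reads off the
Lipschitz bound and the size at `X`. The Laplace transform is a Cauchy integral over the segment
(`packetTransform`), hence is analytic on a neighbourhood of `Ω_M`; at the heights of the segment it
is of size `e^{X / M(t)} = t K(t)`, and elsewhere it is smaller
(`norm_packetTransform_le_inside`, `norm_packetTransform_le_outside`, `exists_extremal_packet`).
If `1 / M_K⁻¹(x)` were not `O(r(x))`, evaluation of `ℓ¹` combinations of such packets along a
suitable sequence of points would give functionals that are pointwise bounded but not uniformly
bounded, contrary to the Banach–Steinhaus theorem (`isBigO_of_forall_lipschitzClass`).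
-/

/-! ### Averages along vertical segments -/

/-- The mean of `F` over the vertical segment of half-length `h` centred at `s`. -/
noncomputable def vavg (h : ℝ) (F : ℂ → ℂ) (s : ℂ) : ℂ :=
  ((2 * h : ℝ) : ℂ)⁻¹ * ∫ u in (-h)..h, F (s + u * Complex.I)

/-- Cauchy's theorem for the rectangles with left side on `Re s = c` that are contained in
`[c, d] × [-ρ, ρ]`, as an identity between integrals of `F`. -/
def RectShift (c d ρ : ℝ) (F : ℂ → ℂ) : Prop :=
  ∀ r ∈ Icc c d, ∀ v₁ ∈ Icc (-ρ) ρ, ∀ v₂ ∈ Icc (-ρ) ρ,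
    ∫ v in v₁..v₂, F (r + v * Complex.I) = (∫ v in v₁..v₂, F (c + v * Complex.I)) -
      Complex.I * ∫ x in c..r, (F (x + v₂ * Complex.I) - F (x + v₁ * Complex.I))

theorem continuous_vavg {F : ℂ → ℂ} (hF : Continuous F) (h : ℝ) : Continuous (vavg h F) := by
  unfold vavg
  refine continuous_const.mul ?_
  apply intervalIntegral.continuous_parametric_intervalIntegral_of_continuous'
  fun_prop

theorem norm_vavg_le {F : ℂ → ℂ} {h B : ℝ} (hh : 0 < h) {s : ℂ}
    (hB : ∀ u ∈ Icc (-h) h, ‖F (s + u * Complex.I)‖ ≤ B) : ‖vavg h F s‖ ≤ B := by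
  have h1 : ‖∫ u in (-h)..h, F (s + u * Complex.I)‖ ≤ B * |h - (-h)| := by
    apply intervalIntegral.norm_integral_le_of_norm_le_const
    intro u hu
    rw [uIoc_of_le (by linarith)] at hu
    exact hB u ⟨hu.1.le, hu.2⟩
  have h2 : |h - (-h)| = 2 * h := by rw [abs_of_pos (by linarith)]; ring
  rw [h2] at h1
  unfold vavg
  rw [norm_mul, norm_inv, Complex.norm_real, Real.norm_of_nonneg (by positivity)]
  rw [inv_mul_le_iff₀ (by positivity)]
  linarith

theorem vavg_eq_integral (h : ℝ) (F : ℂ → ℂ) (r v : ℝ) :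
    vavg h F (r + v * Complex.I) =
      ((2 * h : ℝ) : ℂ)⁻¹ * ∫ u in (v - h)..(v + h), F (r + u * Complex.I) := by
  unfold vavg
  congr 1
  have := intervalIntegral.integral_comp_add_left (a := -h) (b := h)
    (fun u : ℝ => F (r + u * Complex.I)) v
  rw [show v - h = v + -h by ring, ← this]
  congr 1
  ext u
  push_cast
  ring_nf

theorem RectShift.vavg {c d ρ h : ℝ} {F : ℂ → ℂ} (hF : Continuous F) (hh : 0 < h)
    (hR : RectShift c d ρ F) : RectShift c d (ρ - h) (vavg h F) := by
  intro r hr v₁ hv₁ v₂ hv₂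
  have hswap : ∀ (G : ℝ → ℝ → ℂ) (a b a' b' : ℝ), Continuous (Function.uncurry G) →
      ∫ x in a..b, ((2 * h : ℝ) : ℂ)⁻¹ * ∫ y in a'..b', G x y =
      ((2 * h : ℝ) : ℂ)⁻¹ * ∫ y in a'..b', ∫ x in a..b, G x y := by
    intro G a b a' b' hG
    rw [intervalIntegral.integral_const_mul]
    congr 1
    apply MeasureTheory.intervalIntegral_intervalIntegral_swap
    exact (hG.continuousOn.integrableOn_compact (isCompact_uIcc.prod isCompact_uIcc)).mono_set
      (prod_mono uIoc_subset_uIcc uIoc_subset_uIcc)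
  have key : ∀ u ∈ Icc (-h) h, ∫ v in v₁..v₂, F (r + v * Complex.I + u * Complex.I) =
      (∫ v in v₁..v₂, F (c + v * Complex.I + u * Complex.I)) -
        Complex.I * ∫ x in c..r, (F (x + v₂ * Complex.I + u * Complex.I) -
          F (x + v₁ * Complex.I + u * Complex.I)) := by
    intro u hu
    have e : ∀ q : ℝ, ∫ v in v₁..v₂, F (q + v * Complex.I + u * Complex.I) =
        ∫ v in (v₁ + u)..(v₂ + u), F (q + v * Complex.I) := by
      intro q
      have := intervalIntegral.integral_comp_add_right (a := v₁) (b := v₂)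
        (fun v : ℝ => F (q + v * Complex.I)) u
      rw [← this]
      congr 1; ext v; push_cast; ring_nf
    rw [e, e, hR r hr (v₁ + u) ⟨by linarith [hv₁.1, hu.1], by linarith [hv₁.2, hu.2]⟩ (v₂ + u)
      ⟨by linarith [hv₂.1, hu.1], by linarith [hv₂.2, hu.2]⟩]
    congr 2
    congr 1; ext x; push_cast; ring_nf
  simp only [_root_.vavg]
  rw [hswap (fun v u => F (r + v * Complex.I + u * Complex.I)) _ _ _ _ (by fun_prop),
    hswap (fun v u => F (c + v * Complex.I + u * Complex.I)) _ _ _ _ (by fun_prop)]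
  have hc : ∀ s : ℂ, IntervalIntegrable (fun u : ℝ => F (s + u * Complex.I)) volume (-h) h :=
    fun s => Continuous.intervalIntegrable (by fun_prop) _ _
  have e2 : ∀ x : ℝ, ((2 * h : ℝ) : ℂ)⁻¹ * (∫ u in (-h)..h, F (x + v₂ * Complex.I + u * Complex.I))
      - ((2 * h : ℝ) : ℂ)⁻¹ * (∫ u in (-h)..h, F (x + v₁ * Complex.I + u * Complex.I)) =
      ((2 * h : ℝ) : ℂ)⁻¹ * ∫ u in (-h)..h, (F (x + v₂ * Complex.I + u * Complex.I) -
        F (x + v₁ * Complex.I + u * Complex.I)) := by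
    intro x
    rw [intervalIntegral.integral_sub (hc _) (hc _), mul_sub]
  simp only [e2]
  rw [hswap (fun x u => F (x + v₂ * Complex.I + u * Complex.I) -
        F (x + v₁ * Complex.I + u * Complex.I)) _ _ _ _ (by fun_prop)]
  rw [mul_left_comm, ← mul_sub]
  congr 1
  rw [← intervalIntegral.integral_const_mul, ← intervalIntegral.integral_sub]
  · apply intervalIntegral.integral_congr
    intro u hu
    rw [uIcc_of_le (by linarith)] at hu
    exact key u hu
  · apply Continuous.intervalIntegrable
    apply intervalIntegral.continuous_parametric_intervalIntegral_of_continuous'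
    fun_prop
  · apply Continuous.intervalIntegrable
    refine continuous_const.mul ?_
    apply intervalIntegral.continuous_parametric_intervalIntegral_of_continuous'
    fun_prop

/-- One averaging step trades the value on `Re s = r` for the value on `Re s = c` and an
integral over the horizontal sides. -/
theorem norm_vavg_le_of_rectShift {c d ρ h A : ℝ} {F : ℂ → ℂ} {f : ℝ → ℝ}
    (hh : 0 < h) (hR : RectShift c d ρ F) (hf : Continuous f)
    (hA : ∀ v ∈ Icc (-(ρ - h)) (ρ - h), ‖vavg h F (c + v * Complex.I)‖ ≤ A)
    (hB : ∀ r ∈ Icc c d, ∀ v ∈ Icc (-ρ) ρ, ‖F (r + v * Complex.I)‖ ≤ f r) {r v : ℝ}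
    (hr : r ∈ Icc c d) (hv : v ∈ Icc (-(ρ - h)) (ρ - h)) :
    ‖vavg h F (r + v * Complex.I)‖ ≤ A + h⁻¹ * ∫ x in c..r, f x := by
  have hp : v + h ∈ Icc (-ρ) ρ := ⟨by linarith [hv.1], by linarith [hv.2]⟩
  have hm : v - h ∈ Icc (-ρ) ρ := ⟨by linarith [hv.1], by linarith [hv.2]⟩
  have e : vavg h F (r + v * Complex.I) = vavg h F (c + v * Complex.I) -
      ((2 * h : ℝ) : ℂ)⁻¹ * (Complex.I * ∫ x in c..r, (F (x + (v + h : ℝ) * Complex.I) -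
        F (x + (v - h : ℝ) * Complex.I))) := by
    rw [vavg_eq_integral, vavg_eq_integral, hR r hr _ hm _ hp, mul_sub]
  rw [e]
  refine (norm_sub_le _ _).trans (add_le_add (hA v hv) ?_)
  have h1 : ‖∫ x in c..r, (F (x + (v + h : ℝ) * Complex.I) - F (x + (v - h : ℝ) * Complex.I))‖ ≤
      ∫ x in c..r, 2 * f x := by
    apply intervalIntegral.norm_integral_le_of_norm_le hr.1
    · refine ae_of_all _ fun x hx => ?_
      have hx' : x ∈ Icc c d := ⟨hx.1.le, hx.2.trans hr.2⟩
      have := norm_sub_le (F (x + (v + h : ℝ) * Complex.I)) (F (x + (v - h : ℝ) * Complex.I))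
      linarith [hB x hx' _ hp, hB x hx' _ hm]
    · exact Continuous.intervalIntegrable (by fun_prop) _ _
  rw [intervalIntegral.integral_const_mul] at h1
  rw [norm_mul, norm_mul, Complex.norm_I, one_mul, norm_inv, Complex.norm_real,
    Real.norm_of_nonneg (by positivity)]
  calc (2 * h)⁻¹ * _ ≤ (2 * h)⁻¹ * (2 * ∫ x in c..r, f x) := by gcongr
    _ = h⁻¹ * ∫ x in c..r, f x := by field_simp

theorem RectShift.iterate_vavg {c d ρ h : ℝ} {F : ℂ → ℂ} (hF : Continuous F) (hh : 0 < h)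
    (hR : RectShift c d ρ F) (k : ℕ) :
    Continuous ((_root_.vavg h)^[k] F) ∧ RectShift c d (ρ - k * h) ((_root_.vavg h)^[k] F) := by
  induction k with
  | zero => simpa using ⟨hF, hR⟩
  | succ k ih =>
    rw [Function.iterate_succ_apply']
    refine ⟨continuous_vavg ih.1 h, ?_⟩
    have := RectShift.vavg ih.1 hh ih.2
    convert this using 1
    push_cast; ring

theorem norm_iterate_vavg_le {h B : ℝ} {F : ℂ → ℂ} (hh : 0 < h) {r ρ : ℝ}
    (hB : ∀ v ∈ Icc (-ρ) ρ, ‖F (r + v * Complex.I)‖ ≤ B) (k : ℕ) :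
    ∀ v ∈ Icc (-(ρ - k * h)) (ρ - k * h), ‖(vavg h)^[k] F (r + v * Complex.I)‖ ≤ B := by
  induction k with
  | zero => simpa using hB
  | succ k ih =>
    intro v hv
    rw [Function.iterate_succ_apply']
    push_cast at hv
    apply norm_vavg_le hh
    intro u hu
    have := ih (v + u) ⟨by linarith [hv.1, hu.1], by linarith [hv.2, hu.2]⟩
    rw [show (r : ℂ) + v * Complex.I + u * Complex.I = r + (v + u : ℝ) * Complex.I by
      push_cast; ring]
    exact this

/-- Shifting a `k`-fold average to the line `Re s = c` costs the factor `exp ((r - c) / h)`,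
and the horizontal sides contribute only `((r - c) / h) ^ k / k!`. -/
theorem norm_iterate_vavg_le_exp {c d ρ h A B : ℝ} {F : ℂ → ℂ} (hF : Continuous F) (hh : 0 < h)
    (hR : RectShift c d ρ F) (hA0 : 0 ≤ A)
    (hA : ∀ v ∈ Icc (-ρ) ρ, ‖F (c + v * Complex.I)‖ ≤ A)
    (hB : ∀ r ∈ Icc c d, ∀ v ∈ Icc (-ρ) ρ, ‖F (r + v * Complex.I)‖ ≤ B) (k : ℕ) :
    ∀ r ∈ Icc c d, ∀ v ∈ Icc (-(ρ - k * h)) (ρ - k * h),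
      ‖(vavg h)^[k] F (r + v * Complex.I)‖ ≤
        A * Real.exp ((r - c) / h) + B * ((r - c) / h) ^ k / k.factorial := by
  have main : ∀ k : ℕ, ∀ r ∈ Icc c d, ∀ v ∈ Icc (-(ρ - k * h)) (ρ - k * h),
      ‖(vavg h)^[k] F (r + v * Complex.I)‖ ≤
        A * (∑ j ∈ Finset.range k, ((r - c) / h) ^ j / j.factorial) +
          B * (((r - c) / h) ^ k / k.factorial) := by
    intro k
    induction k with
    | zero => simpa using hB
    | succ k ih =>
      intro r hr v hv
      have hv' : v ∈ Icc (-(ρ - k * h - h)) (ρ - k * h - h) := by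
        push_cast at hv
        exact ⟨by linarith [hv.1], by linarith [hv.2]⟩
      have hreg := RectShift.iterate_vavg hF hh hR k
      have hint : ∀ j : ℕ, h⁻¹ * ∫ x in c..r, ((x - c) / h) ^ j / j.factorial =
          ((r - c) / h) ^ (j + 1) / (j + 1).factorial := by
        intro j
        have : ∀ x ∈ uIcc c r, HasDerivAt
            (fun x => h * (((x - c) / h) ^ (j + 1) / (j + 1).factorial))
            (((x - c) / h) ^ j / j.factorial) x := by
          intro x _
          have h1 : HasDerivAt (fun x : ℝ => (x - c) / h) (1 / h) x :=
            ((hasDerivAt_id x).sub_const c).div_const h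
          have h2 := ((h1.pow (j + 1)).div_const ((j + 1).factorial : ℝ)).const_mul h
          refine h2.congr_deriv ?_
          rw [Nat.factorial_succ]
          have : ((j.factorial : ℕ) : ℝ) ≠ 0 := by positivity
          push_cast
          field_simp
        rw [intervalIntegral.integral_eq_sub_of_hasDerivAt this
          (Continuous.intervalIntegrable (by fun_prop) _ _)]
        simp
        field_simp
      have := norm_vavg_le_of_rectShift (A := A)
        (f := fun x => A * (∑ j ∈ Finset.range k, ((x - c) / h) ^ j / j.factorial) +
          B * (((x - c) / h) ^ k / k.factorial)) hh hreg.2 (by fun_prop)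
        (by
          intro w hw
          rw [← Function.iterate_succ_apply' (vavg h) k F]
          apply norm_iterate_vavg_le hh hA (k + 1)
          push_cast
          exact ⟨by linarith [hw.1], by linarith [hw.2]⟩)
        (fun x hx w hw => ih x hx w hw) hr hv'
      rw [← Function.iterate_succ_apply' (vavg h) k F] at this
      refine this.trans (le_of_eq ?_)
      rw [intervalIntegral.integral_add (Continuous.intervalIntegrable (by fun_prop) _ _)
        (Continuous.intervalIntegrable (by fun_prop) _ _), intervalIntegral.integral_const_mul,
        intervalIntegral.integral_const_mul, intervalIntegral.integral_finsetSum
        (fun j _ => Continuous.intervalIntegrable (by fun_prop) _ _), Finset.sum_range_succ']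
      rw [mul_add, ← mul_assoc, mul_comm h⁻¹ A, mul_assoc, Finset.mul_sum, ← mul_assoc h⁻¹ B,
        mul_comm h⁻¹ B, mul_assoc B, hint]
      simp only [hint]
      simp
      ring
  intro r hr v hv
  refine (main k r hr v hv).trans ?_
  rw [mul_div_assoc]
  gcongr
  exact Real.sum_le_exp_of_nonneg (div_nonneg (by linarith [hr.1]) hh.le) k

/-! ### Band-limited kernels -/

/-- The kernel `sinc (w y) ^ 4 * sinc (h y) ^ N`, the Fourier transform of a probability
measure on `[-(4 w + N h), 4 w + N h]`. The first factor gives integrability at the scale `1 / w`,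
the second one makes the kernel exponentially small in `N` beyond the scale `1 / h`. -/
noncomputable def sincKernel (w h : ℝ) (N : ℕ) (y : ℝ) : ℝ :=
  Real.sinc (w * y) ^ 4 * Real.sinc (h * y) ^ N

theorem continuous_sincKernel (w h : ℝ) (N : ℕ) : Continuous (sincKernel w h N) := by
  have := Real.continuous_sinc
  unfold sincKernel
  fun_prop

theorem sincKernel_nonneg (w h : ℝ) {N : ℕ} (hN : Even N) (y : ℝ) : 0 ≤ sincKernel w h N y :=
  mul_nonneg (Even.pow_nonneg (by decide) _) (hN.pow_nonneg _)

theorem sincKernel_neg (w h : ℝ) (N : ℕ) (y : ℝ) : sincKernel w h N (-y) = sincKernel w h N y := by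
  simp [sincKernel, Real.sinc_neg]

theorem abs_sinc_mul_abs_le_one (z : ℝ) : |Real.sinc z| * |z| ≤ 1 := by
  rcases eq_or_ne z 0 with rfl | hz
  · simp
  · rw [← abs_mul, Real.sinc_of_ne_zero hz, div_mul_cancel₀ _ hz]
    exact Real.abs_sin_le_one z

theorem sinc_pow_four_le (z : ℝ) : Real.sinc z ^ 4 ≤ 4 / (1 + z ^ 2) ^ 2 := by
  have h1 := Real.abs_sinc_le_one z
  have h2 := abs_sinc_mul_abs_le_one z
  have h3 : Real.sinc z ^ 2 * (1 + z ^ 2) ≤ 2 := by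
    have a1 : Real.sinc z ^ 2 ≤ 1 := by rw [← sq_abs]; nlinarith [abs_nonneg (Real.sinc z)]
    have a2 : Real.sinc z ^ 2 * z ^ 2 ≤ 1 := by
      rw [← sq_abs, ← sq_abs z, ← mul_pow]
      exact pow_le_one₀ (by positivity) h2
    linarith
  rw [le_div_iff₀ (by positivity)]
  have h4 : 0 ≤ Real.sinc z ^ 2 * (1 + z ^ 2) := by positivity
  calc Real.sinc z ^ 4 * (1 + z ^ 2) ^ 2 = (Real.sinc z ^ 2 * (1 + z ^ 2)) ^ 2 := by ring
    _ ≤ 2 ^ 2 := by gcongr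
    _ = 4 := by norm_num

theorem sincKernel_le (w h : ℝ) (N : ℕ) (y : ℝ) :
    sincKernel w h N y ≤ 4 / (1 + (w * y) ^ 2) ^ 2 := by
  refine le_trans ?_ (sinc_pow_four_le (w * y))
  have h1 : Real.sinc (h * y) ^ N ≤ 1 :=
    (le_abs_self _).trans (by rw [abs_pow]; exact pow_le_one₀ (abs_nonneg _) (Real.abs_sinc_le_one _))
  exact mul_le_of_le_one_right (Even.pow_nonneg (by decide) _) h1

theorem sincKernel_tail_le (w : ℝ) {h y : ℝ} (N : ℕ) (hy : 3 ≤ |h * y|) :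
    sincKernel w h N y ≤ (1 / 3) ^ N * (4 / (1 + (w * y) ^ 2) ^ 2) := by
  have h1 : |Real.sinc (h * y)| ≤ 1 / 3 := by
    have := abs_sinc_mul_abs_le_one (h * y)
    have h0 := abs_nonneg (Real.sinc (h * y))
    nlinarith
  have h2 : Real.sinc (h * y) ^ N ≤ (1 / 3) ^ N :=
    (le_abs_self _).trans (by rw [abs_pow]; gcongr)
  have h3 : 0 ≤ Real.sinc (w * y) ^ 4 := Even.pow_nonneg (by decide) _
  unfold sincKernel
  rw [mul_comm]
  exact mul_le_mul h2 (sinc_pow_four_le _) h3 (by positivity)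

theorem sinc_ge {z : ℝ} (hz : |z| ≤ 1) : 1 - z ^ 2 / 4 ≤ Real.sinc z := by
  have main : ∀ z : ℝ, 0 < z → z ≤ 1 → 1 - z ^ 2 / 4 ≤ Real.sinc z := by
    intro z h0 h1
    rw [Real.sinc_of_ne_zero h0.ne', le_div_iff₀ h0]
    have := Real.sin_gt_sub_cube h0
    nlinarith [pow_pos h0 3]
  rcases lt_trichotomy z 0 with h | rfl | h
  · have := main (-z) (by linarith) (by rw [abs_of_neg h] at hz; exact hz)
    rwa [Real.sinc_neg, neg_sq] at this
  · simp
  · exact main z h (by rwa [abs_of_pos h] at hz)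

theorem sincKernel_ge {w y : ℝ} {N : ℕ} (hN : 8 ≤ N) (hy : |w * y| ≤ 1) :
    1 / 8 ≤ sincKernel w (4 * w / N) N y := by
  have hN' : (8 : ℝ) ≤ N := by exact_mod_cast hN
  have hN0 : (0 : ℝ) < N := by linarith
  have h1 : 3 / 4 ≤ Real.sinc (w * y) := by
    have := sinc_ge hy
    have h2 : (w * y) ^ 2 ≤ 1 := by rw [← sq_abs]; exact pow_le_one₀ (abs_nonneg _) hy
    linarith
  have e : 4 * w / N * y = 4 / N * (w * y) := by ring
  have h3 : |4 * w / N * y| ≤ 4 / N := by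
    rw [e, abs_mul, abs_of_pos (by positivity)]
    exact mul_le_of_le_one_right (by positivity) hy
  have h4 : (4 : ℝ) / N ≤ 1 := by rw [div_le_one hN0]; linarith
  have h5 : 1 - 4 / (N : ℝ) ^ 2 ≤ Real.sinc (4 * w / N * y) := by
    have := sinc_ge (h3.trans h4)
    have h6 : (4 * w / N * y) ^ 2 ≤ (4 / N) ^ 2 := by
      rw [← sq_abs]; gcongr
    have : (4 / (N : ℝ)) ^ 2 / 4 = 4 / (N : ℝ) ^ 2 := by field_simp
    linarith
  have h6 : 1 / 2 ≤ Real.sinc (4 * w / N * y) ^ N := by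
    have h7 : (4 : ℝ) / N ^ 2 ≤ 1 := by
      rw [div_le_one (by positivity)]; nlinarith
    have h8 := one_add_mul_le_pow (a := -(4 / (N : ℝ) ^ 2)) (by linarith) N
    have h9 : (1 + -(4 / (N : ℝ) ^ 2)) ^ N ≤ Real.sinc (4 * w / N * y) ^ N := by
      gcongr
      · linarith
      · linarith
    have h10 : (N : ℝ) * -(4 / (N : ℝ) ^ 2) = -(4 / N) := by field_simp
    have h11 : (4 : ℝ) / N ≤ 1 / 2 := by rw [div_le_div_iff₀ hN0 (by norm_num)]; linarith
    linarith
  unfold sincKernel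
  have h12 : (3 / 4 : ℝ) ^ 4 ≤ Real.sinc (w * y) ^ 4 := by gcongr
  calc (1 / 8 : ℝ) ≤ (3 / 4) ^ 4 * (1 / 2) := by norm_num
    _ ≤ _ := by gcongr

/-! ### Smoothed Laplace transforms -/

/-- The Laplace transform of `S`, translated by `x` and weighted by `φ`:
`∫₀^∞ e^{s (x - v)} S(v) φ(x - v) dv`. -/
noncomputable def smoothedLaplace (S φ : ℝ → ℝ) (x : ℝ) (s : ℂ) : ℂ :=
  ∫ v in Ioi (0 : ℝ), Complex.exp (-s * v) * S v * (Complex.exp (s * x) * φ (x - v))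

theorem smoothedLaplace_one (S : ℝ → ℝ) (x : ℝ) (s : ℂ) :
    smoothedLaplace S (fun _ => 1) x s = laplace S s * Complex.exp (s * x) := by
  unfold smoothedLaplace laplace
  rw [← integral_mul_const]
  simp

theorem integral_exp_vertical (h y : ℝ) :
    ∫ u in (-h)..h, Complex.exp (u * Complex.I * y) = ((2 * h : ℝ) : ℂ) * Real.sinc (h * y) := by
  rcases eq_or_ne y 0 with rfl | hy
  · simp; ring
  · have h1 := intervalIntegral.integral_comp_mul_right (a := -h) (b := h)
      (fun t : ℝ => Complex.exp (t * Complex.I)) hy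
    have h2 : ∀ u : ℝ, Complex.exp (u * Complex.I * y) = Complex.exp ((u * y : ℝ) * Complex.I) := by
      intro u; congr 1; push_cast; ring
    simp only [h2]
    rw [h1, neg_mul, integral_exp_mul_I_eq_sinc]
    have : (y : ℂ) ≠ 0 := by exact_mod_cast hy
    simp only [Complex.real_smul]
    push_cast
    field_simp

theorem vavg_smoothedLaplace {S φ : ℝ → ℝ} (hS : LaplaceConverges S) (hφ : Continuous φ)
    (hφ1 : ∀ y, |φ y| ≤ 1) {h : ℝ} (hh : 0 < h) (x : ℝ) {s : ℂ} (hs : 0 < s.re) :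
    vavg h (smoothedLaplace S φ x) s =
      smoothedLaplace S (fun y => φ y * Real.sinc (h * y)) x s := by
  have hsplit : ∀ (u v : ℝ), Complex.exp (-(s + u * Complex.I) * v) * S v *
      (Complex.exp ((s + u * Complex.I) * x) * φ (x - v)) =
      (Complex.exp (u * Complex.I * (x - v : ℝ)) * (Complex.exp (s * x) * φ (x - v))) *
        (Complex.exp (-s * v) * S v) := by
    intro u v
    have : Complex.exp (-(s + u * Complex.I) * v) * Complex.exp ((s + u * Complex.I) * x) =
        Complex.exp (u * Complex.I * (x - v : ℝ)) * Complex.exp (s * x) * Complex.exp (-s * v) := by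
      rw [← Complex.exp_add, ← Complex.exp_add, ← Complex.exp_add]
      congr 1; push_cast; ring
    linear_combination (S v * φ (x - v) : ℂ) * this
  have hint : Integrable (Function.uncurry fun (u : ℝ) (v : ℝ) =>
      (Complex.exp (u * Complex.I * (x - v : ℝ)) * (Complex.exp (s * x) * φ (x - v))) *
        (Complex.exp (-s * v) * S v))
      ((volume.restrict (Set.uIoc (-h) h)).prod (volume.restrict (Ioi (0 : ℝ)))) := by
    have : IsFiniteMeasure (volume.restrict (Set.uIoc (-h) h)) := by
      rw [uIoc_of_le (by linarith)]; infer_instance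
    have h1 : Integrable (fun p : ℝ × ℝ => Complex.exp (-s * p.2) * S p.2)
      ((volume.restrict (Set.uIoc (-h) h)).prod (volume.restrict (Ioi (0 : ℝ)))) :=
      Integrable.comp_snd (hS s hs) _
    refine Integrable.bdd_mul (c := ‖Complex.exp (s * x)‖) h1 ?_ (ae_of_all _ ?_)
    · apply Continuous.aestronglyMeasurable
      fun_prop
    · rintro ⟨u, v⟩
      simp only [norm_mul]
      have : u * Complex.I * (x - v : ℝ) = (u * (x - v) : ℝ) * Complex.I := by push_cast; ring
      rw [this, Complex.norm_exp_ofReal_mul_I, one_mul, Complex.norm_real]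
      exact mul_le_of_le_one_right (norm_nonneg _) (hφ1 _)
  unfold vavg smoothedLaplace
  simp only [hsplit]
  rw [intervalIntegral_integral_swap hint, ← integral_const_mul]
  congr 1
  ext v
  have e : ∀ u : ℝ, Complex.exp (u * Complex.I * (x - v : ℝ)) *
      (Complex.exp (s * x) * φ (x - v)) * (Complex.exp (-s * v) * S v) =
      Complex.exp (u * Complex.I * (x - v : ℝ)) * ((Complex.exp (s * x) * φ (x - v)) *
        (Complex.exp (-s * v) * S v)) := fun u => mul_assoc _ _ _
  simp only [e]
  rw [intervalIntegral.integral_mul_const, integral_exp_vertical]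
  have hh' : (h : ℂ) ≠ 0 := by exact_mod_cast hh.ne'
  push_cast
  field_simp

theorem vavg_congr {F G : ℂ → ℂ} {h : ℝ} {s : ℂ} (hh : 0 < h)
    (hFG : ∀ u ∈ Icc (-h) h, F (s + u * Complex.I) = G (s + u * Complex.I)) :
    vavg h F s = vavg h G s := by
  unfold vavg
  congr 1
  apply intervalIntegral.integral_congr
  intro u hu
  rw [uIcc_of_le (by linarith)] at hu
  exact hFG u hu

theorem iterate_vavg_smoothedLaplace {S φ : ℝ → ℝ} (hS : LaplaceConverges S) (hφ : Continuous φ)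
    (hφ1 : ∀ y, |φ y| ≤ 1) {h : ℝ} (hh : 0 < h) (x : ℝ) (k : ℕ) {s : ℂ} (hs : 0 < s.re) :
    (vavg h)^[k] (smoothedLaplace S φ x) s =
      smoothedLaplace S (fun y => φ y * Real.sinc (h * y) ^ k) x s := by
  induction k generalizing s with
  | zero => simp
  | succ k ih =>
    have hc := Real.continuous_sinc
    rw [Function.iterate_succ_apply']
    have e : vavg h ((vavg h)^[k] (smoothedLaplace S φ x)) s =
        vavg h (smoothedLaplace S (fun y => φ y * Real.sinc (h * y) ^ k) x) s := by
      exact vavg_congr hh fun u _ => ih (by simpa using hs)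
    rw [e, vavg_smoothedLaplace hS (by fun_prop) _ hh x hs]
    · congr 1; ext y; ring
    · intro y
      rw [abs_mul, abs_pow]
      exact mul_le_one₀ (hφ1 y) (by positivity)
        (pow_le_one₀ (abs_nonneg _) (Real.abs_sinc_le_one _))

theorem iterate_vavg_congr {F G : ℂ → ℂ} {h r ρ : ℝ} (hh : 0 < h)
    (hFG : ∀ v ∈ Icc (-ρ) ρ, F (r + v * Complex.I) = G (r + v * Complex.I)) (k : ℕ) :
    ∀ v ∈ Icc (-(ρ - k * h)) (ρ - k * h),
      (vavg h)^[k] F (r + v * Complex.I) = (vavg h)^[k] G (r + v * Complex.I) := by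
  induction k with
  | zero => simpa using hFG
  | succ k ih =>
    intro v hv
    rw [Function.iterate_succ_apply', Function.iterate_succ_apply']
    push_cast at hv
    refine vavg_congr hh fun u hu => ?_
    have := ih (v + u) ⟨by linarith [hv.1, hu.1], by linarith [hv.2, hu.2]⟩
    rw [show (r : ℂ) + v * Complex.I + u * Complex.I = r + (v + u : ℝ) * Complex.I by
      push_cast; ring]
    exact this

/-! ### The Tauberian argument -/

theorem integrable_inv_one_add_div_sq {b : ℝ} (hb : 0 < b) :
    Integrable (fun y : ℝ => 1 / (1 + (y / b) ^ 2)) := by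
  have := (integrable_inv_one_add_sq).comp_div hb.ne'
  simpa [one_div] using this

theorem integral_inv_one_add_div_sq_le {b : ℝ} (hb : 0 < b) :
    ∫ y : ℝ, 1 / (1 + (y / b) ^ 2) ≤ 4 * b := by
  have h := Measure.integral_comp_div (fun y : ℝ => (1 + y ^ 2)⁻¹) b
  simp only [one_div]
  rw [h, integral_univ_inv_one_add_sq, abs_of_pos hb, smul_eq_mul]
  nlinarith [Real.pi_lt_four]

/-- A nonnegative kernel concentrated on the scale `b`. The decay of order `4` makes
`(b + |y|) φ y` integrable, so that `φ` may be paired with functions of linear growth. -/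
structure IsKernelAt (b : ℝ) (φ : ℝ → ℝ) : Prop where
  continuous : Continuous φ
  nonneg : ∀ y, 0 ≤ φ y
  le : ∀ y, φ y ≤ 4 / (1 + (y / b) ^ 2) ^ 2
  ge : ∀ y, |y| ≤ b → 1 / 8 ≤ φ y

theorem one_add_abs_mul_le (z : ℝ) : (1 + |z|) * (4 / (1 + z ^ 2) ^ 2) ≤ 8 * (1 / (1 + z ^ 2)) := by
  have h1 : 1 + |z| ≤ 2 * (1 + z ^ 2) := by
    rw [← sq_abs]; nlinarith [sq_nonneg (|z| - 1), abs_nonneg z]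
  rw [mul_div_assoc', mul_one_div, div_le_div_iff₀ (by positivity) (by positivity)]
  have h2 : 0 < 1 + z ^ 2 := by positivity
  nlinarith [mul_le_mul_of_nonneg_right h1 h2.le]

namespace IsKernelAt

variable {b : ℝ} {φ : ℝ → ℝ}

theorem weighted_le (hφ : IsKernelAt b φ) (hb : 0 < b) (y : ℝ) :
    (b + |y|) * φ y ≤ 8 * b * (1 / (1 + (y / b) ^ 2)) := by
  have h1 := one_add_abs_mul_le (y / b)
  have e : b + |y| = b * (1 + |y / b|) := by
    rw [abs_div, abs_of_pos hb]; field_simp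
  rw [e]
  calc b * (1 + |y / b|) * φ y ≤ b * (1 + |y / b|) * (4 / (1 + (y / b) ^ 2) ^ 2) := by
        gcongr; exact hφ.le y
    _ ≤ b * (8 * (1 / (1 + (y / b) ^ 2))) := by rw [mul_assoc]; gcongr
    _ = _ := by ring

theorem le' (hφ : IsKernelAt b φ) (y : ℝ) : φ y ≤ 4 * (1 / (1 + (y / b) ^ 2)) := by
  refine (hφ.le y).trans ?_
  have : (1 : ℝ) ≤ 1 + (y / b) ^ 2 := by nlinarith [sq_nonneg (y / b)]
  rw [mul_one_div]
  gcongr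
  nlinarith

theorem integrable_weighted (hφ : IsKernelAt b φ) (hb : 0 < b) :
    Integrable (fun y => (b + |y|) * φ y) := by
  refine ((integrable_inv_one_add_div_sq hb).const_mul (8 * b)).mono' ?_ (ae_of_all _ fun y => ?_)
  · have := hφ.continuous
    exact (by fun_prop : Continuous (fun y => (b + |y|) * φ y)).aestronglyMeasurable
  · rw [Real.norm_of_nonneg (mul_nonneg (by positivity) (hφ.nonneg y))]
    exact hφ.weighted_le hb y

theorem integrable (hφ : IsKernelAt b φ) (hb : 0 < b) : Integrable φ := by
  refine ((integrable_inv_one_add_div_sq hb).const_mul 4).mono' hφ.continuous.aestronglyMeasurable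
    (ae_of_all _ fun y => ?_)
  rw [Real.norm_of_nonneg (hφ.nonneg y)]
  exact hφ.le' y

theorem integral_le (hφ : IsKernelAt b φ) (hb : 0 < b) : ∫ y, φ y ≤ 16 * b := by
  have h1 := integral_mono (hφ.integrable hb) ((integrable_inv_one_add_div_sq hb).const_mul 4) hφ.le'
  rw [integral_const_mul] at h1
  linarith [integral_inv_one_add_div_sq_le hb]

theorem le_integral (hφ : IsKernelAt b φ) (hb : 0 < b) : b / 4 ≤ ∫ y, φ y := by
  have h1 : ∫ y in (-b)..b, (1 / 8 : ℝ) ≤ ∫ y in (-b)..b, φ y := by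
    apply intervalIntegral.integral_mono_on (by linarith) (by simp)
      (hφ.continuous.intervalIntegrable _ _)
    intro y hy
    exact hφ.ge y (abs_le.2 hy)
  rw [intervalIntegral.integral_const, intervalIntegral.integral_of_le (by linarith)] at h1
  have h2 := setIntegral_le_integral (hφ.integrable hb) (ae_of_all _ hφ.nonneg) (s := Ioc (-b) b)
  rw [smul_eq_mul] at h1
  linarith

/-- If the increments of `f` at `x` are controlled and the mean of `f` near `x` is small, then
`f x` is small. -/
theorem abs_le_of_increment (hφ : IsKernelAt b φ) (hb : 0 < b) {f : ℝ → ℝ} {E G x : ℝ}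
    (hint : Integrable (fun y => f (x + y) * φ y))
    (hJ : |∫ y, f (x + y) * φ y| ≤ E * b ^ 2)
    (hG : ∀ y, |f (x + y) - f x| * φ y ≤ G * b * (1 / (1 + (y / b) ^ 2))) (hG0 : 0 ≤ G) :
    |f x| ≤ 4 * (E + 4 * G) * b := by
  have h1 : ∫ y, f (x + y) * φ y = (∫ y, (f (x + y) - f x) * φ y) + f x * ∫ y, φ y := by
    rw [← integral_const_mul, ← integral_add]
    · congr 1; ext y; ring
    · have := hint.sub ((hφ.integrable hb).const_mul (f x))
      refine this.congr (ae_of_all _ fun y => ?_)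
      simp only [Pi.sub_apply]; ring
    · exact (hφ.integrable hb).const_mul _
  have h2 : |∫ y, (f (x + y) - f x) * φ y| ≤ G * b * (4 * b) := by
    have := norm_integral_le_of_norm_le ((integrable_inv_one_add_div_sq hb).const_mul (G * b))
      (f := fun y => (f (x + y) - f x) * φ y) (ae_of_all _ fun y => by
        rw [norm_mul, Real.norm_eq_abs, Real.norm_of_nonneg (hφ.nonneg y)]
        exact hG y)
    rw [integral_const_mul, Real.norm_eq_abs] at this
    refine this.trans ?_
    gcongr
    exact integral_inv_one_add_div_sq_le hb
  have h3 := hφ.le_integral hb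
  have h4 : |f x| * ∫ y, φ y ≤ E * b ^ 2 + G * b * (4 * b) := by
    have h5 : f x * ∫ y, φ y = (∫ y, f (x + y) * φ y) - ∫ y, (f (x + y) - f x) * φ y := by linarith
    have h6 : |f x| * ∫ y, φ y = |f x * ∫ y, φ y| := by
      rw [abs_mul, abs_of_nonneg (a := ∫ y, φ y) (by linarith)]
    rw [h6, h5]
    exact (abs_sub _ _).trans (add_le_add hJ h2)
  have h7 : |f x| * (b / 4) ≤ E * b ^ 2 + G * b * (4 * b) :=
    (mul_le_mul_of_nonneg_left h3 (abs_nonneg _)).trans h4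
  have h8 : |f x| * b ≤ (4 * (E + 4 * G) * b) * b := by nlinarith
  exact le_of_mul_le_mul_right h8 hb

/-- The monotone function `f + C v + D 1_{v ≥ 0}` has increments `O(b)` on the scale `b`,
because its increments are nonnegative and their mean against `φ` is small. -/
theorem increment_le (hφ : IsKernelAt b φ) (hb : 0 < b) {f : ℝ → ℝ} {C D E x₀ : ℝ} (hC : 0 ≤ C)
    (hmono : Monotone (fun v => f v + C * v + D * (Ici (0 : ℝ)).indicator 1 v))
    (hx₀ : 0 ≤ x₀) (hint : ∀ x, x₀ ≤ x → Integrable (fun y => f (x + y) * φ y))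
    (hJ : ∀ x, x₀ ≤ x → |∫ y, f (x + y) * φ y| ≤ E * b ^ 2)
    (hD : ∀ y, y ≤ -x₀ → D * φ y ≤ E * b) {v : ℝ} (hv : x₀ + b ≤ v) :
    f (v + b) - f v ≤ (20 * E + 192 * C) * b := by
  set x := v - b with hx
  have hxx : x₀ ≤ x := by rw [hx]; linarith
  set α := fun v => f v + C * v + D * (Ici (0 : ℝ)).indicator 1 v with hα
  have hφi := hφ.integrable hb
  have hI1 : Integrable (fun y => f (x + 3 * b + y) * φ y - f (x + y) * φ y) :=
    (hint (x + 3 * b) (by linarith)).sub (hint x hxx)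
  have hI2 : Integrable (fun y => 3 * C * b * φ y) := hφi.const_mul _
  have hI3 : Integrable (fun y => (Ico (-x - 3 * b) (-x)).indicator (fun y => D * φ y) y) :=
    (hφi.const_mul D).indicator measurableSet_Ico
  have hI12 : Integrable
      (fun y => f (x + 3 * b + y) * φ y - f (x + y) * φ y + 3 * C * b * φ y) := hI1.add hI2
  have hsum : ∀ y, (α (x + 3 * b + y) - α (x + y)) * φ y =
      (f (x + 3 * b + y) * φ y - f (x + y) * φ y) + 3 * C * b * φ y +
      (Ico (-x - 3 * b) (-x)).indicator (fun y => D * φ y) y := by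
    intro y
    simp only [hα, indicator, mem_Ici, mem_Ico, Pi.one_apply]
    split_ifs with h1 h2 h3 h4 h5 h6 h7
    · linarith [h3.2]
    · ring
    · ring
    · exfalso; exact h4 ⟨by linarith, by linarith⟩
    · exfalso; linarith
    · exfalso; linarith
    · exfalso; linarith [h7.1]
    · ring
  have hI : Integrable (fun y => (α (x + 3 * b + y) - α (x + y)) * φ y) := by
    simp only [hsum]
    exact hI12.add hI3
  have hup : ∫ y, (α (x + 3 * b + y) - α (x + y)) * φ y ≤
      2 * (E * b ^ 2) + 3 * C * b * (16 * b) + 3 * b * (E * b) := by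
    have e : ∫ y, (α (x + 3 * b + y) - α (x + y)) * φ y =
        ((∫ y, f (x + 3 * b + y) * φ y) - ∫ y, f (x + y) * φ y) + (∫ y, 3 * C * b * φ y) +
        ∫ y, (Ico (-x - 3 * b) (-x)).indicator (fun y => D * φ y) y := by
      simp only [hsum]
      rw [integral_add hI12 hI3, integral_add hI1 hI2, integral_sub
        (hint (x + 3 * b) (by linarith)) (hint x hxx)]
    rw [e]
    have a1 := (abs_le.1 (hJ (x + 3 * b) (by linarith))).2
    have a2 := (abs_le.1 (hJ x hxx)).1
    have a3 : ∫ y, 3 * C * b * φ y ≤ 3 * C * b * (16 * b) := by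
      rw [integral_const_mul]
      gcongr
      exact hφ.integral_le hb
    have a4 : ∫ y, (Ico (-x - 3 * b) (-x)).indicator (fun y => D * φ y) y ≤ 3 * b * (E * b) := by
      rw [integral_indicator measurableSet_Ico]
      have : ∫ y in Ico (-x - 3 * b) (-x), D * φ y ≤ ∫ y in Ico (-x - 3 * b) (-x), E * b := by
        apply setIntegral_mono_on (hφi.const_mul D).integrableOn
          (continuous_const.integrableOn_Icc.mono_set Ico_subset_Icc_self) measurableSet_Ico
        intro y hy
        exact hD y (by linarith [hy.2])
      refine this.trans (le_of_eq ?_)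
      rw [setIntegral_const, Real.volume_real_Ico_of_le (by linarith), smul_eq_mul]
      ring
    linarith
  -- For `|y| ≤ b` the interval from `x + y` to `x + 3 b + y` contains `[v, v + b]`, so that the mean
  -- of the increments of `α` over distance `3 b` dominates `α (v + b) - α v`.
  have hlow : b / 4 * (α (v + b) - α v) ≤ ∫ y, (α (x + 3 * b + y) - α (x + y)) * φ y := by
    have h0 : ∀ y, 0 ≤ (α (x + 3 * b + y) - α (x + y)) * φ y := fun y =>
      mul_nonneg (sub_nonneg.2 (hmono (by linarith))) (hφ.nonneg y)
    refine le_trans ?_ (setIntegral_le_integral hI (ae_of_all _ h0) (s := Icc (-b) b))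
    have : ∫ y in Icc (-b) b, (α (v + b) - α v) * (1 / 8) ≤
        ∫ y in Icc (-b) b, (α (x + 3 * b + y) - α (x + y)) * φ y := by
      apply setIntegral_mono_on continuous_const.integrableOn_Icc hI.integrableOn measurableSet_Icc
      intro y hy
      have h1 : α (v + b) ≤ α (x + 3 * b + y) := hmono (by linarith [hy.1])
      have h2 : α (x + y) ≤ α v := hmono (by linarith [hy.2])
      have h3 : α v ≤ α (v + b) := hmono (by linarith)
      exact mul_le_mul (by linarith) (hφ.ge y (abs_le.2 hy)) (by norm_num) (by linarith)
    refine le_trans (le_of_eq ?_) this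
    rw [setIntegral_const, Real.volume_real_Icc_of_le (by linarith), smul_eq_mul]
    ring
  have h1 : (b / 4) * (α (v + b) - α v) ≤ (b / 4) * ((20 * E + 192 * C) * b) := by
    nlinarith
  have h2 := le_of_mul_le_mul_left h1 (by positivity)
  have e1 : (Ici (0 : ℝ)).indicator (1 : ℝ → ℝ) v = 1 :=
    indicator_of_mem (by simp only [mem_Ici]; linarith) _
  have e2 : (Ici (0 : ℝ)).indicator (1 : ℝ → ℝ) (v + b) = 1 :=
    indicator_of_mem (by simp only [mem_Ici]; linarith) _
  simp only [hα, e1, e2] at h2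
  nlinarith

/-- Increments over arbitrary distances: upwards one sums the bounds for steps of length `b`, and
downwards `f + C v` is non-decreasing. -/
theorem abs_sub_le (hφ : IsKernelAt b φ) (hb : 0 < b) {f : ℝ → ℝ} {C D E x₀ : ℝ} (hC : 0 ≤ C)
    (hE0 : 0 ≤ E)
    (hmono : Monotone (fun v => f v + C * v + D * (Ici (0 : ℝ)).indicator 1 v))
    (hx₀ : 0 ≤ x₀) (hint : ∀ x, x₀ ≤ x → Integrable (fun y => f (x + y) * φ y))
    (hJ : ∀ x, x₀ ≤ x → |∫ y, f (x + y) * φ y| ≤ E * b ^ 2)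
    (hD : ∀ y, y ≤ -x₀ → D * φ y ≤ E * b) {u v : ℝ} (hu : x₀ + b ≤ u) (hv : x₀ + b ≤ v) :
    |f u - f v| ≤ (20 * E + 193 * C) * (b + |u - v|) := by
  have hmono' : ∀ u v, x₀ + b ≤ u → u ≤ v → f u + C * u ≤ f v + C * v := by
    intro u v hu huv
    have := hmono huv
    have e1 : (Ici (0 : ℝ)).indicator (1 : ℝ → ℝ) v = 1 :=
      indicator_of_mem (by simp only [mem_Ici]; linarith) _
    have e2 : (Ici (0 : ℝ)).indicator (1 : ℝ → ℝ) u = 1 :=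
      indicator_of_mem (by simp only [mem_Ici]; linarith) _
    simp only [e1, e2] at this
    linarith
  set D₁ := 20 * E + 192 * C with hD₁
  have hD₁0 : 0 ≤ D₁ := by positivity
  have hstep : ∀ k : ℕ, ∀ u, x₀ + b ≤ u → f (u + k * b) - f u ≤ D₁ * (k * b) := by
    intro k u hu
    induction k with
    | zero => simp
    | succ k ih =>
      have h1 := hφ.increment_le hb hC hmono hx₀ hint hJ hD
        (v := u + k * b) (by nlinarith [k.cast_nonneg (α := ℝ)])
      push_cast
      rw [show u + (k + 1) * b = u + k * b + b by ring]
      nlinarith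
  have main : ∀ u v, x₀ + b ≤ u → u ≤ v → |f u - f v| ≤ (20 * E + 193 * C) * (b + |u - v|) := by
    intro u v hu huv
    rw [abs_sub_comm u v, abs_of_nonneg (by linarith : 0 ≤ v - u), abs_le]
    constructor
    · obtain ⟨k, hk1, hk2⟩ : ∃ k : ℕ, v - u ≤ k * b ∧ (k : ℝ) * b ≤ v - u + b := by
        refine ⟨⌈(v - u) / b⌉₊, ?_, ?_⟩
        · rw [← div_le_iff₀ hb]; exact Nat.le_ceil _
        · have := Nat.ceil_lt_add_one (a := (v - u) / b) (div_nonneg (by linarith) hb.le)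
          have h2 : ((⌈(v - u) / b⌉₊ : ℕ) : ℝ) * b ≤ ((v - u) / b + 1) * b := by gcongr
          refine h2.trans (le_of_eq ?_)
          field_simp
      have h1 := hstep k u hu
      have h2 := hmono' v (u + k * b) (by linarith) (by linarith)
      have h3 : D₁ * (k * b) ≤ D₁ * (v - u + b) := by gcongr
      have h4 : C * (u + k * b - v) ≤ C * b := by gcongr; linarith
      nlinarith [mul_nonneg hC (by linarith : 0 ≤ v - u)]
    · have h2 := hmono' u v hu huv
      nlinarith [mul_nonneg hC (by linarith : 0 ≤ v - u), mul_nonneg hC hb.le,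
        mul_nonneg hE0 (by linarith : 0 ≤ v - u + b)]
  rcases le_total u v with h | h
  · exact main u v hu h
  · rw [abs_sub_comm, abs_sub_comm u v]; exact main v u hv h

end IsKernelAt

/-! ### Letting the abscissa tend to zero -/

/-- Extending `S` by `0` to the negative axis keeps the one-sided Tauberian condition, up to a jump
at `0`. -/
theorem monotone_indicator_add {S : ℝ → ℝ} {C : ℝ} (hC : 0 ≤ C)
    (hmono : MonotoneOn (fun x : ℝ => S x + C * x) (Ici 0)) :
    Monotone (fun v => (Ici (0 : ℝ)).indicator S v + C * v +
      |S 0| * (Ici (0 : ℝ)).indicator 1 v) := by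
  intro u v huv
  simp only [indicator, mem_Ici, Pi.one_apply]
  split_ifs with h1 h2
  · have := hmono h1 h2 huv
    simp only at this
    linarith
  · linarith
  · have := hmono (mem_Ici.2 le_rfl) (by assumption : (0 : ℝ) ≤ v) (by assumption : (0 : ℝ) ≤ v)
    simp only at this
    nlinarith [neg_abs_le (S 0)]
  · nlinarith

theorem smoothedLaplace_ofReal (S φ : ℝ → ℝ) (x σ : ℝ) :
    smoothedLaplace S φ x σ =
      ((∫ v in Ioi (0 : ℝ), Real.exp (σ * (x - v)) * (S v * φ (x - v)) : ℝ) : ℂ) := by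
  unfold smoothedLaplace
  rw [← integral_complex_ofReal]
  congr 1
  ext v
  have : Complex.exp (σ * ((x : ℂ) - v)) = Complex.exp (-σ * v) * Complex.exp (σ * x) := by
    rw [← Complex.exp_add]; congr 1; ring
  push_cast
  rw [this]
  ring

theorem LaplaceConverges.integrableOn_real {S : ℝ → ℝ} (hS : LaplaceConverges S) {σ : ℝ}
    (hσ : 0 < σ) : IntegrableOn (fun v => Real.exp (-σ * v) * S v) (Ioi 0) := by
  have h1 := (hS σ (by simpa using hσ)).re
  refine h1.congr (ae_of_all _ fun v => ?_)
  have : Complex.exp (-(σ : ℂ) * v) * S v = ((Real.exp (-σ * v) * S v : ℝ) : ℂ) := by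
    push_cast; rfl
  simp only [this]
  exact Complex.ofReal_re _

/-- Letting `σ` tend to `0` in a bound for the smoothed Laplace transform. The Tauberian condition
bounds `S` from below by an affine function, so that monotone convergence applies. -/
theorem integrableOn_mul_kernel_of_bounded {S φ : ℝ → ℝ} {b C E x : ℝ} (hb : 0 < b) (hC : 0 ≤ C)
    (hmono : MonotoneOn (fun x : ℝ => S x + C * x) (Ici 0)) (hS : LaplaceConverges S)
    (hφ : IsKernelAt b φ) (hx : 0 ≤ x)
    (hE : ∀ᶠ σ : ℝ in 𝓝[>] 0, ‖smoothedLaplace S φ x σ‖ ≤ E) :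
    IntegrableOn (fun v => S v * φ (x - v)) (Ioi 0) ∧
      |∫ v in Ioi (0 : ℝ), S v * φ (x - v)| ≤ E := by
  have hφc := hφ.continuous
  have hφ4 : ∀ y, |φ y| ≤ 4 := by
    intro y
    rw [abs_of_nonneg (hφ.nonneg y)]
    refine (hφ.le' y).trans ?_
    have : 1 / (1 + (y / b) ^ 2) ≤ 1 := by
      rw [div_le_one (by positivity)]; nlinarith [sq_nonneg (y / b)]
    linarith
  have hSσ : ∀ σ : ℝ, 0 < σ →
      IntegrableOn (fun v => Real.exp (σ * (x - v)) * (S v * φ (x - v))) (Ioi 0) := by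
    intro σ hσ
    have h1 := Integrable.bdd_mul (f := fun v => Real.exp (σ * x) * φ (x - v))
      (c := Real.exp (σ * x) * 4)
      (LaplaceConverges.integrableOn_real hS hσ)
      (Continuous.aestronglyMeasurable (by fun_prop)) (ae_of_all _ fun v => by
        rw [norm_mul, Real.norm_of_nonneg (Real.exp_pos _).le, Real.norm_eq_abs]
        gcongr
        exact hφ4 _)
    refine h1.congr (ae_of_all _ fun v => ?_)
    have : Real.exp (σ * (x - v)) = Real.exp (-σ * v) * Real.exp (σ * x) := by
      rw [← Real.exp_add]; congr 1; ring
    simp only [this]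
    ring
  -- `q` majorizes the negative part of `S v * φ (x - v)`
  set q := fun v => (C * v + |S 0|) * φ (x - v) with hq
  have hqi : Integrable (fun v => (C * |v| + |S 0|) * φ (x - v)) := by
    have h1 : Integrable (fun v => (b + |x - v|) * φ (x - v)) :=
      (hφ.integrable_weighted hb).comp_sub_left x
    have h2 : Integrable (fun v => φ (x - v)) := (hφ.integrable hb).comp_sub_left x
    refine Integrable.mono' ((h1.const_mul C).add (h2.const_mul (C * |x| + |S 0|)))
      (Continuous.aestronglyMeasurable (by fun_prop)) (ae_of_all _ fun v => ?_)
    rw [Real.norm_of_nonneg (mul_nonneg (by positivity) (hφ.nonneg _))]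
    simp only [Pi.add_apply]
    have h3 : |v| ≤ |x| + |x - v| := by
      have := abs_sub x (x - v); rw [sub_sub_cancel] at this; exact this
    have h4 := hφ.nonneg (x - v)
    rw [← mul_assoc, ← add_mul]
    refine mul_le_mul_of_nonneg_right ?_ h4
    nlinarith [mul_le_mul_of_nonneg_left h3 hC, mul_nonneg hC hb.le]
  have hqI : IntegrableOn q (Ioi 0) := by
    refine hqi.integrableOn.congr_fun (fun v hv => ?_) measurableSet_Ioi
    simp only [hq, abs_of_pos (mem_Ioi.1 hv)]
  have hq0 : ∀ v ∈ Ioi (0 : ℝ), 0 ≤ q v := fun v hv =>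
    mul_nonneg (by have := mul_nonneg hC (le_of_lt (mem_Ioi.1 hv)); positivity) (hφ.nonneg _)
  have hP0 : ∀ v ∈ Ioi (0 : ℝ), 0 ≤ S v * φ (x - v) + q v := by
    intro v hv
    have h1 := hmono (mem_Ici.2 le_rfl) (le_of_lt (mem_Ioi.1 hv) : (0 : ℝ) ≤ v) (le_of_lt hv)
    simp only at h1
    have h2 : 0 ≤ S v + (C * v + |S 0|) := by linarith [neg_abs_le (S 0)]
    have := mul_nonneg h2 (hφ.nonneg (x - v))
    simp only [hq]; linarith
  set B := Real.exp 1 * (E + Real.exp x * ∫ v in Ioi (0 : ℝ), q v) with hB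
  have hloc : ∀ R : ℝ, IntegrableOn (fun v => S v * φ (x - v)) (Ioc 0 R) := by
    intro R
    have h1 := (hSσ 1 one_pos).mono_set (fun v (hv : v ∈ Ioc 0 R) => mem_Ioi.2 hv.1)
    have h2 := Integrable.bdd_mul (f := fun v => Real.exp (-(x - min v R)))
      (c := Real.exp (R - x)) h1
      (Continuous.aestronglyMeasurable (by fun_prop)) (ae_of_all _ fun v => by
        rw [Real.norm_of_nonneg (Real.exp_pos _).le]
        apply Real.exp_le_exp.2
        linarith [min_le_right v R])
    refine h2.congr ?_
    rw [EventuallyEq, ae_restrict_iff' measurableSet_Ioc]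
    refine ae_of_all _ fun v hv => ?_
    have : min v R = v := min_eq_left hv.2
    simp only [this]
    rw [← mul_assoc, ← Real.exp_add]
    simp
  have hIP : IntegrableOn (fun v => S v * φ (x - v) + q v) (Ioi 0) := by
    refine integrableOn_Ioi_of_intervalIntegral_norm_bounded B 0
      (l := atTop) (b := fun R : ℝ => R) (fun R => ?_) tendsto_id ?_
    · exact (hloc R).add (hqI.mono_set Ioc_subset_Ioi_self)
    · filter_upwards [eventually_gt_atTop 0] with R hR
      -- for `σ ≤ 1 / R` the factor `e^{σ (x - v)}` is bounded below on `[0, R]`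
      obtain ⟨σ, hσE, hσ0, hσ1⟩ : ∃ σ : ℝ, ‖smoothedLaplace S φ x σ‖ ≤ E ∧ 0 < σ ∧
          σ < min 1 (1 / R) :=
        (hE.and (Ioo_mem_nhdsGT (lt_min one_pos (one_div_pos.2 hR)))).exists
      have hσ2 : σ ≤ 1 := (hσ1.trans_le (min_le_left _ _)).le
      have hσ3 : σ * R ≤ 1 := by
        have := (hσ1.trans_le (min_le_right _ _)).le
        rwa [le_div_iff₀ hR] at this
      have hqσ : IntegrableOn (fun v => Real.exp (σ * (x - v)) * q v) (Ioi 0) := by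
        refine Integrable.mono' (hqI.const_mul (Real.exp x))
          ((by fun_prop : Continuous fun v => Real.exp (σ * (x - v)) * q v).aestronglyMeasurable) ?_
        rw [ae_restrict_iff' measurableSet_Ioi]
        refine ae_of_all _ fun v hv => ?_
        rw [Real.norm_of_nonneg (mul_nonneg (Real.exp_pos _).le (hq0 v hv))]
        gcongr
        · exact hq0 v hv
        · nlinarith [mem_Ioi.1 hv]
      have hqσ2 : ∫ v in Ioi (0 : ℝ), Real.exp (σ * (x - v)) * q v ≤
          Real.exp x * ∫ v in Ioi (0 : ℝ), q v := by
        rw [← integral_const_mul]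
        apply setIntegral_mono_on hqσ (hqI.const_mul _) measurableSet_Ioi
        intro v hv
        gcongr
        · exact hq0 v hv
        · nlinarith [mem_Ioi.1 hv]
      have hPσ : IntegrableOn (fun v => Real.exp (σ * (x - v)) * (S v * φ (x - v) + q v))
          (Ioi 0) := by
        have := (hSσ σ hσ0).add hqσ
        refine this.congr (ae_of_all _ fun v => ?_)
        simp only [Pi.add_apply]; ring
      have hPσ2 : ∫ v in Ioi (0 : ℝ), Real.exp (σ * (x - v)) * (S v * φ (x - v) + q v) ≤
          E + Real.exp x * ∫ v in Ioi (0 : ℝ), q v := by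
        have e : ∫ v in Ioi (0 : ℝ), Real.exp (σ * (x - v)) * (S v * φ (x - v) + q v) =
            (∫ v in Ioi (0 : ℝ), Real.exp (σ * (x - v)) * (S v * φ (x - v))) +
            ∫ v in Ioi (0 : ℝ), Real.exp (σ * (x - v)) * q v := by
          rw [← integral_add (hSσ σ hσ0) hqσ]
          congr 1; ext v; ring
        rw [e]
        rw [smoothedLaplace_ofReal, Complex.norm_real, Real.norm_eq_abs] at hσE
        linarith [(abs_le.1 hσE).2]
      rw [intervalIntegral.integral_of_le hR.le]
      calc ∫ v in Ioc 0 R, ‖S v * φ (x - v) + q v‖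
          ≤ ∫ v in Ioc 0 R,
              Real.exp 1 * (Real.exp (σ * (x - v)) * (S v * φ (x - v) + q v)) := by
            apply setIntegral_mono_on
              ((hloc R).add (hqI.mono_set Ioc_subset_Ioi_self)).norm
              ((hPσ.mono_set Ioc_subset_Ioi_self).const_mul _) measurableSet_Ioc
            intro v hv
            have h0 := hP0 v hv.1
            change ‖S v * φ (x - v) + q v‖ ≤ _
            rw [Real.norm_of_nonneg h0, ← mul_assoc, ← Real.exp_add]
            apply le_mul_of_one_le_left h0
            apply Real.one_le_exp
            have : σ * v ≤ σ * R := by gcongr; exact hv.2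
            nlinarith
        _ = Real.exp 1 * ∫ v in Ioc 0 R,
              Real.exp (σ * (x - v)) * (S v * φ (x - v) + q v) := by
            rw [integral_const_mul]
        _ ≤ Real.exp 1 * ∫ v in Ioi (0 : ℝ),
              Real.exp (σ * (x - v)) * (S v * φ (x - v) + q v) := by
            refine mul_le_mul_of_nonneg_left ?_ (Real.exp_pos _).le
            refine setIntegral_mono_set hPσ ?_ (Ioc_subset_Ioi_self.eventuallyLE)
            rw [EventuallyLE, ae_restrict_iff' measurableSet_Ioi]
            exact ae_of_all _ fun v hv => mul_nonneg (Real.exp_pos _).le (hP0 v hv)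
        _ ≤ B := by rw [hB]; gcongr
  have hI : IntegrableOn (fun v => S v * φ (x - v)) (Ioi 0) := by
    refine (hIP.sub hqI).congr (ae_of_all _ fun v => ?_)
    simp only [Pi.sub_apply]; ring
  refine ⟨hI, ?_⟩
  have hlim : Tendsto (fun σ : ℝ => ∫ v in Ioi (0 : ℝ), Real.exp (σ * (x - v)) * (S v * φ (x - v)))
      (𝓝[>] 0) (𝓝 (∫ v in Ioi (0 : ℝ), S v * φ (x - v))) := by
    apply tendsto_integral_filter_of_dominated_convergence
      (fun v => Real.exp x * ‖S v * φ (x - v)‖)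
    · exact Eventually.of_forall fun σ =>
        (Continuous.aestronglyMeasurable (by fun_prop)).mul hI.aestronglyMeasurable
    · filter_upwards [Ioo_mem_nhdsGT (zero_lt_one (α := ℝ))] with σ hσ
      rw [ae_restrict_iff' measurableSet_Ioi]
      refine ae_of_all _ fun v hv => ?_
      rw [norm_mul, Real.norm_of_nonneg (Real.exp_pos _).le]
      gcongr
      nlinarith [mem_Ioi.1 hv, hσ.1, hσ.2]
    · exact hI.norm.const_mul _
    · refine ae_of_all _ fun v => ?_
      have : Tendsto (fun σ : ℝ => Real.exp (σ * (x - v)) * (S v * φ (x - v))) (𝓝 0)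
          (𝓝 (Real.exp (0 * (x - v)) * (S v * φ (x - v)))) :=
        Continuous.tendsto (by fun_prop) 0
      simp only [zero_mul, Real.exp_zero, one_mul] at this
      exact this.mono_left nhdsWithin_le_nhds
  refine le_of_tendsto hlim.abs ?_
  filter_upwards [hE] with σ hσ
  rwa [smoothedLaplace_ofReal, Complex.norm_real, Real.norm_eq_abs] at hσ

/-! ### From smoothed Laplace transforms to pointwise bounds -/

theorem isKernelAt_sincKernel {b : ℝ} (hb : 0 < b) {N : ℕ} (hN : Even N) (hN8 : 8 ≤ N) :
    IsKernelAt b (sincKernel (1 / b) (4 * (1 / b) / N) N) where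
  continuous := continuous_sincKernel _ _ _
  nonneg := sincKernel_nonneg _ _ hN
  le y := by
    have := sincKernel_le (1 / b) (4 * (1 / b) / N) N y
    rwa [one_div_mul_eq_div b y] at this
  ge y hy := by
    apply sincKernel_ge hN8
    rw [one_div_mul_eq_div, abs_div, abs_of_pos hb, div_le_one hb]
    exact hy

theorem integral_indicator_mul_kernel {S φ : ℝ → ℝ} (hφ : ∀ y, φ (-y) = φ y) (x : ℝ) :
    ∫ y, (Ici (0 : ℝ)).indicator S (x + y) * φ y = ∫ v in Ioi (0 : ℝ), S v * φ (x - v) := by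
  have h1 := integral_add_left_eq_self (μ := volume)
    (fun v => (Ici (0 : ℝ)).indicator S v * φ (v - x)) x
  have h2 : (fun v => (Ici (0 : ℝ)).indicator S v * φ (v - x)) =
      (Ici (0 : ℝ)).indicator (fun v => S v * φ (x - v)) := by
    ext v
    rw [indicator_mul_left, ← hφ (v - x), neg_sub]
  rw [h2, integral_indicator measurableSet_Ici, integral_Ici_eq_integral_Ioi] at h1
  simpa using h1

theorem integrable_indicator_mul_kernel {S φ : ℝ → ℝ} (hφ : ∀ y, φ (-y) = φ y) {x : ℝ}
    (h : IntegrableOn (fun v => S v * φ (x - v)) (Ioi 0)) :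
    Integrable (fun y => (Ici (0 : ℝ)).indicator S (x + y) * φ y) := by
  have h2 : (fun v => (Ici (0 : ℝ)).indicator S v * φ (v - x)) =
      (Ici (0 : ℝ)).indicator (fun v => S v * φ (x - v)) := by
    ext v
    rw [indicator_mul_left, ← hφ (v - x), neg_sub]
  rw [← integrableOn_Ici_iff_integrableOn_Ioi, ← integrable_indicator_iff measurableSet_Ici,
    ← h2] at h
  have := h.comp_add_left x
  simpa using this

section

variable {S φ : ℝ → ℝ} {b C E x₀ : ℝ}

theorem abs_sub_le_of_smoothedLaplace (hb : 0 < b) (hC : 0 ≤ C)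
    (hmono : MonotoneOn (fun x : ℝ => S x + C * x) (Ici 0)) (hS : LaplaceConverges S)
    (hφ : IsKernelAt b φ) (hφe : ∀ y, φ (-y) = φ y) (hE0 : 0 ≤ E) (hx₀ : 0 ≤ x₀)
    (hE : ∀ x, x₀ ≤ x → ∀ᶠ σ : ℝ in 𝓝[>] 0, ‖smoothedLaplace S φ x σ‖ ≤ E * b ^ 2)
    (hS0 : ∀ y, y ≤ -x₀ → |S 0| * φ y ≤ E * b) {u v : ℝ} (hu : x₀ + b ≤ u) (hv : x₀ + b ≤ v) :
    |S u - S v| ≤ (20 * E + 193 * C) * (b + |u - v|) := by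
  have hI := fun x (hx : x₀ ≤ x) =>
    integrableOn_mul_kernel_of_bounded hb hC hmono hS hφ (hx₀.trans hx) (hE x hx)
  have := hφ.abs_sub_le hb hC hE0 (monotone_indicator_add hC hmono) hx₀
    (fun x hx => integrable_indicator_mul_kernel hφe (hI x hx).1)
    (fun x hx => by rw [integral_indicator_mul_kernel hφe]; exact (hI x hx).2) hS0 hu hv
  rwa [indicator_of_mem (mem_Ici.2 (by linarith)), indicator_of_mem (mem_Ici.2 (by linarith))]
    at this

/-- Pointwise bound for `S` on the scale `b`. On `y ≥ -a` the increments of `S` are controlled,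
while for `y < -a` the a priori bound `B` is outweighed by the factor `τ` in the tail of `φ`. -/
theorem abs_le_of_smoothedLaplace (hb : 0 < b) (hC : 0 ≤ C)
    (hmono : MonotoneOn (fun x : ℝ => S x + C * x) (Ici 0)) (hS : LaplaceConverges S)
    (hφ : IsKernelAt b φ) (hφe : ∀ y, φ (-y) = φ y) (hE0 : 0 ≤ E) (hx₀ : 0 ≤ x₀)
    (hE : ∀ x, x₀ ≤ x → ∀ᶠ σ : ℝ in 𝓝[>] 0, ‖smoothedLaplace S φ x σ‖ ≤ E * b ^ 2)
    (hS0 : ∀ y, y ≤ -x₀ → |S 0| * φ y ≤ E * b) {B a τ : ℝ} (hB : ∀ x, 0 ≤ x → |S x| ≤ B)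
    (ha : 0 ≤ a) (hτ0 : 0 ≤ τ) (hτ : ∀ y, y ≤ -a → φ y ≤ τ * (4 / (1 + (y / b) ^ 2) ^ 2))
    (hBτ : B * τ ≤ E * b) {x : ℝ} (hx : x₀ + b + a ≤ x) :
    |S x| ≤ (2692 * E + 24704 * C) * b := by
  have hI := fun x (hx : x₀ ≤ x) =>
    integrableOn_mul_kernel_of_bounded hb hC hmono hS hφ (hx₀.trans hx) (hE x hx)
  have hxx : x₀ ≤ x := by linarith
  have hB0 : 0 ≤ B := (abs_nonneg _).trans (hB 0 le_rfl)
  have hfB : ∀ v, |(Ici (0 : ℝ)).indicator S v| ≤ B := by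
    intro v
    by_cases hv : v ∈ Ici (0 : ℝ)
    · rw [indicator_of_mem hv]; exact hB v hv
    · rw [indicator_of_notMem hv]; simpa using hB0
  have key := hφ.abs_le_of_increment hb (f := (Ici (0 : ℝ)).indicator S) (E := E)
    (G := 8 * (20 * E + 193 * C) + 8 * E) (x := x)
    (integrable_indicator_mul_kernel hφe (hI x hxx).1)
    (by rw [integral_indicator_mul_kernel hφe]; exact (hI x hxx).2) ?_ (by positivity)
  · rw [indicator_of_mem (mem_Ici.2 (by linarith))] at key
    refine key.trans (le_of_eq (by ring))
  intro y
  have hpos : 0 ≤ 1 / (1 + (y / b) ^ 2) := by positivity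
  by_cases hy : -a ≤ y
  · have h1 := abs_sub_le_of_smoothedLaplace hb hC hmono hS hφ hφe hE0 hx₀ hE hS0
      (u := x + y) (v := x) (by linarith) (by linarith)
    rw [add_sub_cancel_left] at h1
    rw [indicator_of_mem (mem_Ici.2 (by linarith)), indicator_of_mem (mem_Ici.2 (by linarith))]
    have h2 := mul_le_mul_of_nonneg_right h1 (hφ.nonneg y)
    have h3 := mul_le_mul_of_nonneg_left (hφ.weighted_le hb y)
      (by positivity : 0 ≤ 20 * E + 193 * C)
    have h4 : 0 ≤ 8 * E * b * (1 / (1 + (y / b) ^ 2)) := by positivity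
    nlinarith
  · have h1 : |(Ici (0 : ℝ)).indicator S (x + y) - (Ici (0 : ℝ)).indicator S x| ≤ 2 * B := by
      have := abs_sub ((Ici (0 : ℝ)).indicator S (x + y)) ((Ici (0 : ℝ)).indicator S x)
      linarith [hfB (x + y), hfB x]
    have h2 : φ y ≤ τ * (4 * (1 / (1 + (y / b) ^ 2))) := by
      refine (hτ y (by linarith)).trans ?_
      gcongr
      have : (1 : ℝ) ≤ 1 + (y / b) ^ 2 := by nlinarith [sq_nonneg (y / b)]
      rw [mul_one_div]
      gcongr
      nlinarith
    calc _ ≤ 2 * B * (τ * (4 * (1 / (1 + (y / b) ^ 2)))) := by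
          apply mul_le_mul h1 h2 (hφ.nonneg y) (by positivity)
      _ = (B * τ) * (8 * (1 / (1 + (y / b) ^ 2))) := by ring
      _ ≤ (E * b) * (8 * (1 / (1 + (y / b) ^ 2))) := by gcongr
      _ ≤ _ := by
        have h4 : 0 ≤ 8 * (20 * E + 193 * C) * b * (1 / (1 + (y / b) ^ 2)) := by positivity
        nlinarith

/-- The argument with a kernel of fixed scale shows that `S` is bounded; it needs no a priori bound,
since near `0` the function `S` is bounded by the one-sided Tauberian condition. -/
theorem exists_bound_of_smoothedLaplace (hC : 0 ≤ C)
    (hmono : MonotoneOn (fun x : ℝ => S x + C * x) (Ici 0)) (hS : LaplaceConverges S)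
    (hφ : IsKernelAt 1 φ) (hφe : ∀ y, φ (-y) = φ y)
    (hE : ∀ x, 0 ≤ x → ∀ᶠ σ : ℝ in 𝓝[>] 0, ‖smoothedLaplace S φ x σ‖ ≤ E) :
    ∃ B, ∀ x, 0 ≤ x → |S x| ≤ B := by
  set E' := max E (4 * |S 0|) with hE'
  have hE'0 : 0 ≤ E' := le_max_of_le_right (by positivity)
  have hE2 : ∀ x, 0 ≤ x → ∀ᶠ σ : ℝ in 𝓝[>] 0, ‖smoothedLaplace S φ x σ‖ ≤ E' * 1 ^ 2 := by
    intro x hx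
    filter_upwards [hE x hx] with σ hσ
    rw [one_pow, mul_one]
    exact hσ.trans (le_max_left _ _)
  have hS0 : ∀ y, y ≤ -(0 : ℝ) → |S 0| * φ y ≤ E' * 1 := by
    intro y _
    have h1 := hφ.le' y
    have h2 : 1 / (1 + (y / 1) ^ 2) ≤ (1 : ℝ) := by
      rw [div_le_one (by positivity)]; nlinarith [sq_nonneg (y / 1)]
    have h3 := le_max_right E (4 * |S 0|)
    rw [← hE'] at h3
    nlinarith [abs_nonneg (S 0)]
  have hsub : ∀ u v : ℝ, 1 ≤ u → 1 ≤ v → |S u - S v| ≤ (20 * E' + 193 * C) * (1 + |u - v|) :=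
    fun u v hu hv => abs_sub_le_of_smoothedLaplace one_pos hC hmono hS hφ hφe hE'0 le_rfl hE2 hS0
      (by linarith) (by linarith)
  set D := 20 * E' + 193 * C with hD
  have hD0 : 0 ≤ D := by positivity
  set m := |S 0| + |S 1| + C with hm
  have hm0 : 0 ≤ m := by positivity
  have hfm : ∀ v : ℝ, v ≤ 1 → |(Ici (0 : ℝ)).indicator S v| ≤ m := by
    intro v hv
    by_cases hv0 : v ∈ Ici (0 : ℝ)
    · rw [indicator_of_mem hv0]
      have h1 := hmono (mem_Ici.2 le_rfl) hv0 hv0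
      have h2 := hmono hv0 (mem_Ici.2 zero_le_one) hv
      simp only at h1 h2
      have h3 : (0 : ℝ) ≤ v := hv0
      have h4 : C * v ≤ C * 1 := by gcongr
      have h5 := mul_nonneg hC h3
      rw [abs_le]
      constructor <;> linarith [neg_abs_le (S 0), le_abs_self (S 1), abs_nonneg (S 0),
        abs_nonneg (S 1)]
    · rw [indicator_of_notMem hv0]; simpa using hm0
  have hI := fun x (hx : (0 : ℝ) ≤ x) =>
    integrableOn_mul_kernel_of_bounded one_pos hC hmono hS hφ hx (hE2 x hx)
  refine ⟨max m (4 * (E' + 4 * (8 * (D + 2 * m))) * 1), fun x hx => ?_⟩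
  rcases le_total x 1 with hx1 | hx1
  · have := hfm x hx1
    rw [indicator_of_mem (mem_Ici.2 hx)] at this
    exact this.trans (le_max_left _ _)
  refine le_trans ?_ (le_max_right _ _)
  have key := hφ.abs_le_of_increment one_pos (f := (Ici (0 : ℝ)).indicator S) (E := E')
    (G := 8 * (D + 2 * m)) (x := x)
    (integrable_indicator_mul_kernel hφe (hI x hx).1)
    (by rw [integral_indicator_mul_kernel hφe]; exact (hI x hx).2) ?_ (by positivity)
  · rwa [indicator_of_mem (mem_Ici.2 hx)] at key
  intro y
  have h1 : |(Ici (0 : ℝ)).indicator S (x + y) - (Ici (0 : ℝ)).indicator S x| ≤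
      (D + 2 * m) * (1 + |y|) := by
    rw [indicator_of_mem (mem_Ici.2 hx) (f := S)]
    have hy0 := abs_nonneg y
    rcases le_total 1 (x + y) with h | h
    · rw [indicator_of_mem (mem_Ici.2 (by linarith))]
      have := hsub (x + y) x h hx1
      rw [add_sub_cancel_left] at this
      nlinarith
    · have h2 := hfm (x + y) h
      have h3 := hfm 1 le_rfl
      rw [indicator_of_mem (mem_Ici.2 zero_le_one)] at h3
      have h4 := hsub x 1 hx1 le_rfl
      have h5 : |x - 1| ≤ |y| := by
        rw [abs_of_nonneg (by linarith), abs_of_nonpos (by linarith : y ≤ 0)]; linarith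
      have h6 := abs_sub ((Ici (0 : ℝ)).indicator S (x + y)) (S x)
      have h7 : |S x| ≤ |S x - S 1| + |S 1| := by
        have := abs_add_le (S x - S 1) (S 1); rwa [sub_add_cancel] at this
      nlinarith
  calc _ ≤ (D + 2 * m) * (1 + |y|) * φ y := by
        gcongr
        exact hφ.nonneg y
    _ = (D + 2 * m) * ((1 + |y|) * φ y) := by ring
    _ ≤ (D + 2 * m) * (8 * 1 * (1 / (1 + (y / 1) ^ 2))) := by
        exact mul_le_mul_of_nonneg_left (hφ.weighted_le one_pos y) (by positivity)
    _ = _ := by ring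

end

/-! ### Analytic extensions to `Ω_M` -/

theorem continuous_comp_abs_im {M : ℝ → ℝ} (hM : IsGrowthFunction M) :
    Continuous (fun s : ℂ => M |s.im|) :=
  hM.continuousOn.comp_continuous (by fun_prop) (fun s => mem_Ici.2 (abs_nonneg _))

theorem isClosed_Omega {M : ℝ → ℝ} (hM : IsGrowthFunction M) : IsClosed (Omega M) := by
  refine isClosed_le (by fun_prop) ?_
  exact continuous_const.div (continuous_comp_abs_im hM) fun s => (hM.pos _ (abs_nonneg _)).ne'

/-- The growth condition for large `|s|` becomes a bound on all of `Ω_M`, by compactness near `0`. -/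
theorem exists_extension_bound {M K : ℝ → ℝ} (hM : IsGrowthFunction M) (hK : IsGrowthFunction K)
    {g : ℂ → ℂ} (hg : ContinuousOn g (Omega M))
    (hR : ∃ R : ℝ, ∀ s ∈ Omega M, R ≤ ‖s‖ → ‖g s‖ ≤ K ‖s‖ / ‖s‖) :
    ∃ B, 0 < B ∧ ∀ s ∈ Omega M, ‖g s‖ ≤ B * (K ‖s‖ / (1 + ‖s‖)) := by
  obtain ⟨R, hR⟩ := hR
  set R' := max R 1 with hR'
  have hR'1 : 1 ≤ R' := le_max_right _ _
  have hc : IsCompact (Omega M ∩ Metric.closedBall 0 R') :=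
    (isCompact_closedBall 0 R').inter_left (isClosed_Omega hM)
  obtain ⟨c, hc⟩ := hc.exists_bound_of_continuousOn (hg.mono inter_subset_left)
  have hK0 := hK.pos 0 le_rfl
  refine ⟨2 + |c| * (1 + R') / K 0, by positivity, fun s hs => ?_⟩
  have hKs : K 0 ≤ K ‖s‖ := hK.monotoneOn (mem_Ici.2 le_rfl) (norm_nonneg s) (norm_nonneg s)
  have hKs0 : 0 < K ‖s‖ := hK0.trans_le hKs
  have hn := norm_nonneg s
  rw [add_mul]
  rcases le_total R' ‖s‖ with h | h
  · have h1 := hR s hs ((le_max_left _ _).trans h)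
    have h2 : 1 ≤ ‖s‖ := hR'1.trans h
    refine h1.trans ?_
    have h3 : K ‖s‖ / ‖s‖ ≤ 2 * (K ‖s‖ / (1 + ‖s‖)) := by
      rw [mul_div_assoc', div_le_div_iff₀ (by linarith) (by linarith)]
      nlinarith
    have : 0 ≤ |c| * (1 + R') / K 0 * (K ‖s‖ / (1 + ‖s‖)) := by positivity
    linarith
  · have h1 := hc s ⟨hs, by simpa using h⟩
    have h2 : |c| ≤ |c| * (1 + R') / K 0 * (K ‖s‖ / (1 + ‖s‖)) := by
      rw [div_mul_div_comm, le_div_iff₀ (by positivity), mul_assoc]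
      have : K 0 * (1 + ‖s‖) ≤ (1 + R') * K ‖s‖ := by nlinarith
      gcongr
    have : 0 ≤ 2 * (K ‖s‖ / (1 + ‖s‖)) := by positivity
    linarith [le_abs_self c]

/-- The nearest-point projection to the rectangle `[c, d] × [-ρ, ρ]`. -/
noncomputable def rectProj (c d ρ : ℝ) (s : ℂ) : ℂ :=
  (max c (min d s.re) : ℝ) + (max (-ρ) (min ρ s.im) : ℝ) * Complex.I

theorem rectProj_re (c d ρ : ℝ) (s : ℂ) : (rectProj c d ρ s).re = max c (min d s.re) := by
  simp [rectProj]

theorem rectProj_im (c d ρ : ℝ) (s : ℂ) : (rectProj c d ρ s).im = max (-ρ) (min ρ s.im) := by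
  simp [rectProj]

theorem continuous_rectProj (c d ρ : ℝ) : Continuous (rectProj c d ρ) := by
  unfold rectProj
  fun_prop

theorem rectProj_mem {c d ρ : ℝ} (hcd : c ≤ d) (hρ : 0 ≤ ρ) (s : ℂ) :
    rectProj c d ρ s ∈ Icc c d ×ℂ Icc (-ρ) ρ := by
  rw [Complex.mem_reProdIm, rectProj_re, rectProj_im]
  exact ⟨⟨le_max_left _ _, max_le hcd (min_le_left _ _)⟩,
    ⟨le_max_left _ _, max_le (by linarith) (min_le_left _ _)⟩⟩

theorem rectProj_eq {c d ρ r v : ℝ} (hr : r ∈ Icc c d) (hv : v ∈ Icc (-ρ) ρ) :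
    rectProj c d ρ (r + v * Complex.I) = r + v * Complex.I := by
  apply Complex.ext
  · rw [rectProj_re]; simp [hr.1, hr.2]
  · rw [rectProj_im]; simp [hv.1, hv.2]

theorem rectShift_of_differentiableOn {c d ρ : ℝ} {F : ℂ → ℂ}
    (hc : ContinuousOn F (Icc c d ×ℂ Icc (-ρ) ρ))
    (hd : DifferentiableOn ℂ F (Ioo c d ×ℂ Ioo (-ρ) ρ)) :
    RectShift c d ρ F := by
  have main : ∀ r ∈ Icc c d, ∀ v₁ ∈ Icc (-ρ) ρ, ∀ v₂ ∈ Icc (-ρ) ρ, v₁ ≤ v₂ →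
      (∫ v in v₁..v₂, F (r + v * Complex.I)) = (∫ v in v₁..v₂, F (c + v * Complex.I)) -
      Complex.I * ((∫ x in c..r, F (x + v₂ * Complex.I)) -
        ∫ x in c..r, F (x + v₁ * Complex.I)) := by
    intro r hr v₁ hv₁ v₂ hv₂ h12
    have := Complex.integral_boundary_rect_eq_zero_of_continuousOn_of_differentiableOn F
      (c + v₁ * Complex.I) (r + v₂ * Complex.I) ?_ ?_
    · simp only [Complex.add_re, Complex.ofReal_re, Complex.mul_re, Complex.I_re, mul_zero,
        Complex.ofReal_im, Complex.I_im, mul_one, sub_self, add_zero, Complex.add_im,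
        Complex.mul_im, zero_add, smul_eq_mul] at this
      linear_combination -Complex.I * this + ((∫ v in v₁..v₂, F (r + v * Complex.I)) -
        (∫ v in v₁..v₂, F (c + v * Complex.I))) * Complex.I_sq
    · apply hc.mono
      simp only [Complex.add_re, Complex.ofReal_re, Complex.mul_re, Complex.I_re, mul_zero,
        Complex.ofReal_im, Complex.I_im, mul_one, sub_self, add_zero, Complex.add_im,
        Complex.mul_im, zero_add]
      rw [uIcc_of_le hr.1, uIcc_of_le h12]
      intro z hz
      rw [Complex.mem_reProdIm] at hz ⊢
      exact ⟨⟨hz.1.1, hz.1.2.trans hr.2⟩, ⟨hv₁.1.trans hz.2.1, hz.2.2.trans hv₂.2⟩⟩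
    · apply hd.mono
      simp only [Complex.add_re, Complex.ofReal_re, Complex.mul_re, Complex.I_re, mul_zero,
        Complex.ofReal_im, Complex.I_im, mul_one, sub_self, add_zero, Complex.add_im,
        Complex.mul_im, zero_add]
      rw [min_eq_left hr.1, max_eq_right hr.1, min_eq_left h12, max_eq_right h12]
      intro z hz
      rw [Complex.mem_reProdIm] at hz ⊢
      exact ⟨⟨hz.1.1, hz.1.2.trans_le hr.2⟩, ⟨hv₁.1.trans_lt hz.2.1, hz.2.2.trans_le hv₂.2⟩⟩
  have hline : ∀ r ∈ Icc c d, ∀ v ∈ Icc (-ρ) ρ,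
      IntervalIntegrable (fun x : ℝ => F (x + v * Complex.I)) volume c r := by
    intro r hr v hv
    apply ContinuousOn.intervalIntegrable
    refine hc.comp (by fun_prop) fun x hx => ?_
    rw [uIcc_of_le hr.1] at hx
    rw [Complex.mem_reProdIm]
    simpa using ⟨⟨hx.1, hx.2.trans hr.2⟩, hv⟩
  intro r hr v₁ hv₁ v₂ hv₂
  rw [intervalIntegral.integral_sub (hline r hr v₂ hv₂) (hline r hr v₁ hv₁)]
  rcases le_total v₁ v₂ with h | h
  · exact main r hr v₁ hv₁ v₂ hv₂ h
  · have := main r hr v₂ hv₂ v₁ hv₁ h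
    rw [intervalIntegral.integral_symm v₂ v₁, intervalIntegral.integral_symm v₂ v₁, this]
    ring

theorem rect_subset_Omega {M : ℝ → ℝ} (hM : IsGrowthFunction M) {t ρ : ℝ} (hρt : ρ ≤ t)
    (hρ : 0 ≤ ρ) {c d : ℝ} (hc : -(1 / M t) ≤ c) (hd : d ≤ 1 / M t) :
    Icc c d ×ℂ Icc (-ρ) ρ ⊆ Omega M := by
  intro s hs
  rw [Complex.mem_reProdIm] at hs
  have h1 : |s.im| ≤ t := (abs_le.2 hs.2).trans hρt
  have h2 : M |s.im| ≤ M t := hM.monotoneOn (mem_Ici.2 (abs_nonneg _)) (mem_Ici.2 (hρ.trans hρt)) h1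
  have h3 : 1 / M t ≤ 1 / M |s.im| := one_div_le_one_div_of_le (hM.pos _ (abs_nonneg _)) h2
  exact (abs_le.2 ⟨hc.trans hs.1.1, hs.1.2.trans hd⟩).trans h3

theorem rect_subset_interior_Omega {M : ℝ → ℝ} (hM : IsGrowthFunction M) {t ρ : ℝ} (hρt : ρ ≤ t)
    (hρ : 0 ≤ ρ) {c d : ℝ} (hc : -(1 / M t) ≤ c) (hd : d ≤ 1 / M t) :
    Ioo c d ×ℂ Ioo (-ρ) ρ ⊆ interior (Omega M) := by
  apply interior_maximal _ (isOpen_Ioo.reProdIm isOpen_Ioo)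
  refine Subset.trans ?_ (rect_subset_Omega hM hρt hρ hc hd)
  exact inter_subset_inter (preimage_mono Ioo_subset_Icc_self) (preimage_mono Ioo_subset_Icc_self)

/-- The smoothed Laplace transform near `s = 0` is a repeated average of `g(s) e^{s x}` along
vertical segments, and shifting the averages to the boundary of `Ω_M` bounds it. -/
theorem norm_smoothedLaplace_le {M S : ℝ → ℝ} {g : ℂ → ℂ} (hM : IsGrowthFunction M)
    (hS : LaplaceConverges S) (hg : IsLaplaceExtension M S g) {t ρ w h x Q G : ℝ} {N : ℕ}
    (hρt : ρ ≤ t) (hw : 0 < w) (hh : 0 < h) (hwh : 4 * w + N * h ≤ ρ)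
    (hQ : ∀ v₁ ∈ Icc (-ρ) ρ, ∀ v₂ ∈ Icc (-ρ) ρ, v₁ ≤ v₂ →
      ‖∫ u in v₁..v₂, g ((-(1 / M t) : ℝ) + u * Complex.I) *
        Complex.exp (((-(1 / M t) : ℝ) + u * Complex.I) * x)‖ ≤ Q)
    (hG : ∀ s ∈ Omega M, |s.im| ≤ ρ → |s.re| ≤ 1 / M t → ‖g s‖ ≤ G) (hx : 0 ≤ x) {σ : ℝ}
    (hσ0 : 0 < σ) (hσ : σ ≤ 1 / M t) :
    ‖smoothedLaplace S (sincKernel w h N) x σ‖ ≤ Q / (2 * w) * Real.exp ((σ + 1 / M t) / h) +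
      G * Real.exp (σ * x) * ((σ + 1 / M t) / h) ^ N / N.factorial := by
  have hρ : 0 ≤ ρ := by
    have : 0 ≤ (N : ℝ) * h := by positivity
    linarith
  have hNh : 0 ≤ (N : ℝ) * h := by positivity
  have ht0 : 0 ≤ t := hρ.trans hρt
  have hMt := hM.pos t ht0
  set δ := 1 / M t with hδ
  have hδ0 : 0 < δ := by positivity
  set F := fun s : ℂ => g s * Complex.exp (s * x) with hF
  set F' := fun s : ℂ => F (rectProj (-δ) σ ρ s) with hF'
  have hrect : Icc (-δ) σ ×ℂ Icc (-ρ) ρ ⊆ Omega M := rect_subset_Omega hM hρt hρ le_rfl hσ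
  have hFc : ContinuousOn F (Icc (-δ) σ ×ℂ Icc (-ρ) ρ) :=
    (hg.continuousOn.mono hrect).mul (by fun_prop)
  have hF'c : Continuous F' :=
    hFc.comp_continuous (continuous_rectProj _ _ _) fun s => rectProj_mem (by linarith) hρ s
  have hFF' : ∀ r ∈ Icc (-δ) σ, ∀ v ∈ Icc (-ρ) ρ,
      F' (r + v * Complex.I) = F (r + v * Complex.I) := by
    intro r hr v hv
    simp only [hF', rectProj_eq hr hv]
  have hmem : ∀ r ∈ Icc (-δ) σ, ∀ v ∈ Icc (-ρ) ρ,
      (r + v * Complex.I : ℂ) ∈ Icc (-δ) σ ×ℂ Icc (-ρ) ρ := by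
    intro r hr v hv
    rw [Complex.mem_reProdIm]; simpa using ⟨hr, hv⟩
  have hF'eq : EqOn F' F (Icc (-δ) σ ×ℂ Icc (-ρ) ρ) := by
    intro s hs
    rw [Complex.mem_reProdIm] at hs
    have := hFF' s.re hs.1 s.im hs.2
    rwa [Complex.re_add_im] at this
  have hF'R : RectShift (-δ) σ ρ F' := by
    apply rectShift_of_differentiableOn (hFc.congr hF'eq)
    refine DifferentiableOn.congr (f := F) ?_ (fun s hs => hF'eq ?_)
    · exact (hg.differentiableOn.mono (rect_subset_interior_Omega hM hρt hρ le_rfl hσ)).mul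
        (by fun_prop)
    · exact inter_subset_inter (preimage_mono Ioo_subset_Icc_self)
        (preimage_mono Ioo_subset_Icc_self) hs
  -- the smoothed Laplace transform as an iterated average
  have hσmem : σ ∈ Icc (-δ) σ := ⟨by linarith, le_rfl⟩
  have e1 : ∀ v ∈ Icc (-ρ) ρ, F' (σ + v * Complex.I) =
      smoothedLaplace S (fun _ => 1) x (σ + v * Complex.I) := by
    intro v hv
    rw [hFF' σ hσmem v hv, smoothedLaplace_one]
    simp only [hF]
    rw [hg.eq_laplace _ (hrect (hmem σ hσmem v hv)) (by simpa using hσ0)]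
  have e2 : ∀ v ∈ Icc (-(ρ - 4 * w)) (ρ - 4 * w), (vavg w)^[4] F' (σ + v * Complex.I) =
      smoothedLaplace S (fun y => 1 * Real.sinc (w * y) ^ 4) x (σ + v * Complex.I) := by
    intro v hv
    rw [iterate_vavg_congr hw e1 4 v (by exact_mod_cast hv)]
    exact iterate_vavg_smoothedLaplace hS continuous_const (by simp) hw x 4 (by simpa using hσ0)
  have e3 : (vavg h)^[N] ((vavg w)^[4] F') σ = smoothedLaplace S (sincKernel w h N) x σ := by
    have h1 := iterate_vavg_congr hh e2 N 0 ⟨by linarith, by linarith⟩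
    simp only [Complex.ofReal_zero, zero_mul, add_zero] at h1
    rw [h1]
    have hc := Real.continuous_sinc
    rw [iterate_vavg_smoothedLaplace hS (by fun_prop) _ hh x N (by simpa using hσ0)]
    · congr 1; ext y; simp [sincKernel]
    · intro y
      rw [one_mul, abs_pow]
      exact pow_le_one₀ (abs_nonneg _) (Real.abs_sinc_le_one _)
  -- bounds on the rectangle and on its left side
  have hQ0 : 0 ≤ Q := (norm_nonneg _).trans (hQ 0 ⟨by linarith, hρ⟩ 0 ⟨by linarith, hρ⟩ le_rfl)
  have hB : ∀ r ∈ Icc (-δ) σ, ∀ v ∈ Icc (-ρ) ρ,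
      ‖F' (r + v * Complex.I)‖ ≤ G * Real.exp (σ * x) := by
    intro r hr v hv
    rw [hFF' r hr v hv]
    simp only [hF]
    have h1 := hG _ (hrect (hmem r hr v hv)) (by simpa using abs_le.2 hv)
      (by simpa using abs_le.2 ⟨hr.1, hr.2.trans hσ⟩)
    rw [norm_mul, Complex.norm_exp]
    have h0 : 0 ≤ G := (norm_nonneg _).trans h1
    have : ((r + v * Complex.I) * (x : ℂ)).re = r * x := by simp
    rw [this]
    gcongr
    exact hr.2
  have hA1 : ∀ v ∈ Icc (-(ρ - w)) (ρ - w), ‖vavg w F' ((-δ : ℝ) + v * Complex.I)‖ ≤ Q / (2 * w) := by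
    intro v hv
    rw [vavg_eq_integral, norm_mul, norm_inv, Complex.norm_real,
      Real.norm_of_nonneg (by positivity), inv_mul_eq_div]
    gcongr
    have := hQ (v - w) ⟨by linarith [hv.1], by linarith [hv.2]⟩ (v + w)
      ⟨by linarith [hv.1], by linarith [hv.2]⟩ (by linarith)
    refine le_trans (le_of_eq ?_) this
    congr 1
    apply intervalIntegral.integral_congr
    intro u hu
    rw [uIcc_of_le (by linarith)] at hu
    exact hFF' (-δ) ⟨le_rfl, by linarith⟩ u ⟨by linarith [hv.1, hu.1], by linarith [hv.2, hu.2]⟩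
  have hA : ∀ v ∈ Icc (-(ρ - 4 * w)) (ρ - 4 * w),
      ‖(vavg w)^[4] F' ((-δ : ℝ) + v * Complex.I)‖ ≤ Q / (2 * w) := by
    intro v hv
    rw [Function.iterate_succ_apply]
    apply norm_iterate_vavg_le hw hA1 3
    push_cast
    exact ⟨by linarith [hv.1], by linarith [hv.2]⟩
  have hreg := RectShift.iterate_vavg hF'c hw hF'R 4
  have hB4 : ∀ r ∈ Icc (-δ) σ, ∀ v ∈ Icc (-(ρ - 4 * w)) (ρ - 4 * w),
      ‖(vavg w)^[4] F' (r + v * Complex.I)‖ ≤ G * Real.exp (σ * x) := by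
    intro r hr v hv
    exact norm_iterate_vavg_le hw (hB r hr) 4 v (by exact_mod_cast hv)
  have hfin := norm_iterate_vavg_le_exp hreg.1 hh (by exact_mod_cast hreg.2)
    (by positivity) hA hB4 N σ hσmem 0 ⟨by linarith, by linarith⟩
  simp only [Complex.ofReal_zero, zero_mul, add_zero, sub_neg_eq_add] at hfin
  rw [← e3]
  exact hfin

/-! ### The decay estimate -/

/-- The hypotheses force `S` to be bounded: the Tauberian argument at a fixed scale, where only the
part `|Im s| ≤ 8` of the extension matters. -/
theorem exists_abs_le {M K S : ℝ → ℝ} (hM : IsGrowthFunction M) (hK : IsGrowthFunction K)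
    {C : ℝ} (hC : 0 ≤ C) (hmono : MonotoneOn (fun x : ℝ => S x + C * x) (Ici 0))
    (hS : LaplaceConverges S) {g : ℂ → ℂ} (hg : IsLaplaceExtension M S g) {B : ℝ} (hB : 0 < B)
    (hgB : ∀ s ∈ Omega M, ‖g s‖ ≤ B * (K ‖s‖ / (1 + ‖s‖))) :
    ∃ B', ∀ x, 0 ≤ x → |S x| ≤ B' := by
  have hM8 := hM.pos 8 (by norm_num)
  set δ := 1 / M 8 with hδ
  have hδ0 : 0 < δ := by positivity
  set G := B * K (δ + 8) with hG
  have hG0 : 0 ≤ G := mul_nonneg hB.le (hK.pos _ (by linarith)).le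
  have hGs : ∀ s ∈ Omega M, |s.im| ≤ 8 → |s.re| ≤ 1 / M 8 → ‖g s‖ ≤ G := by
    intro s hs h1 h2
    refine (hgB s hs).trans ?_
    have h3 : ‖s‖ ≤ δ + 8 := (Complex.norm_le_abs_re_add_abs_im s).trans (by linarith)
    have h4 : K ‖s‖ ≤ K (δ + 8) :=
      hK.monotoneOn (mem_Ici.2 (norm_nonneg _)) (mem_Ici.2 (by linarith)) h3
    have h5 : K ‖s‖ / (1 + ‖s‖) ≤ K ‖s‖ :=
      div_le_self (hK.pos _ (norm_nonneg _)).le (by linarith [norm_nonneg s])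
    rw [hG]; gcongr; linarith
  refine exists_bound_of_smoothedLaplace hC hmono hS
    (isKernelAt_sincKernel one_pos (N := 8) (by decide) le_rfl) (sincKernel_neg _ _ _)
    (E := (G * 16) / (2 * (1 / 1)) * Real.exp ((δ + 1 / M 8) / (4 * (1 / 1) / (8 : ℕ))) +
      G * Real.exp 1 * ((δ + 1 / M 8) / (4 * (1 / 1) / (8 : ℕ))) ^ 8 / Nat.factorial 8) ?_
  intro x hx
  have hpos : 0 < min δ (1 / (x + 1)) := lt_min hδ0 (by positivity)
  filter_upwards [Ioo_mem_nhdsGT hpos] with σ hσ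
  have hσδ : σ ≤ δ := (hσ.2.trans_le (min_le_left _ _)).le
  have hσx : σ * x ≤ 1 := by
    have h1 := (hσ.2.trans_le (min_le_right _ _)).le
    rw [le_div_iff₀ (by linarith)] at h1
    nlinarith [hσ.1]
  have hσ0 := hσ.1
  refine (norm_smoothedLaplace_le hM hS hg (t := 8) (ρ := 8) le_rfl (by norm_num) (by norm_num)
    (by norm_num) (Q := G * 16) ?_ hGs hx hσ.1 hσδ).trans ?_
  · intro v₁ hv₁ v₂ hv₂ h12
    have := intervalIntegral.norm_integral_le_of_norm_le_const (a := v₁) (b := v₂) (C := G)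
      (f := fun u : ℝ => g ((-(1 / M 8) : ℝ) + u * Complex.I) *
        Complex.exp (((-(1 / M 8) : ℝ) + u * Complex.I) * x)) ?_
    · refine this.trans ?_
      gcongr
      rw [abs_le]; constructor <;> linarith [hv₁.1, hv₁.2, hv₂.1, hv₂.2]
    · intro u hu
      rw [uIoc_of_le h12] at hu
      have hu' : u ∈ Icc (-8 : ℝ) 8 := ⟨by linarith [hu.1, hv₁.1], hu.2.trans hv₂.2⟩
      have h1 := hGs ((-(1 / M 8) : ℝ) + u * Complex.I)
        (rect_subset_Omega hM (t := 8) (ρ := 8) le_rfl (by norm_num) (c := -(1 / M 8))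
          (d := 1 / M 8) le_rfl le_rfl (by
          rw [Complex.mem_reProdIm]
          simp only [Complex.add_re, Complex.ofReal_re, Complex.mul_re, Complex.I_re, mul_zero,
            Complex.ofReal_im, Complex.I_im, mul_one, sub_self, add_zero, Complex.add_im,
            Complex.mul_im, zero_add]
          exact ⟨⟨le_rfl, by linarith⟩, hu'⟩)) (by simpa using abs_le.2 hu')
        (by simp [abs_of_pos hM8])
      rw [norm_mul, Complex.norm_exp]
      have h2 : Real.exp (((-(1 / M 8) : ℝ) + u * Complex.I) * (x : ℂ)).re ≤ 1 := by
        rw [Real.exp_le_one_iff]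
        have : (((-(1 / M 8) : ℝ) + u * Complex.I) * (x : ℂ)).re = -δ * x := by simp [hδ]
        rw [this]
        nlinarith
      calc _ ≤ G * 1 := by gcongr
        _ = G := mul_one G
  · gcongr

theorem pow_div_factorial_le_exp_neg {t δ : ℝ} {N : ℕ} (ht : 0 < t) (hδ : 0 ≤ δ)
    (hδt : 8 * Real.exp 3 * δ ≤ t) (hN : 0 < N) :
    (2 * δ / (t / (4 * N))) ^ N / N.factorial ≤ Real.exp (-2 * N) := by
  have hN0 : (0 : ℝ) < N := by exact_mod_cast hN
  have h1 : 2 * δ / (t / (4 * N)) ≤ Real.exp (-3) * N := by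
    rw [div_le_iff₀ (by positivity)]
    have h2 : Real.exp (-3) * N * (t / (4 * N)) = Real.exp (-3) * t / 4 := by field_simp
    rw [h2]
    have h3 : Real.exp (-3) * (8 * Real.exp 3 * δ) ≤ Real.exp (-3) * t := by gcongr
    have h4 : Real.exp (-3) * (8 * Real.exp 3 * δ) = 8 * δ := by
      rw [Real.exp_neg]; field_simp
    linarith
  calc (2 * δ / (t / (4 * N))) ^ N / N.factorial ≤ (Real.exp (-3) * N) ^ N / N.factorial := by
        gcongr
    _ = Real.exp (-3) ^ N * ((N : ℝ) ^ N / N.factorial) := by rw [mul_pow, mul_div_assoc]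
    _ ≤ Real.exp (-3) ^ N * Real.exp N := by
        gcongr
        exact Real.pow_div_factorial_le_exp _ hN0.le _
    _ = Real.exp (-2 * N) := by
        rw [← Real.exp_nat_mul, ← Real.exp_add]; congr 1; ring

/-- With `N` averages of length `t / (4 N)`, shifting to the boundary of `Ω_M` costs a translation
of `x` by `4 N / t`, and the horizontal sides contribute only `exp (-2 N)`. -/
theorem eventually_norm_smoothedLaplace_le {M S : ℝ → ℝ} {g : ℂ → ℂ} (hM : IsGrowthFunction M)
    (hS : LaplaceConverges S) (hg : IsLaplaceExtension M S g) {t x Λ C₁ G : ℝ} {N : ℕ}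
    (ht : 0 < t) (hN : 0 < N) (hδt : 8 * Real.exp 3 * (1 / M t) ≤ t)
    (hQ : ∀ v₁ ∈ Icc (-(t / 2)) (t / 2), ∀ v₂ ∈ Icc (-(t / 2)) (t / 2), v₁ ≤ v₂ →
      ‖∫ u in v₁..v₂, g ((-(1 / M t) : ℝ) + u * Complex.I) *
        Complex.exp (((-(1 / M t) : ℝ) + u * Complex.I) * x)‖ ≤
        C₁ / t * Real.exp (Λ - x / M t))
    (hG : ∀ s ∈ Omega M, |s.im| ≤ t / 2 → |s.re| ≤ 1 / M t → ‖g s‖ ≤ G) (hG0 : 0 ≤ G)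
    (hx0 : 0 ≤ x) (hx : M t * Λ + 4 * N / t ≤ x) :
    ∀ᶠ σ : ℝ in 𝓝[>] 0, ‖smoothedLaplace S (sincKernel (t / 16) (t / (4 * N)) N) x σ‖ ≤
      8 * Real.exp 1 * |C₁| / t ^ 2 + G * Real.exp 1 * Real.exp (-2 * N) := by
  have hMt0 := hM.pos t ht.le
  have hN0 : (0 : ℝ) < N := by exact_mod_cast hN
  have hδ0 : 0 < 1 / M t := by positivity
  have hpos : 0 < min (min (1 / M t) (t / (4 * N))) (1 / (x + 1)) :=
    lt_min (lt_min hδ0 (by positivity)) (by positivity)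
  filter_upwards [Ioo_mem_nhdsGT hpos] with σ hσ
  have hσ0 := hσ.1
  have hσδ : σ ≤ 1 / M t := (hσ.2.trans_le ((min_le_left _ _).trans (min_le_left _ _))).le
  have hσh : σ ≤ t / (4 * N) := (hσ.2.trans_le ((min_le_left _ _).trans (min_le_right _ _))).le
  have hσx : σ * x ≤ 1 := by
    have h1 := (hσ.2.trans_le (min_le_right _ _)).le
    rw [le_div_iff₀ (by linarith)] at h1
    nlinarith [hσ.1]
  have h48 : 4 * (t / 16) + N * (t / (4 * N)) ≤ t / 2 := by
    apply le_of_eq; field_simp; norm_num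
  refine (norm_smoothedLaplace_le hM hS hg (t := t) (ρ := t / 2) (by linarith) (by positivity)
    (by positivity) h48 hQ hG hx0 hσ0 hσδ).trans (add_le_add ?_ ?_)
  · have h1 : (σ + 1 / M t) / (t / (4 * N)) ≤ 1 + 4 * N / t * (1 / M t) := by
      rw [add_div]
      apply add_le_add
      · rw [div_le_one (by positivity)]; exact hσh
      · apply le_of_eq; field_simp
    have h2 : Λ - x / M t + 4 * N / t * (1 / M t) ≤ 0 := by
      have h3 : (M t * Λ + 4 * N / t) / M t ≤ x / M t := by gcongr
      have h4 : (M t * Λ + 4 * N / t) / M t = Λ + 4 * N / t * (1 / M t) := by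
        rw [add_div, mul_div_cancel_left₀ _ hMt0.ne']; ring
      linarith
    have h5 : Real.exp (Λ - x / M t) * Real.exp ((σ + 1 / M t) / (t / (4 * N))) ≤
        Real.exp 1 := by
      rw [← Real.exp_add]
      apply Real.exp_le_exp.2; linarith
    calc _ = C₁ * (8 / t ^ 2) * (Real.exp (Λ - x / M t) *
          Real.exp ((σ + 1 / M t) / (t / (4 * N)))) := by field_simp; ring
      _ ≤ |C₁| * (8 / t ^ 2) * Real.exp 1 := by
        gcongr
        exact le_abs_self _
      _ = _ := by ring
  · have h1 : ((σ + 1 / M t) / (t / (4 * N))) ^ N / N.factorial ≤ Real.exp (-2 * N) := by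
      refine le_trans ?_ (pow_div_factorial_le_exp_neg ht hδ0.le hδt hN)
      gcongr
      linarith
    rw [mul_div_assoc]
    gcongr

set_option maxHeartbeats 400000 in
/-- The Tauberian theorem with an explicit threshold: if the Fourier inversion integrals of
`g` over the boundary of `Ω_M` are at most `C₁ / t * exp (Λ t - x / M t)`, then `S x = O(1 / t)`
as soon as `x` exceeds `M t * Λ t` by a multiple of `log (t K(t) log t) / t`. -/
theorem exists_decay {M K S Λ : ℝ → ℝ} (hM : IsGrowthFunction M) (hK : IsGrowthFunction K)
    {C : ℝ} (hC : 0 ≤ C) (hmono : MonotoneOn (fun x : ℝ => S x + C * x) (Ici 0))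
    (hS : LaplaceConverges S) {g : ℂ → ℂ} (hg : IsLaplaceExtension M S g) {B : ℝ} (hB : 0 < B)
    (hgB : ∀ s ∈ Omega M, ‖g s‖ ≤ B * (K ‖s‖ / (1 + ‖s‖)))
    (hΛ : Tendsto Λ atTop atTop)
    (hΛL : ∀ᶠ t in atTop, Λ t ≤ Real.log t + Real.log (Real.log t) + Real.log (K t)) {C₁ : ℝ}
    (hQ : ∀ᶠ t in atTop, ∀ x, M t * Λ t ≤ x → ∀ v₁ ∈ Icc (-(t / 2)) (t / 2),
      ∀ v₂ ∈ Icc (-(t / 2)) (t / 2), v₁ ≤ v₂ →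
      ‖∫ u in v₁..v₂, g ((-(1 / M t) : ℝ) + u * Complex.I) *
        Complex.exp (((-(1 / M t) : ℝ) + u * Complex.I) * x)‖ ≤
        C₁ / t * Real.exp (Λ t - x / M t)) :
    ∃ C₂, 0 ≤ C₂ ∧ ∀ᶠ t in atTop, ∀ x, M t * Λ t +
      100 * (Real.log t + Real.log (Real.log t) + Real.log (K t)) / t ≤ x → |S x| ≤ C₂ / t := by
  obtain ⟨B', hB'⟩ := exists_abs_le hM hK hC hmono hS hg hB hgB
  have hB'0 : 0 ≤ B' := (abs_nonneg _).trans (hB' 0 le_rfl)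
  have hM0 := hM.pos 0 le_rfl
  have hK0 := hK.pos 0 le_rfl
  obtain ⟨E, hE0, hE1, hE2, hE3⟩ : ∃ E : ℝ, 0 ≤ E ∧
      8 * Real.exp 1 * |C₁| + Real.exp 1 * B / K 0 ≤ E ∧ 4 * |S 0| ≤ E ∧ B' / K 0 ≤ E := by
    have h1 : 0 ≤ 8 * Real.exp 1 * |C₁| + Real.exp 1 * B / K 0 := by positivity
    have h2 : 0 ≤ B' / K 0 := by positivity
    exact ⟨8 * Real.exp 1 * |C₁| + Real.exp 1 * B / K 0 + 4 * |S 0| + B' / K 0, by positivity,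
      by linarith [abs_nonneg (S 0)], by linarith, by linarith [abs_nonneg (S 0)]⟩
  refine ⟨(2692 * E + 24704 * C) * 16, by positivity, ?_⟩
  have hlog : ∀ᶠ t in atTop, 1 ≤ Real.log t := Real.tendsto_log_atTop.eventually_ge_atTop 1
  filter_upwards [hQ, hΛL, hlog, hΛ.eventually_ge_atTop 10, hΛ.eventually_ge_atTop (1 / M 0),
    eventually_ge_atTop 16, eventually_ge_atTop (2 / M 0),
    eventually_ge_atTop (8 * Real.exp 3 / M 0)] with t hQt hΛLt hlogt hΛ10 hΛM ht16 htM htM2 x hx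
  set L := Real.log t + Real.log (Real.log t) + Real.log (K t) with hL
  have ht0 : 0 < t := by linarith
  have hMt : M 0 ≤ M t := hM.monotoneOn (mem_Ici.2 le_rfl) (mem_Ici.2 ht0.le) ht0.le
  have hMt0 : 0 < M t := hM0.trans_le hMt
  have hKt : K 0 ≤ K t := hK.monotoneOn (mem_Ici.2 le_rfl) (mem_Ici.2 ht0.le) ht0.le
  have hKt0 : 0 < K t := hK0.trans_le hKt
  have hexpL : Real.exp L = t * Real.log t * K t := by
    rw [hL, Real.exp_add, Real.exp_add, Real.exp_log ht0, Real.exp_log (by linarith),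
      Real.exp_log hKt0]
  -- an even number of averages, comparable to `L`
  obtain ⟨N, hNe, hNL, hNL2⟩ : ∃ N : ℕ, Even N ∧ L ≤ N ∧ (N : ℝ) ≤ L + 2 := by
    refine ⟨2 * ⌈L / 2⌉₊, even_two_mul _, ?_, ?_⟩
    · have := Nat.le_ceil (L / 2)
      push_cast; linarith
    · have := Nat.ceil_lt_add_one (a := L / 2) (by linarith)
      push_cast; linarith
  have hN8' : (8 : ℝ) ≤ N := by linarith
  have hN8 : 8 ≤ N := by exact_mod_cast hN8'
  have hN0 : (0 : ℝ) < N := by linarith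
  set b := 16 / t with hb
  have hb0 : 0 < b := by positivity
  have hb1 : b ≤ 1 := by rw [hb, div_le_one ht0]; exact ht16
  have hw : 1 / b = t / 16 := by rw [hb, one_div_div]
  have hh : 4 * (1 / b) / N = t / (4 * N) := by rw [hw]; field_simp; norm_num
  set δ := 1 / M t with hδ
  have hδ0 : 0 < δ := by positivity
  have hδM : δ ≤ 1 / M 0 := one_div_le_one_div_of_le hM0 hMt
  have hMΛ : 1 ≤ M t * Λ t := by
    have : M 0 * (1 / M 0) ≤ M t * Λ t := mul_le_mul hMt hΛM (by positivity) hMt0.le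
    rwa [mul_one_div_cancel hM0.ne'] at this
  set x₀ := M t * Λ t + 4 * N / t with hx₀
  have hx₀1 : 1 ≤ x₀ := by have : 0 ≤ 4 * N / t := by positivity
                           linarith
  have hGs : ∀ s ∈ Omega M, |s.im| ≤ t / 2 → |s.re| ≤ 1 / M t → ‖g s‖ ≤ B * K t := by
    intro s hs h1 h2
    refine (hgB s hs).trans ?_
    have h3 : ‖s‖ ≤ t := by
      have h4 : 1 / M 0 ≤ t / 2 := by
        rw [div_le_iff₀ hM0] at htM ⊢
        linarith
      exact (Complex.norm_le_abs_re_add_abs_im s).trans (by linarith)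
    have h4 : K ‖s‖ ≤ K t := hK.monotoneOn (mem_Ici.2 (norm_nonneg _)) (mem_Ici.2 ht0.le) h3
    have h5 : K ‖s‖ / (1 + ‖s‖) ≤ K ‖s‖ :=
      div_le_self (hK.pos _ (norm_nonneg _)).le (by linarith [norm_nonneg s])
    gcongr; linarith
  have hδt : 8 * Real.exp 3 * (1 / M t) ≤ t := by
    rw [mul_one_div]
    refine le_trans ?_ htM2
    gcongr
  have hexp2 : K t * Real.exp (-2 * N) ≤ 1 / K 0 / t ^ 2 := by
    have h1 : Real.exp (-2 * N) ≤ 1 / (t * Real.log t * K t) ^ 2 := by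
      have h2 : Real.exp (-2 * L) = 1 / (t * Real.log t * K t) ^ 2 := by
        rw [← hexpL, ← Real.exp_nat_mul, one_div, ← Real.exp_neg]; congr 1; push_cast; ring
      rw [← h2]
      apply Real.exp_le_exp.2; linarith
    calc K t * Real.exp (-2 * N) ≤ K t * (1 / (t * Real.log t * K t) ^ 2) := by gcongr
      _ = 1 / (K t * (Real.log t) ^ 2) / t ^ 2 := by field_simp
      _ ≤ 1 / K 0 / t ^ 2 := by
        have h2 : 1 ≤ Real.log t ^ 2 := one_le_pow₀ hlogt
        gcongr
        exact hKt.trans (le_mul_of_one_le_right hKt0.le h2)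
  -- the smoothed Laplace transform at scale `b` is `O (b ^ 2)`
  have hsm : ∀ x, x₀ ≤ x → ∀ᶠ σ : ℝ in 𝓝[>] 0,
      ‖smoothedLaplace S (sincKernel (1 / b) (4 * (1 / b) / N) N) x σ‖ ≤ E * b ^ 2 := by
    intro x hx
    have hx1 : 0 ≤ x := by linarith
    have hxM : M t * Λ t ≤ x := by
      have : 0 ≤ 4 * N / t := by positivity
      linarith
    rw [hh, hw]
    filter_upwards [eventually_norm_smoothedLaplace_le hM hS hg ht0 (by omega) hδt (hQt x hxM)
      hGs (by positivity) hx1 hx] with σ hσ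
    refine hσ.trans ?_
    calc _ = 8 * Real.exp 1 * |C₁| / t ^ 2 + Real.exp 1 * B * (K t * Real.exp (-2 * N)) := by ring
      _ ≤ 8 * Real.exp 1 * |C₁| / t ^ 2 + Real.exp 1 * B * (1 / K 0 / t ^ 2) := by gcongr
      _ = (8 * Real.exp 1 * |C₁| + Real.exp 1 * B / K 0) / t ^ 2 := by ring
      _ ≤ E * 256 / t ^ 2 := by
        gcongr
        linarith
      _ = E * b ^ 2 := by rw [hb]; ring
  -- `(1 / 3) ^ N ≤ 1 / (t K(t) log t)`, because `N ≥ L`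
  have htail : B' * (1 / 3) ^ N ≤ E * b := by
    have h1 : ((1 : ℝ) / 3) ^ N ≤ Real.exp (-L) := by
      have h2 : (1 : ℝ) / 3 ≤ Real.exp (-1) := by
        rw [Real.exp_neg, one_div]
        exact inv_anti₀ (Real.exp_pos _) (by linarith [Real.exp_one_lt_d9])
      calc ((1 : ℝ) / 3) ^ N ≤ Real.exp (-1) ^ N := by gcongr
        _ = Real.exp (-N) := by rw [← Real.exp_nat_mul]; congr 1; ring
        _ ≤ _ := by apply Real.exp_le_exp.2; linarith
    rw [Real.exp_neg, hexpL] at h1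
    have h3 : (t * Real.log t * K t)⁻¹ ≤ (t * K 0)⁻¹ := by
      apply inv_anti₀ (by positivity)
      rw [mul_assoc]
      gcongr
      exact hKt.trans (le_mul_of_one_le_left hKt0.le hlogt)
    calc B' * (1 / 3) ^ N ≤ B' * (t * K 0)⁻¹ := by gcongr; exact h1.trans h3
      _ = B' / K 0 * (1 / t) := by field_simp
      _ ≤ E * b := by
        rw [hb]
        gcongr
        norm_num
  have hker := isKernelAt_sincKernel hb0 hNe hN8
  -- the jump at `0` is seen at distance at least `x₀ ≥ 1`
  have hS0 : ∀ y, y ≤ -x₀ → |S 0| * sincKernel (1 / b) (4 * (1 / b) / N) N y ≤ E * b := by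
    intro y hy
    have h1 := hker.le' y
    have h2 : 1 / (1 + (y / b) ^ 2) ≤ b := by
      rw [div_le_iff₀ (by positivity)]
      have h3 : 1 ≤ y ^ 2 := by
        rw [one_le_sq_iff_one_le_abs, le_abs]; right; linarith
      have h4 : b * (y / b) ^ 2 = y ^ 2 / b := by field_simp
      have h5 : 1 ≤ y ^ 2 / b := by rw [le_div_iff₀ hb0]; linarith
      rw [mul_add, h4]; linarith
    calc _ ≤ |S 0| * (4 * b) := by gcongr; linarith
      _ = 4 * |S 0| * b := by ring
      _ ≤ E * b := by gcongr
  have hfinal := abs_le_of_smoothedLaplace hb0 hC hmono hS hker (sincKernel_neg _ _ _) hE0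
    (by linarith) hsm hS0 hB' (a := 12 * N / t) (by positivity) (τ := (1 / 3) ^ N) (by positivity)
    (fun y hy => ?_) htail (x := x) ?_
  · refine hfinal.trans (le_of_eq ?_)
    rw [hb]; ring
  · have := sincKernel_tail_le (1 / b) N (h := 4 * (1 / b) / N) (y := y) ?_
    · rwa [one_div_mul_eq_div] at this
    · rw [hh, abs_mul, abs_of_pos (by positivity)]
      have h1 : 12 * N / t ≤ |y| := by rw [le_abs]; right; linarith
      calc (3 : ℝ) = t / (4 * N) * (12 * N / t) := by field_simp; norm_num
        _ ≤ _ := by gcongr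
  · refine le_trans ?_ hx
    -- translations: `4 N / t` from the averages, `b` and `12 N / t` from the kernel
    have : x₀ + b + 12 * N / t = M t * Λ t + 16 * (N + 1) / t := by
      rw [hx₀, hb]; ring
    rw [this]
    have h1 : 16 * (N + 1) / t ≤ 100 * L / t :=
      div_le_div_of_nonneg_right (by linarith) ht0.le
    linarith

/-! ### Integrals of the extension over the boundary of `Ω_M` -/

theorem intervalIntegrable_comp_abs {h : ℝ → ℝ} {T : ℝ} (hT : 0 ≤ T)
    (hh : IntervalIntegrable h volume 0 T) :
    IntervalIntegrable (fun u => h |u|) volume (-T) T ∧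
      ∫ u in (-T)..T, h |u| = 2 * ∫ u in (0 : ℝ)..T, h u := by
  have h1 : IntervalIntegrable (fun u => h |u|) volume 0 T := by
    refine hh.congr fun u hu => ?_
    rw [uIoc_of_le hT] at hu
    simp only [abs_of_pos hu.1]
  have h2 : IntervalIntegrable (fun u => h |u|) volume (-T) 0 := by
    rw [IntervalIntegrable.iff_comp_neg]
    simpa using h1.symm
  refine ⟨h2.trans h1, ?_⟩
  rw [← intervalIntegral.integral_add_adjacent_intervals h2 h1]
  have h3 : ∫ u in (-T)..0, h |u| = ∫ u in (0 : ℝ)..T, h |u| := by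
    have := intervalIntegral.integral_comp_neg (a := -T) (b := 0) (fun u => h |u|)
    simpa using this
  have h4 : ∫ u in (0 : ℝ)..T, h |u| = ∫ u in (0 : ℝ)..T, h u := by
    apply intervalIntegral.integral_congr
    intro u hu
    rw [uIcc_of_le hT] at hu
    simp only [abs_of_nonneg hu.1]
  rw [h3, h4]; ring

theorem norm_boundary_integral_le {g : ℂ → ℂ} {h : ℝ → ℝ} {δ T x : ℝ} (hT : 0 ≤ T)
    (hh : IntervalIntegrable h volume 0 T) (hh0 : ∀ u, 0 ≤ u → 0 ≤ h u)
    (hg : ∀ u ∈ Icc (-T) T, u ≠ 0 → ‖g ((-δ : ℝ) + u * Complex.I)‖ ≤ h |u|) {v₁ v₂ : ℝ}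
    (hv₁ : v₁ ∈ Icc (-T) T) (hv₂ : v₂ ∈ Icc (-T) T) (h12 : v₁ ≤ v₂) :
    ‖∫ u in v₁..v₂, g ((-δ : ℝ) + u * Complex.I) *
      Complex.exp (((-δ : ℝ) + u * Complex.I) * x)‖ ≤
      2 * (∫ u in (0 : ℝ)..T, h u) * Real.exp (-(δ * x)) := by
  obtain ⟨h1, h2⟩ := intervalIntegrable_comp_abs hT hh
  have h3 : IntervalIntegrable (fun u => h |u|) volume v₁ v₂ := by
    apply h1.mono_set
    rw [uIcc_of_le h12, uIcc_of_le (by linarith)]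
    exact Icc_subset_Icc hv₁.1 hv₂.2
  have h4 : ‖∫ u in v₁..v₂, g ((-δ : ℝ) + u * Complex.I) *
      Complex.exp (((-δ : ℝ) + u * Complex.I) * x)‖ ≤
      ∫ u in v₁..v₂, h |u| * Real.exp (-(δ * x)) := by
    apply intervalIntegral.norm_integral_le_of_norm_le h12 _ (h3.mul_const _)
    have : ∀ᵐ u : ℝ, u ≠ 0 := by
      rw [ae_iff]; simp
    filter_upwards [this] with u hu0 hu
    rw [norm_mul, Complex.norm_exp]
    have e : (((-δ : ℝ) + u * Complex.I) * (x : ℂ)).re = -(δ * x) := by simp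
    rw [e]
    gcongr
    exact hg u ⟨by linarith [hu.1, hv₁.1], hu.2.trans hv₂.2⟩ hu0
  refine h4.trans ?_
  rw [intervalIntegral.integral_mul_const, ← h2]
  gcongr
  apply intervalIntegral.integral_mono_interval hv₁.1 h12 hv₂.2 _ h1
  exact ae_of_all _ fun u => hh0 _ (abs_nonneg u)

section

variable {M K : ℝ → ℝ} {g : ℂ → ℂ} {B : ℝ}

theorem mem_Omega_boundary (hM : IsGrowthFunction M) {t u : ℝ} (hu : |u| ≤ t) :
    (-(1 / M t) : ℝ) + u * Complex.I ∈ Omega M := by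
  have ht : 0 ≤ t := (abs_nonneg u).trans hu
  have hMt := hM.pos t ht
  apply rect_subset_Omega hM (t := t) le_rfl ht le_rfl le_rfl
  rw [Complex.mem_reProdIm]
  have h1 : (((-(1 / M t) : ℝ) : ℂ) + u * Complex.I).re = -(1 / M t) := by simp
  have h2 : (((-(1 / M t) : ℝ) : ℂ) + u * Complex.I).im = u := by simp
  rw [h1, h2]
  have : 0 < 1 / M t := by positivity
  exact ⟨⟨le_rfl, by linarith⟩, abs_le.1 hu⟩

theorem norm_boundary_le (hM : IsGrowthFunction M) {t u : ℝ} (htM : 2 / M 0 ≤ t) (ht : 0 ≤ t)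
    (hu : |u| ≤ t / 2) : |u| ≤ ‖((-(1 / M t) : ℝ) : ℂ) + u * Complex.I‖ ∧
      ‖((-(1 / M t) : ℝ) : ℂ) + u * Complex.I‖ ≤ t := by
  have hM0 := hM.pos 0 le_rfl
  have hMt : M 0 ≤ M t := hM.monotoneOn (mem_Ici.2 le_rfl) (mem_Ici.2 ht) ht
  have h1 : (((-(1 / M t) : ℝ) : ℂ) + u * Complex.I).re = -(1 / M t) := by simp
  have h2 : (((-(1 / M t) : ℝ) : ℂ) + u * Complex.I).im = u := by simp
  have h3 := Complex.abs_im_le_norm (((-(1 / M t) : ℝ) : ℂ) + u * Complex.I)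
  have h4 := Complex.norm_le_abs_re_add_abs_im (((-(1 / M t) : ℝ) : ℂ) + u * Complex.I)
  rw [h2] at h3
  rw [h1, h2, abs_neg, abs_of_pos (one_div_pos.2 (hM0.trans_le hMt))] at h4
  have h5 : 1 / M t ≤ 1 / M 0 := one_div_le_one_div_of_le hM0 hMt
  have h6 : 1 / M 0 ≤ t / 2 := by
    rw [div_le_iff₀ hM0] at htM ⊢
    linarith
  exact ⟨h3, by linarith⟩

/-- The boundary integrals without further assumptions: `∫ K / (1 + u) du` costs a logarithm. -/
theorem boundary_integral_general (hM : IsGrowthFunction M) (hK : IsGrowthFunction K) (hB : 0 < B)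
    (hgB : ∀ s ∈ Omega M, ‖g s‖ ≤ B * (K ‖s‖ / (1 + ‖s‖))) :
    ∀ᶠ t in atTop, ∀ x : ℝ, ∀ v₁ ∈ Icc (-(t / 2)) (t / 2),
      ∀ v₂ ∈ Icc (-(t / 2)) (t / 2), v₁ ≤ v₂ →
      ‖∫ u in v₁..v₂, g ((-(1 / M t) : ℝ) + u * Complex.I) *
        Complex.exp (((-(1 / M t) : ℝ) + u * Complex.I) * x)‖ ≤
        2 * B * K t * Real.log t * Real.exp (-(1 / M t * x)) := by
  filter_upwards [eventually_ge_atTop (2 / M 0), eventually_ge_atTop 2] with t htM ht2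
    x v₁ hv₁ v₂ hv₂ h12
  have ht0 : 0 ≤ t := by linarith
  have hKt := hK.pos t ht0
  have hcont : ContinuousOn (fun u : ℝ => B * K t * (1 + u)⁻¹) (uIcc 0 (t / 2)) := by
    rw [uIcc_of_le (by linarith)]
    refine continuousOn_const.mul (ContinuousOn.inv₀ (by fun_prop) fun u hu => ?_)
    linarith [hu.1]
  refine (norm_boundary_integral_le (h := fun u => B * K t * (1 + u)⁻¹) (by linarith)
    hcont.intervalIntegrable (fun u hu => by positivity) (fun u hu _ => ?_) hv₁ hv₂ h12).trans ?_
  · have hu' : |u| ≤ t / 2 := abs_le.2 hu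
    obtain ⟨h1, h2⟩ := norm_boundary_le hM htM ht0 hu'
    refine (hgB _ (mem_Omega_boundary hM (hu'.trans (by linarith)))).trans ?_
    rw [mul_assoc, ← div_eq_mul_inv]
    have h3 := hK.monotoneOn (mem_Ici.2 (norm_nonneg _)) (mem_Ici.2 ht0) h2
    gcongr
  · rw [intervalIntegral.integral_const_mul,
      intervalIntegral.integral_comp_add_left (fun u => u⁻¹) 1, add_zero,
      integral_inv_of_pos one_pos (by linarith), div_one]
    have : Real.log (1 + t / 2) ≤ Real.log t := Real.log_le_log (by linarith) (by linarith)
    calc _ ≤ 2 * (B * K t * Real.log t) * Real.exp (-(1 / M t * x)) := by gcongr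
      _ = _ := by ring

theorem positiveIncrease_exists_le_one (h : PositiveIncrease K) (hK : IsGrowthFunction K) :
    ∃ a : ℝ, 0 < a ∧ a ≤ 1 ∧ ∃ t₀ : ℝ, 0 < t₀ ∧ ∃ A : ℝ, 0 < A ∧ ∀ t R : ℝ, t₀ ≤ t → t ≤ R →
      K t ≤ A * (t ^ a * R ^ (-a) * K R) := by
  obtain ⟨a, ha, t₀, ht₀, A, hA⟩ := h
  refine ⟨min a 1, lt_min ha one_pos, min_le_right _ _, t₀, ht₀, max A 1, by positivity,
    fun t R ht hR => ?_⟩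
  have ht0 : 0 < t := ht₀.trans_le ht
  have hR0 : 0 < R := ht0.trans_le hR
  have h1 := hA t R ht hR
  have hKR := hK.pos R hR0.le
  have h2 : K t ≤ A * (t ^ a * R ^ (-a) * K R) := by
    have : t ^ a * (t ^ (-a) * K t) ≤ t ^ a * (A * (R ^ (-a) * K R)) := by gcongr
    rw [← mul_assoc, ← Real.rpow_add ht0, add_neg_cancel, Real.rpow_zero, one_mul] at this
    linarith
  have h3 : t ^ a * R ^ (-a) ≤ t ^ (min a 1) * R ^ (-(min a 1)) := by
    rw [Real.rpow_neg hR0.le, Real.rpow_neg hR0.le, ← div_eq_mul_inv, ← div_eq_mul_inv,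
      ← Real.div_rpow ht0.le hR0.le, ← Real.div_rpow ht0.le hR0.le]
    exact Real.rpow_le_rpow_of_exponent_ge (by positivity) ((div_le_one hR0).2 hR) (min_le_left _ _)
  refine h2.trans ?_
  have : A ≤ max A 1 := le_max_left _ _
  gcongr

/-- If `K` is of positive increase, the boundary integrals lose no logarithm. -/
theorem boundary_integral_positiveIncrease (hM : IsGrowthFunction M) (hK : IsGrowthFunction K)
    (hB : 0 < B) (hgB : ∀ s ∈ Omega M, ‖g s‖ ≤ B * (K ‖s‖ / (1 + ‖s‖)))
    (hKi : PositiveIncrease K) :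
    ∃ C₁, 0 ≤ C₁ ∧ ∀ᶠ t in atTop, ∀ x : ℝ, ∀ v₁ ∈ Icc (-(t / 2)) (t / 2),
      ∀ v₂ ∈ Icc (-(t / 2)) (t / 2), v₁ ≤ v₂ →
      ‖∫ u in v₁..v₂, g ((-(1 / M t) : ℝ) + u * Complex.I) *
        Complex.exp (((-(1 / M t) : ℝ) + u * Complex.I) * x)‖ ≤
        C₁ * K t * Real.exp (-(1 / M t * x)) := by
  obtain ⟨a, ha, ha1, t₀, ht₀, A, hA0, hA⟩ := positiveIncrease_exists_le_one hKi hK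
  refine ⟨2 * (B * (A * (1 + t₀)) / a), by positivity, ?_⟩
  filter_upwards [eventually_ge_atTop (2 / M 0), eventually_ge_atTop 2, eventually_ge_atTop t₀]
    with t htM ht2 htt₀ x v₁ hv₁ v₂ hv₂ h12
  have ht0 : 0 < t := by linarith
  have hKt := hK.pos t ht0.le
  set c := B * (A * (1 + t₀)) * (t ^ (-a) * K t) with hc
  have hc0 : 0 ≤ c := by positivity
  have hint : IntervalIntegrable (fun u : ℝ => c * u ^ (a - 1)) volume 0 (t / 2) :=
    (intervalIntegral.intervalIntegrable_rpow' (by linarith)).const_mul c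
  refine (norm_boundary_integral_le (h := fun u => c * u ^ (a - 1)) (by linarith)
    hint (fun u hu => by positivity) (fun u hu hu0 => ?_) hv₁ hv₂ h12).trans ?_
  · have hu' : |u| ≤ t / 2 := abs_le.2 hu
    obtain ⟨h1, h2⟩ := norm_boundary_le hM htM ht0.le hu'
    have h0 : 0 < |u| := abs_pos.2 hu0
    refine (hgB _ (mem_Omega_boundary hM (hu'.trans (by linarith)))).trans ?_
    set r := ‖((-(1 / M t) : ℝ) : ℂ) + u * Complex.I‖ with hr
    have hr0 : 0 < r := h0.trans_le h1
    have hmain : K r / (1 + r) ≤ A * (1 + t₀) * (t ^ (-a) * K t) * |u| ^ (a - 1) := by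
      rcases le_total t₀ r with h | h
      · have h3 := hA r t h h2
        have h4 : r ^ a / (1 + r) ≤ |u| ^ (a - 1) := by
          have h5 : r ^ a / (1 + r) ≤ r ^ (a - 1) := by
            rw [Real.rpow_sub_one hr0.ne']
            gcongr; linarith
          exact h5.trans (Real.rpow_le_rpow_of_nonpos h0 h1 (by linarith))
        calc K r / (1 + r) ≤ A * (r ^ a * t ^ (-a) * K t) / (1 + r) := by gcongr
          _ = A * 1 * (t ^ (-a) * K t) * (r ^ a / (1 + r)) := by ring
          _ ≤ A * (1 + t₀) * (t ^ (-a) * K t) * |u| ^ (a - 1) := by gcongr; linarith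
      · have h3 := hA t₀ t le_rfl htt₀
        have h4 : K r ≤ K t₀ := hK.monotoneOn (mem_Ici.2 hr0.le) (mem_Ici.2 ht₀.le) h
        have h5 : t₀ ^ a ≤ t₀ * |u| ^ (a - 1) := by
          have h6 : t₀ ^ (a - 1) ≤ |u| ^ (a - 1) :=
            Real.rpow_le_rpow_of_nonpos h0 (h1.trans h) (by linarith)
          have h7 : t₀ ^ a = t₀ * t₀ ^ (a - 1) := by
            rw [Real.rpow_sub_one ht₀.ne']; field_simp
          rw [h7]; gcongr
        calc K r / (1 + r) ≤ K r := div_le_self (hK.pos _ hr0.le).le (by linarith)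
          _ ≤ A * (t₀ ^ a * t ^ (-a) * K t) := h4.trans h3
          _ ≤ A * ((t₀ * |u| ^ (a - 1)) * t ^ (-a) * K t) := by gcongr
          _ = A * t₀ * (t ^ (-a) * K t) * |u| ^ (a - 1) := by ring
          _ ≤ _ := by gcongr; linarith
    calc B * (K r / (1 + r)) ≤ B * (A * (1 + t₀) * (t ^ (-a) * K t) * |u| ^ (a - 1)) := by gcongr
      _ = c * |u| ^ (a - 1) := by rw [hc]; ring
  · rw [intervalIntegral.integral_const_mul, integral_rpow (Or.inl (by linarith)), sub_add_cancel,
      Real.zero_rpow ha.ne', sub_zero]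
    have h1 : (t / 2) ^ a ≤ t ^ a := by gcongr; linarith
    have h2 : t ^ (-a) * t ^ a = 1 := by rw [← Real.rpow_add ht0]; simp
    calc 2 * (c * ((t / 2) ^ a / a)) * Real.exp (-(1 / M t * x))
        ≤ 2 * (c * (t ^ a / a)) * Real.exp (-(1 / M t * x)) := by gcongr
      _ = 2 * (B * (A * (1 + t₀)) / a) * (t ^ (-a) * t ^ a) * K t * Real.exp (-(1 / M t * x)) := by
        rw [hc]; ring
      _ = _ := by rw [h2, mul_one]

end

section

variable {M K S : ℝ → ℝ} {g : ℂ → ℂ} {B : ℝ}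

/-- On the dyadic block `[v / 2, v]` the path of integration is moved to the left, to the boundary
of `Ω_M` at height `|v|`; each of the two horizontal connections costs a factor `1 / x`. -/
theorem norm_dyadic_block_le (hM : IsGrowthFunction M) (hK : IsGrowthFunction K)
    (hg : IsLaplaceExtension M S g) (hB : 0 < B)
    (hgB : ∀ s ∈ Omega M, ‖g s‖ ≤ B * (K ‖s‖ / (1 + ‖s‖))) {t x v : ℝ} (htM : 2 / M 0 ≤ t)
    (hx : 0 < x) (hv : |v| ≤ t / 2) :
    ‖∫ u in (v / 2)..v, g ((-(1 / M t) : ℝ) + u * Complex.I) *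
      Complex.exp (((-(1 / M t) : ℝ) + u * Complex.I) * x)‖ ≤
      B * K t * (Real.exp (-(1 / M |v| * x)) + 2 / x * Real.exp (-(1 / M t * x))) := by
  have hM0 := hM.pos 0 le_rfl
  have ht0 : 0 < t := (by positivity : (0 : ℝ) < 2 / M 0).trans_le htM
  have hKt := hK.pos t ht0.le
  have hMv : M |v| ≤ M t :=
    hM.monotoneOn (mem_Ici.2 (abs_nonneg v)) (mem_Ici.2 ht0.le) (by linarith)
  have hMv0 : M 0 ≤ M |v| :=
    hM.monotoneOn (mem_Ici.2 le_rfl) (mem_Ici.2 (abs_nonneg v)) (abs_nonneg v)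
  set δ := 1 / M t with hδ
  set δ' := 1 / M |v| with hδ'
  have hδ0 : 0 < δ := one_div_pos.2 (hM.pos t ht0.le)
  have hδδ' : δ ≤ δ' := one_div_le_one_div_of_le (hM.pos _ (abs_nonneg v)) hMv
  have hδ't : δ' ≤ t / 2 := by
    have h1 : δ' ≤ 1 / M 0 := one_div_le_one_div_of_le hM0 hMv0
    have h6 : 1 / M 0 ≤ t / 2 := by
      rw [div_le_iff₀ hM0] at htM ⊢
      linarith
    exact h1.trans h6
  set F : ℂ → ℂ := fun s => g s * Complex.exp (s * x) with hF
  have hsub : Icc (-δ') (-δ) ×ℂ Icc (-|v|) |v| ⊆ Omega M :=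
    rect_subset_Omega hM le_rfl (abs_nonneg v) le_rfl (by linarith)
  have hrect : RectShift (-δ') (-δ) |v| F := by
    apply rectShift_of_differentiableOn
    · exact (hg.continuousOn.mono hsub).mul (by fun_prop)
    · exact (hg.differentiableOn.mono (rect_subset_interior_Omega hM le_rfl (abs_nonneg v) le_rfl
        (by linarith))).mul (by fun_prop)
  have hbd : ∀ r ∈ Icc (-δ') (-δ), ∀ u ∈ Icc (-|v|) |v|, ‖F (r + u * Complex.I)‖ ≤
      B * K t / (1 + |u|) * Real.exp (r * x) := by
    intro r hr u hu
    have e1 : ((r : ℂ) + u * Complex.I).re = r := by simp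
    have e2 : ((r : ℂ) + u * Complex.I).im = u := by simp
    have e3 : (((r : ℂ) + u * Complex.I) * x).re = r * x := by simp
    have hmem : (r : ℂ) + u * Complex.I ∈ Omega M := by
      apply hsub
      rw [Complex.mem_reProdIm, e1, e2]
      exact ⟨hr, hu⟩
    have h3 := Complex.abs_im_le_norm ((r : ℂ) + u * Complex.I)
    have h4 := Complex.norm_le_abs_re_add_abs_im ((r : ℂ) + u * Complex.I)
    rw [e2] at h3
    rw [e1, e2, abs_of_nonpos (by linarith [hr.2])] at h4
    have hu' : |u| ≤ |v| := abs_le.2 hu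
    have h5 : ‖(r : ℂ) + u * Complex.I‖ ≤ t := by linarith [hr.1]
    have h6 := hK.monotoneOn (mem_Ici.2 (norm_nonneg _)) (mem_Ici.2 ht0.le) h5
    rw [hF]
    simp only [norm_mul, Complex.norm_exp, e3]
    gcongr
    refine (hgB _ hmem).trans ?_
    rw [mul_div_assoc]
    gcongr
  have hv1 : v ∈ Icc (-|v|) |v| := ⟨neg_abs_le v, le_abs_self v⟩
  have hv2 : v / 2 ∈ Icc (-|v|) |v| := by
    have := neg_abs_le v
    have := le_abs_self v
    have := abs_nonneg v
    constructor <;> linarith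
  have key := hrect (-δ) ⟨by linarith, le_rfl⟩ (v / 2) hv2 v hv1
  have hbd1 : ‖∫ u in (v / 2)..v, F ((-δ' : ℝ) + u * Complex.I)‖ ≤
      B * K t * Real.exp (-(δ' * x)) := by
    have h1 : ∀ u ∈ uIoc (v / 2) v, ‖F ((-δ' : ℝ) + u * Complex.I)‖ ≤
        B * K t / (1 + |v| / 2) * Real.exp (-(δ' * x)) := by
      intro u hu
      have hu1 : u ∈ Icc (-|v|) |v| := by
        have h1 := uIoc_subset_uIcc hu
        exact (uIcc_subset_Icc hv2 hv1) h1
      have hu2 : |v| / 2 ≤ |u| := by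
        rcases le_total 0 v with h | h
        · rw [uIoc_of_le (by linarith)] at hu
          rw [abs_of_nonneg h, abs_of_nonneg (by linarith [hu.1])]
          exact hu.1.le
        · rw [uIoc_of_ge (by linarith)] at hu
          rw [abs_of_nonpos h, abs_of_nonpos (by linarith [hu.2])]
          linarith [hu.2]
      refine (hbd (-δ') ⟨le_rfl, by linarith⟩ u hu1).trans ?_
      rw [neg_mul]
      gcongr
    refine (intervalIntegral.norm_integral_le_of_norm_le_const h1).trans ?_
    have e : |v - v / 2| = |v| / 2 := by
      rw [show v - v / 2 = v / 2 by ring, abs_div, abs_of_pos (two_pos : (0 : ℝ) < 2)]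
    rw [e]
    have h2 : B * K t / (1 + |v| / 2) * (|v| / 2) ≤ B * K t := by
      rw [div_mul_eq_mul_div, div_le_iff₀ (by positivity)]
      nlinarith [abs_nonneg v, mul_pos hB hKt]
    calc _ = B * K t / (1 + |v| / 2) * (|v| / 2) * Real.exp (-(δ' * x)) := by ring
      _ ≤ _ := by gcongr
  have hhor : ∀ u ∈ Icc (-|v|) |v|, ∀ y ∈ Ioc (-δ') (-δ), ‖F (y + u * Complex.I)‖ ≤
      B * K t * Real.exp (y * x) := by
    intro u hu y hy
    refine (hbd y ⟨hy.1.le, hy.2⟩ u hu).trans ?_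
    gcongr
    exact div_le_self (by positivity) (by linarith [abs_nonneg u])
  have hexp : ∫ y in (-δ')..(-δ), B * K t * Real.exp (y * x) * 2 ≤
      B * K t * (2 / x * Real.exp (-(δ * x))) := by
    rw [intervalIntegral.integral_mul_const, intervalIntegral.integral_const_mul,
      intervalIntegral.integral_comp_mul_right (fun y => Real.exp y) hx.ne', integral_exp,
      smul_eq_mul, neg_mul]
    have : 0 < Real.exp (-δ' * x) := Real.exp_pos _
    calc _ ≤ B * K t * (x⁻¹ * Real.exp (-(δ * x))) * 2 := by gcongr; linarith
      _ = _ := by ring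
  have hbd2 : ‖∫ y in (-δ')..(-δ), (F (y + v * Complex.I) - F (y + (v / 2 : ℝ) * Complex.I))‖ ≤
      B * K t * (2 / x * Real.exp (-(δ * x))) := by
    refine le_trans ?_ hexp
    apply intervalIntegral.norm_integral_le_of_norm_le (by linarith)
    · refine ae_of_all _ fun y hy => ?_
      refine (norm_sub_le _ _).trans ?_
      linarith [hhor v hv1 y hy, hhor (v / 2) hv2 y hy]
    · exact Continuous.intervalIntegrable (by fun_prop) _ _
  rw [key, mul_add]
  refine (norm_sub_le _ _).trans (add_le_add hbd1 ?_)
  rw [norm_mul, Complex.norm_I, one_mul]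
  exact hbd2

/-- Growth of `M` at least like a power of the logarithm makes `e^{-x / M(v)}` decay like a power
of `v / t`. -/
theorem exp_neg_div_le_rpow (hM : IsGrowthFunction M) {β v t x : ℝ} (hβ : 0 < β) (hv : 1 < v)
    (hvt : v ≤ t) (hMl : M v / Real.log v ^ β ≤ M t / Real.log t ^ β)
    (hx : M t * (Real.log t / 2) ≤ x) :
    Real.exp (-(1 / M v * x)) ≤ Real.exp (-(1 / M t * x)) * (v / t) ^ (β / 2) := by
  have hv0 : 0 < v := by linarith
  have ht0 : 0 < t := by linarith
  have hMv := hM.pos v hv0.le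
  have hMt := hM.pos t ht0.le
  have hlv : 0 < Real.log v := Real.log_pos hv
  have hlvt : Real.log v ≤ Real.log t := Real.log_le_log (by linarith) hvt
  have hlt : 0 < Real.log t := by linarith
  set y := Real.log t / Real.log v with hy
  have hy0 : 0 < y := by positivity
  have h1 : 1 + β * (1 - y⁻¹) ≤ y ^ β := by
    rw [Real.rpow_def_of_pos hy0]
    have h2 := Real.add_one_le_exp (Real.log y * β)
    have h3 := Real.one_sub_inv_le_log_of_pos hy0
    nlinarith
  have h2 : 1 / M t * y ^ β ≤ 1 / M v := by
    rw [hy, Real.div_rpow hlt.le hlv.le]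
    rw [div_le_div_iff₀ (by positivity) (by positivity)] at hMl
    rw [div_mul_div_comm, one_mul, div_le_div_iff₀ (by positivity) hMv]
    linarith
  have h3 : Real.log t / 2 ≤ 1 / M t * x := by
    rw [one_div, inv_mul_eq_div, le_div_iff₀ hMt]
    linarith
  have hx0 : 0 < x := lt_of_lt_of_le (by positivity) hx
  have h4 : 1 - y⁻¹ = (Real.log t - Real.log v) / Real.log t := by
    rw [hy]; field_simp
  have h5 : 1 / M t * x + (Real.log t - Real.log v) * (β / 2) ≤ 1 / M v * x := by
    have h6 : 1 / M t * (1 + β * (1 - y⁻¹)) * x ≤ 1 / M v * x := by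
      gcongr
      refine le_trans ?_ h2
      gcongr
    refine le_trans ?_ h6
    have h7 : (Real.log t - Real.log v) * (β / 2) ≤ 1 / M t * x * (β * (1 - y⁻¹)) := by
      have h8 : 0 ≤ 1 - y⁻¹ := by rw [h4]; exact div_nonneg (by linarith) hlt.le
      calc (Real.log t - Real.log v) * (β / 2) = Real.log t / 2 * (β * (1 - y⁻¹)) := by
            rw [h4]; field_simp
        _ ≤ _ := by gcongr
    linarith
  rw [Real.rpow_def_of_pos (by positivity), ← Real.exp_add, Real.exp_le_exp,
    Real.log_div (by linarith) (by linarith)]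
  linarith

/-- If `M(t) / log^β t` is eventually non-decreasing, the boundary integrals lose no logarithm:
the dyadic blocks form a geometric series. -/
theorem boundary_integral_logPower (hM : IsGrowthFunction M) (hK : IsGrowthFunction K)
    (hg : IsLaplaceExtension M S g) (hB : 0 < B)
    (hgB : ∀ s ∈ Omega M, ‖g s‖ ≤ B * (K ‖s‖ / (1 + ‖s‖))) (hMl : LogPowerIncrease M) :
    ∃ C₁, 0 ≤ C₁ ∧ ∀ᶠ t in atTop, ∀ x : ℝ, M t * (Real.log t + Real.log (K t)) ≤ x →
      ∀ v₁ ∈ Icc (-(t / 2)) (t / 2), ∀ v₂ ∈ Icc (-(t / 2)) (t / 2), v₁ ≤ v₂ →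
      ‖∫ u in v₁..v₂, g ((-(1 / M t) : ℝ) + u * Complex.I) *
        Complex.exp (((-(1 / M t) : ℝ) + u * Complex.I) * x)‖ ≤
        C₁ * K t * Real.exp (-(1 / M t * x)) := by
  obtain ⟨β, hβ, t₁, hmono⟩ := hMl
  have hM0 := hM.pos 0 le_rfl
  set T₀ := max t₁ 2 with hT₀
  have hT2 : 2 ≤ T₀ := le_max_right _ _
  set γ := β / 2 with hγ
  have hγ0 : 0 < γ := by positivity
  have hq : (1 / 2 : ℝ) ^ γ < 1 := Real.rpow_lt_one (by norm_num) (by norm_num) hγ0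
  set c₁ := 1 / (1 - (1 / 2 : ℝ) ^ γ) with hc₁
  have hc₁0 : 0 < c₁ := by rw [hc₁]; apply one_div_pos.2; linarith
  have hc₁e : c₁ * (1 / 2 : ℝ) ^ γ + 1 = c₁ := by
    have : 1 - (1 / 2 : ℝ) ^ γ ≠ 0 := by linarith
    rw [hc₁]; field_simp; ring
  refine ⟨2 * (B * (T₀ + c₁ + 12 / M 0)), by positivity, ?_⟩
  have hlogK : ∀ᶠ t in atTop, -2 * Real.log (K 0) ≤ Real.log t :=
    Real.tendsto_log_atTop.eventually_ge_atTop _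
  filter_upwards [eventually_ge_atTop (2 / M 0), eventually_ge_atTop T₀, hlogK,
    Real.tendsto_log_atTop.eventually_ge_atTop 1] with t htM htT htK htl x hx v₁ hv₁ v₂ hv₂ h12
  have ht0 : 0 < t := by linarith
  have hKt := hK.pos t ht0.le
  have hMt := hM.pos t ht0.le
  have hMt0 : M 0 ≤ M t := hM.monotoneOn (mem_Ici.2 le_rfl) (mem_Ici.2 ht0.le) ht0.le
  have hlogKt := log_growth_monotoneOn hK (mem_Ici.2 le_rfl) (mem_Ici.2 ht0.le) ht0.le
  simp only at hlogKt
  have hx1 : M t * (Real.log t / 2) ≤ x := by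
    refine le_trans ?_ hx
    gcongr
    linarith
  have hx2 : M 0 * (Real.log t / 2) ≤ x := by
    refine le_trans ?_ hx1
    gcongr
  have hx0 : 0 < x := lt_of_lt_of_le (by positivity) hx2
  set E := Real.exp (-(1 / M t * x)) with hE
  have hE0 : 0 < E := Real.exp_pos _
  set F : ℝ → ℂ := fun u => g ((-(1 / M t) : ℝ) + u * Complex.I) *
    Complex.exp (((-(1 / M t) : ℝ) + u * Complex.I) * x) with hF
  have hFc : ContinuousOn F (Icc (-(t / 2)) (t / 2)) := by
    refine ContinuousOn.mul (hg.continuousOn.comp (by fun_prop) fun u hu => ?_) (by fun_prop)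
    exact mem_Omega_boundary hM ((abs_le.2 hu).trans (by linarith))
  have hint : ∀ a ∈ Icc (-(t / 2)) (t / 2), ∀ b ∈ Icc (-(t / 2)) (t / 2),
      IntervalIntegrable F volume a b := fun a ha b hb =>
    (hFc.mono (uIcc_subset_Icc ha hb)).intervalIntegrable
  have hFb : ∀ u ∈ Icc (-(t / 2)) (t / 2), ‖F u‖ ≤ B * K t * E := by
    intro u hu
    have hu' : |u| ≤ t / 2 := abs_le.2 hu
    obtain ⟨h1, h2⟩ := norm_boundary_le hM htM ht0.le hu'
    have e : (((-(1 / M t) : ℝ) + u * Complex.I) * (x : ℂ)).re = -(1 / M t * x) := by simp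
    rw [hF]
    simp only [norm_mul, Complex.norm_exp, e]
    gcongr
    refine (hgB _ (mem_Omega_boundary hM (hu'.trans (by linarith)))).trans ?_
    have h3 := hK.monotoneOn (mem_Ici.2 (norm_nonneg _)) (mem_Ici.2 ht0.le) h2
    gcongr
    have h4 := norm_nonneg (((-(1 / M t) : ℝ) : ℂ) + u * Complex.I)
    exact (div_le_self (hK.pos _ h4).le (by linarith)).trans h3
  have h0mem : (0 : ℝ) ∈ Icc (-(t / 2)) (t / 2) := ⟨by linarith, by linarith⟩
  have key : ∀ n : ℕ, ∀ v : ℝ, |v| ≤ t / 2 → |v| ≤ T₀ * 2 ^ n →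
      ‖∫ u in (0 : ℝ)..v, F u‖ ≤ B * K t * E * (T₀ + c₁ * (|v| / t) ^ γ + 2 / x * n) := by
    have base : ∀ n : ℕ, ∀ v : ℝ, |v| ≤ t / 2 → |v| ≤ T₀ →
        ‖∫ u in (0 : ℝ)..v, F u‖ ≤ B * K t * E * (T₀ + c₁ * (|v| / t) ^ γ + 2 / x * n) := by
      intro n v hv hvT
      have h1 : ‖∫ u in (0 : ℝ)..v, F u‖ ≤ B * K t * E * |v - 0| :=
        intervalIntegral.norm_integral_le_of_norm_le_const fun u hu => hFb u
          ((uIcc_subset_Icc h0mem (abs_le.1 hv)) (uIoc_subset_uIcc hu))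
      refine h1.trans ?_
      rw [sub_zero]
      have : 0 ≤ c₁ * (|v| / t) ^ γ + 2 / x * n := by positivity
      gcongr
      linarith
    intro n
    induction n with
    | zero => intro v hv hvT; exact base 0 v hv (by simpa using hvT)
    | succ n ih =>
      intro v hv hvT
      rcases le_total |v| T₀ with h | h
      · exact base _ v hv h
      have hv2 : |v / 2| = |v| / 2 := by rw [abs_div, abs_of_pos (two_pos : (0 : ℝ) < 2)]
      have h1 := ih (v / 2) (by rw [hv2]; linarith [abs_nonneg v])
        (by rw [hv2]; rw [pow_succ] at hvT; linarith)
      have h2 := norm_dyadic_block_le hM hK hg hB hgB htM hx0 hv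
      have h3 := exp_neg_div_le_rpow (x := x) hM hβ (v := |v|) (t := t) (by linarith)
        (by linarith) (hmono (mem_Ici.2 ((le_max_left _ _).trans h))
          (mem_Ici.2 ((le_max_left _ _).trans htT)) (by linarith)) hx1
      have h4 := intervalIntegral.integral_add_adjacent_intervals
        (hint 0 h0mem (v / 2) (abs_le.1 (by rw [hv2]; linarith [abs_nonneg v])))
        (hint (v / 2) (abs_le.1 (by rw [hv2]; linarith [abs_nonneg v])) v (abs_le.1 hv))
      rw [← h4]
      refine (norm_add_le _ _).trans ((add_le_add h1 h2).trans ?_)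
      have h5 : (|v / 2| / t) ^ γ = (1 / 2 : ℝ) ^ γ * (|v| / t) ^ γ := by
        rw [← Real.mul_rpow (by norm_num) (by positivity), hv2]; congr 1; ring
      rw [h5]
      have h6 : B * K t * (Real.exp (-(1 / M |v| * x)) + 2 / x * E) ≤
          B * K t * (E * (|v| / t) ^ γ + 2 / x * E) := by gcongr
      refine (add_le_add le_rfl h6).trans (le_of_eq ?_)
      push_cast
      linear_combination (B * K t * E * (|v| / t) ^ γ) * hc₁e
  -- the number of halvings that lead from `t` to `T₀`
  set n := ⌈Real.log t / Real.log 2⌉₊ with hn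
  have hl2 : 0 < Real.log 2 := Real.log_pos one_lt_two
  have hn1 : t ≤ 2 ^ n := by
    have h1 : Real.log t / Real.log 2 ≤ n := Nat.le_ceil _
    rw [div_le_iff₀ hl2, ← Real.log_pow] at h1
    exact (Real.log_le_log_iff ht0 (by positivity)).1 h1
  have hn2 : (n : ℝ) ≤ 3 * Real.log t := by
    have h1 : (n : ℝ) < Real.log t / Real.log 2 + 1 := Nat.ceil_lt_add_one (by positivity)
    have h2 : Real.log t / Real.log 2 ≤ 2 * Real.log t := by
      rw [div_le_iff₀ hl2]
      nlinarith [Real.log_two_gt_d9]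
    linarith
  have hn3 : 2 / x * n ≤ 12 / M 0 := by
    rw [div_mul_eq_mul_div, div_le_div_iff₀ hx0 hM0]
    nlinarith
  have hfin : ∀ v ∈ Icc (-(t / 2)) (t / 2), ‖∫ u in (0 : ℝ)..v, F u‖ ≤
      B * K t * E * (T₀ + c₁ + 12 / M 0) := by
    intro v hv
    have hv' : |v| ≤ t / 2 := abs_le.2 hv
    refine (key n v hv' ?_).trans ?_
    · have : (2 : ℝ) ^ n ≤ T₀ * 2 ^ n := le_mul_of_one_le_left (by positivity) (by linarith)
      linarith
    · have h1 : (|v| / t) ^ γ ≤ 1 :=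
        Real.rpow_le_one (by positivity) ((div_le_one ht0).2 (by linarith)) hγ0.le
      have : c₁ * (|v| / t) ^ γ ≤ c₁ := mul_le_of_le_one_right hc₁0.le h1
      gcongr
  rw [← intervalIntegral.integral_interval_sub_left (hint 0 h0mem v₂ hv₂) (hint 0 h0mem v₁ hv₁)]
  refine (norm_sub_le _ _).trans ((add_le_add (hfin v₂ hv₂) (hfin v₁ hv₁)).trans (le_of_eq ?_))
  ring

end

/-! ### The inverse functions and the decay rates -/

section

variable {M K : ℝ → ℝ}

theorem tendsto_MKlogInv (hM : IsGrowthFunction M) (hK : IsGrowthFunction K) :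
    Tendsto (MKlogInv M K) atTop atTop := by
  rw [tendsto_atTop]
  intro R
  filter_upwards [eventually_gt_atTop 0, eventually_gt_atTop
    (M R * |Real.log R + Real.log (Real.log R) + Real.log (K R)|)] with x hx0 hx
  obtain ⟨h1, h2⟩ := MKlogInv_spec hM hK hx0
  set T := MKlogInv M K x with hT
  by_contra hTR
  have hTR : T ≤ R := (not_le.1 hTR).le
  have hlogT := Real.log_pos h1
  have hT0 : 0 < T := by linarith
  have hR0 : 0 ≤ R := by linarith
  have h3 : Real.log T ≤ Real.log R := Real.log_le_log hT0 hTR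
  have h4 : Real.log (Real.log T) ≤ Real.log (Real.log R) := Real.log_le_log hlogT h3
  have h5 := log_growth_monotoneOn hK (mem_Ici.2 hT0.le) (mem_Ici.2 hR0) hTR
  simp only at h5
  have h6 : M T ≤ M R := hM.monotoneOn (mem_Ici.2 hT0.le) (mem_Ici.2 hR0) hTR
  have h7 := hM.pos T hT0.le
  have h8 : MKlog M K T ≤ M R * |Real.log R + Real.log (Real.log R) + Real.log (K R)| := by
    unfold MKlog
    calc _ ≤ M T * |Real.log R + Real.log (Real.log R) + Real.log (K R)| := by
          gcongr
          exact le_trans (by linarith) (le_abs_self _)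
      _ ≤ _ := by gcongr
  linarith

theorem tendsto_MKInv (hM : IsGrowthFunction M) (hK : IsGrowthFunction K) :
    Tendsto (MKInv M K) atTop atTop := by
  rw [tendsto_atTop]
  intro R
  filter_upwards [eventually_gt_atTop 0, eventually_gt_atTop
    (M R * |Real.log R + Real.log (K R)|)] with x hx0 hx
  obtain ⟨hT0, h2⟩ := MKInv_spec hM hK hx0
  set T := MKInv M K x with hT
  by_contra hTR
  have hTR : T ≤ R := (not_le.1 hTR).le
  have hR0 : 0 ≤ R := by linarith
  have h3 : Real.log T ≤ Real.log R := Real.log_le_log hT0 hTR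
  have h5 := log_growth_monotoneOn hK (mem_Ici.2 hT0.le) (mem_Ici.2 hR0) hTR
  simp only at h5
  have h6 : M T ≤ M R := hM.monotoneOn (mem_Ici.2 hT0.le) (mem_Ici.2 hR0) hTR
  have h7 := hM.pos T hT0.le
  have h8 : MK M K T ≤ M R * |Real.log R + Real.log (K R)| := by
    unfold MK
    calc _ ≤ M T * |Real.log R + Real.log (K R)| := by
          gcongr
          exact le_trans (by linarith) (le_abs_self _)
      _ ≤ _ := by gcongr
  linarith

theorem tendsto_log_add_log (hK : IsGrowthFunction K) :
    Tendsto (fun t => Real.log t + Real.log (K t)) atTop atTop :=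
  tendsto_atTop_add_right_of_le' _ (Real.log (K 0)) Real.tendsto_log_atTop <| by
    filter_upwards [eventually_ge_atTop 0] with t ht
    exact log_growth_monotoneOn hK (mem_Ici.2 le_rfl) (mem_Ici.2 ht) ht

theorem tendsto_log_add_loglog_add_log (hK : IsGrowthFunction K) :
    Tendsto (fun t => Real.log t + Real.log (Real.log t) + Real.log (K t)) atTop atTop := by
  refine tendsto_atTop_mono' _ ?_ (tendsto_log_add_log hK)
  filter_upwards [Real.tendsto_log_atTop.eventually_ge_atTop 1] with t ht
  linarith [Real.log_nonneg ht]

/-- Regular growth turns into an additive gain. -/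
theorem eventually_MKlog_add_le (hM : IsGrowthFunction M) (hK : IsGrowthFunction K)
    {b : ℝ} (hb : 0 < b) (h : RegularGrowth (fun t => M t * t / b) (MKlog M K)) :
    ∃ C', 0 < C' ∧ ∀ᶠ t in atTop, MKlog M K t +
      b * (Real.log t + Real.log (Real.log t) + Real.log (K t)) / t ≤ MKlog M K (C' * t) := by
  obtain ⟨C', hC', t₀, -, h⟩ := h
  refine ⟨C', hC', ?_⟩
  filter_upwards [eventually_ge_atTop t₀, eventually_gt_atTop 0,
    (tendsto_log_add_loglog_add_log hK).eventually_gt_atTop 0] with t ht ht0 hL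
  have hMt := hM.pos t ht0.le
  have hV : 0 < MKlog M K t := mul_pos hMt hL
  have h1 := h t ht
  rw [le_div_iff₀ hV] at h1
  refine le_trans (le_of_eq ?_) h1
  unfold MKlog
  field_simp

/-- An increment of `M_{K,log}` is at most twice the corresponding increment of `M_K`, because
`log log t` and its increments are dominated by `log t + log K(t)` and its increments. -/
theorem MKlog_sub_le (hM : IsGrowthFunction M) {t T : ℝ} (hK : IsGrowthFunction K)
    (ht : 1 ≤ Real.log t) (htT : t ≤ T) (ht0 : 0 < t)
    (hT : Real.log (Real.log T) ≤ Real.log T + Real.log (K T)) :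
    MKlog M K T - MKlog M K t ≤ 2 * (MK M K T - MK M K t) := by
  have hMt := hM.pos t ht0.le
  have hMM : M t ≤ M T := hM.monotoneOn (mem_Ici.2 ht0.le) (mem_Ici.2 (ht0.le.trans htT)) htT
  have h1 : Real.log t ≤ Real.log T := Real.log_le_log ht0 htT
  have h2 : Real.log (Real.log T) - Real.log (Real.log t) ≤ Real.log T - Real.log t := by
    rw [← Real.log_div (by linarith) (by linarith)]
    refine (Real.log_le_sub_one_of_pos (div_pos (by linarith) (by linarith))).trans ?_
    rw [div_sub_one (by linarith)]
    exact div_le_self (by linarith) ht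
  have h3 := log_growth_monotoneOn hK (mem_Ici.2 ht0.le) (mem_Ici.2 (ht0.le.trans htT)) htT
  simp only at h3
  have h4 : M t * (Real.log (Real.log T) - Real.log (Real.log t)) ≤
      M t * (Real.log T + Real.log (K T) - (Real.log t + Real.log (K t))) :=
    mul_le_mul_of_nonneg_left (by linarith) hMt.le
  have h5 : (M T - M t) * Real.log (Real.log T) ≤
      (M T - M t) * (Real.log T + Real.log (K T)) :=
    mul_le_mul_of_nonneg_left hT (by linarith)
  unfold MKlog MK
  linarith

end

section

variable {M K S : ℝ → ℝ}

/-- The decay estimate for `Λ = log t + log log t + log K(t)`. -/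
theorem exists_decay_of_tauberianClass (hM : IsGrowthFunction M) (hK : IsGrowthFunction K)
    (hS : TauberianClass M K S) :
    ∃ C₂, 0 ≤ C₂ ∧ ∀ᶠ t in atTop, ∀ x, MKlog M K t +
      100 * (Real.log t + Real.log (Real.log t) + Real.log (K t)) / t ≤ x → |S x| ≤ C₂ / t := by
  obtain ⟨⟨C, hC, hmono⟩, hconv, g, hg, R, hgR⟩ := hS
  obtain ⟨B, hB, hgB⟩ := exists_extension_bound hM hK hg.continuousOn ⟨R, hgR⟩
  refine exists_decay hM hK hC.le hmono hconv hg hB hgB (tendsto_log_add_loglog_add_log hK)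
    (Eventually.of_forall fun t => le_rfl) (C₁ := 2 * B) ?_
  filter_upwards [boundary_integral_general hM hK hB hgB,
    Real.tendsto_log_atTop.eventually_ge_atTop 1, eventually_gt_atTop 0] with t h hl ht0
    x _ v₁ hv₁ v₂ hv₂ h12
  refine (h x v₁ hv₁ v₂ hv₂ h12).trans (le_of_eq ?_)
  have hKt := hK.pos t ht0.le
  rw [sub_eq_add_neg, Real.exp_add, Real.exp_add, Real.exp_add, Real.exp_log ht0,
    Real.exp_log (by linarith), Real.exp_log hKt, one_div, inv_mul_eq_div]
  field_simp

/-- The decay estimate for `Λ = log t + log K(t)`, in the cases in which the boundary integrals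
lose no logarithm. -/
theorem exists_decay_of_tauberianClass_refined (hM : IsGrowthFunction M) (hK : IsGrowthFunction K)
    (hS : TauberianClass M K S) (h : PositiveIncrease K ∨ LogPowerIncrease M) :
    ∃ C₂, 0 ≤ C₂ ∧ ∀ᶠ t in atTop, ∀ x, MK M K t +
      100 * (Real.log t + Real.log (Real.log t) + Real.log (K t)) / t ≤ x → |S x| ≤ C₂ / t := by
  obtain ⟨⟨C, hC, hmono⟩, hconv, g, hg, R, hgR⟩ := hS
  obtain ⟨B, hB, hgB⟩ := exists_extension_bound hM hK hg.continuousOn ⟨R, hgR⟩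
  obtain ⟨C₁, -, hQ⟩ : ∃ C₁, 0 ≤ C₁ ∧ ∀ᶠ t in atTop, ∀ x : ℝ,
      M t * (Real.log t + Real.log (K t)) ≤ x → ∀ v₁ ∈ Icc (-(t / 2)) (t / 2),
      ∀ v₂ ∈ Icc (-(t / 2)) (t / 2), v₁ ≤ v₂ →
      ‖∫ u in v₁..v₂, g ((-(1 / M t) : ℝ) + u * Complex.I) *
        Complex.exp (((-(1 / M t) : ℝ) + u * Complex.I) * x)‖ ≤
        C₁ * K t * Real.exp (-(1 / M t * x)) := by
    rcases h with h | h
    · obtain ⟨C₁, h1, h2⟩ := boundary_integral_positiveIncrease hM hK hB hgB h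
      exact ⟨C₁, h1, h2.mono fun t ht x _ => ht x⟩
    · exact boundary_integral_logPower hM hK hg hB hgB h
  refine exists_decay hM hK hC.le hmono hconv hg hB hgB (tendsto_log_add_log hK) ?_ (C₁ := C₁) ?_
  · filter_upwards [Real.tendsto_log_atTop.eventually_ge_atTop 1] with t ht
    linarith [Real.log_nonneg ht]
  filter_upwards [hQ, eventually_gt_atTop 0] with t h ht0 x hx v₁ hv₁ v₂ hv₂ h12
  refine (h x hx v₁ hv₁ v₂ hv₂ h12).trans (le_of_eq ?_)
  have hKt := hK.pos t ht0.le
  rw [sub_eq_add_neg, Real.exp_add, Real.exp_add, Real.exp_log ht0,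
    Real.exp_log hKt, one_div, inv_mul_eq_div]
  field_simp

theorem isBigO_MKlogInv_mul (hM : IsGrowthFunction M) (hK : IsGrowthFunction K)
    (hS : TauberianClass M K S) {c : ℝ} (hc0 : 0 < c) (hc1 : c < 1) :
    S =O[atTop] fun x : ℝ => 1 / MKlogInv M K (c * x) := by
  obtain ⟨C₂, hC₂, hdec⟩ := exists_decay_of_tauberianClass hM hK hS
  have hM0 := hM.pos 0 le_rfl
  have hc : 0 < 1 / c - 1 := by
    rw [sub_pos, one_lt_div hc0]; exact hc1
  have hev : ∀ᶠ t in atTop, ∀ x, MKlog M K t = c * x → |S x| ≤ C₂ / t := by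
    filter_upwards [hdec, eventually_gt_atTop 0, eventually_ge_atTop (100 / ((1 / c - 1) * M 0)),
      (tendsto_log_add_loglog_add_log hK).eventually_gt_atTop 0] with t h ht0 ht1 hL x hx
    apply h
    have hMt : M 0 ≤ M t := hM.monotoneOn (mem_Ici.2 le_rfl) (mem_Ici.2 ht0.le) ht0.le
    have h1 : x = MKlog M K t + (1 / c - 1) * MKlog M K t := by rw [hx]; field_simp; ring
    rw [h1]
    gcongr
    unfold MKlog
    rw [div_le_iff₀ (by positivity)] at ht1
    rw [div_le_iff₀ ht0]
    set L := Real.log t + Real.log (Real.log t) + Real.log (K t)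
    calc 100 * L ≤ t * ((1 / c - 1) * M 0) * L := by gcongr
      _ ≤ t * ((1 / c - 1) * M t) * L := by gcongr
      _ = _ := by ring
  have htend : Tendsto (fun x => MKlogInv M K (c * x)) atTop atTop :=
    (tendsto_MKlogInv hM hK).comp (tendsto_id.const_mul_atTop hc0)
  refine IsBigO.of_bound C₂ ?_
  filter_upwards [htend.eventually hev, eventually_gt_atTop 0] with x hx hx0
  obtain ⟨h1, h2⟩ := MKlogInv_spec hM hK (mul_pos hc0 hx0)
  have := hx x h2
  have hinv : 0 < 1 / MKlogInv M K (c * x) := one_div_pos.2 (by linarith)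
  rw [Real.norm_eq_abs, Real.norm_eq_abs, abs_of_pos hinv, mul_one_div]
  exact this

theorem isBigO_MKlogInv (hM : IsGrowthFunction M) (hK : IsGrowthFunction K)
    (hS : TauberianClass M K S) (hV : RegularGrowth (fun t => M t * t / 675) (MKlog M K)) :
    S =O[atTop] fun x : ℝ => 1 / MKlogInv M K x := by
  obtain ⟨C₂, hC₂, hdec⟩ := exists_decay_of_tauberianClass hM hK hS
  obtain ⟨C', hC', hV⟩ := eventually_MKlog_add_le hM hK (by norm_num) hV
  have htend : Tendsto (fun x => MKlogInv M K x / C') atTop atTop :=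
    (tendsto_MKlogInv hM hK).atTop_div_const hC'
  refine IsBigO.of_bound (C₂ * C') ?_
  filter_upwards [htend.eventually hdec, htend.eventually hV,
    htend.eventually (eventually_gt_atTop 0),
    htend.eventually ((tendsto_log_add_loglog_add_log hK).eventually_gt_atTop 0),
    eventually_gt_atTop 0] with x h1 h2 ht0 hL hx0
  obtain ⟨hT1, hT2⟩ := MKlogInv_spec hM hK hx0
  set T := MKlogInv M K x with hT
  set t := T / C' with ht
  rw [show C' * t = T by rw [ht]; field_simp, hT2] at h2
  have h3 := h1 x (le_trans (by gcongr; norm_num) h2)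
  have hinv : 0 < 1 / T := one_div_pos.2 (by linarith)
  rw [Real.norm_eq_abs, Real.norm_eq_abs, abs_of_pos hinv]
  refine h3.trans (le_of_eq ?_)
  have hT0 : T ≠ 0 := by linarith
  rw [ht]; field_simp

theorem isBigO_MKInv (hM : IsGrowthFunction M) (hK : IsGrowthFunction K)
    (hS : TauberianClass M K S) (hV : RegularGrowth (fun t => M t * t / 675) (MKlog M K))
    (h : PositiveIncrease K ∨ LogPowerIncrease M) :
    S =O[atTop] fun x : ℝ => 1 / MKInv M K x := by
  obtain ⟨C₂, hC₂, hdec⟩ := exists_decay_of_tauberianClass_refined hM hK hS h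
  obtain ⟨C', hC', hV⟩ := eventually_MKlog_add_le hM hK (by norm_num) hV
  have htendT := tendsto_MKInv hM hK
  have htend : Tendsto (fun x => MKInv M K x / C') atTop atTop := htendT.atTop_div_const hC'
  have hloglog : ∀ᶠ T in atTop, Real.log (Real.log T) ≤ Real.log T + Real.log (K T) := by
    have h1 : ∀ᶠ y in atTop, Real.log y ≤ y / 2 := by
      have := Real.isLittleO_log_id_atTop.def (c := 1 / 2) (by norm_num)
      filter_upwards [this, eventually_ge_atTop 0] with y hy hy0
      have h2 := (le_abs_self _).trans hy
      rw [id, Real.norm_eq_abs, abs_of_nonneg hy0] at h2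
      linarith
    filter_upwards [Real.tendsto_log_atTop.eventually h1,
      Real.tendsto_log_atTop.eventually_ge_atTop (-2 * Real.log (K 0)),
      eventually_ge_atTop 0] with T h1 h2 h3
    have h5 := log_growth_monotoneOn hK (mem_Ici.2 le_rfl) (mem_Ici.2 h3) h3
    simp only at h5
    linarith
  refine IsBigO.of_bound (C₂ * C') ?_
  filter_upwards [htend.eventually hdec, htend.eventually hV,
    htend.eventually (eventually_gt_atTop 0), htendT.eventually hloglog,
    htend.eventually (Real.tendsto_log_atTop.eventually_ge_atTop 1),
    htendT.eventually (Real.tendsto_log_atTop.eventually_ge_atTop 1),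
    htend.eventually ((tendsto_log_add_loglog_add_log hK).eventually_gt_atTop 0),
    eventually_gt_atTop 0] with x h1 h2 ht0 hll hlt hlT hL hx0
  obtain ⟨hT1, hT2⟩ := MKInv_spec hM hK hx0
  set T := MKInv M K x with hT
  set t := T / C' with ht
  rw [show C' * t = T by rw [ht]; field_simp] at h2
  have hpos : 0 < 675 * (Real.log t + Real.log (Real.log t) + Real.log (K t)) / t := by positivity
  have htT : t ≤ T := by
    by_contra hcon
    have hcon : T ≤ t := (not_le.1 hcon).le
    have e1 : Real.log T ≤ Real.log t := Real.log_le_log hT1 hcon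
    have e2 : Real.log (Real.log T) ≤ Real.log (Real.log t) :=
      Real.log_le_log (by linarith) e1
    have e3 := log_growth_monotoneOn hK (mem_Ici.2 hT1.le) (mem_Ici.2 ht0.le) hcon
    simp only at e3
    have e4 : M T ≤ M t := hM.monotoneOn (mem_Ici.2 hT1.le) (mem_Ici.2 ht0.le) hcon
    have e5 : MKlog M K T ≤ MKlog M K t := by
      unfold MKlog
      have := hM.pos T hT1.le
      calc _ ≤ M T * (Real.log t + Real.log (Real.log t) + Real.log (K t)) := by gcongr
        _ ≤ _ := by gcongr
    linarith
  have h4 := MKlog_sub_le hM hK hlt htT ht0 hll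
  rw [hT2] at h4
  -- half of the gain `675` from the growth of `M_{K,log}` is available for `M_K`
  have e6 : 675 * (Real.log t + Real.log (Real.log t) + Real.log (K t)) / t =
      6.75 * (100 * (Real.log t + Real.log (Real.log t) + Real.log (K t)) / t) := by ring
  have h3 := h1 x (by linarith)
  have hinv : 0 < 1 / T := one_div_pos.2 (by linarith)
  rw [Real.norm_eq_abs, Real.norm_eq_abs, abs_of_pos hinv]
  refine h3.trans (le_of_eq ?_)
  rw [ht]; field_simp

end

/-! ### An entire cutoff function -/

/-- The entire function `exp (-cos (a (s - 4 n i)) / cosh (a n))`. On the strip `|Re s| ≤ 1 / a` it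
is of size about `1` for `3 n ≤ Im s ≤ 5 n` and double exponentially small for `Im s ≤ 2 n` and
`Im s ≥ 6 n`. -/
noncomputable def cutoff (a n : ℝ) (s : ℂ) : ℂ :=
  Complex.exp (-(Complex.cos (a * (s - 4 * n * Complex.I)) / (Real.cosh (a * n) : ℝ)))

theorem differentiable_cutoff (a n : ℝ) : Differentiable ℂ (cutoff a n) := by
  unfold cutoff
  fun_prop

theorem cutoff_arg (a n σ τ : ℝ) : (a : ℂ) * ((σ : ℂ) + τ * Complex.I - 4 * n * Complex.I) =
    ((a * σ : ℝ) : ℂ) + ((a * (τ - 4 * n) : ℝ) : ℂ) * Complex.I := by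
  push_cast; ring

theorem norm_cutoff (a n σ τ : ℝ) : ‖cutoff a n (σ + τ * Complex.I)‖ =
    Real.exp (-(Real.cos (a * σ) * Real.cosh (a * (τ - 4 * n)) / Real.cosh (a * n))) := by
  unfold cutoff
  rw [Complex.norm_exp, cutoff_arg, Complex.cos_add_mul_I, Complex.neg_re, Complex.div_ofReal_re]
  congr 3
  rw [← Complex.ofReal_cos, ← Complex.ofReal_sin, ← Complex.ofReal_cosh, ← Complex.ofReal_sinh]
  simp only [Complex.sub_re, Complex.mul_re, Complex.mul_im, Complex.ofReal_re,
    Complex.ofReal_im, Complex.I_re, Complex.I_im]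
  ring

theorem half_le_cos {x : ℝ} (hx : |x| ≤ 1) : 1 / 2 ≤ Real.cos x := by
  have h1 := Real.one_sub_sq_div_two_le_cos (x := x)
  have h2 := (sq_le_one_iff_abs_le_one x).2 hx
  linarith

theorem norm_cutoff_le {a n σ τ : ℝ} (hσ : |a * σ| ≤ 1) : ‖cutoff a n (σ + τ * Complex.I)‖ ≤
    Real.exp (-(Real.cosh (a * (τ - 4 * n)) / Real.cosh (a * n) / 2)) := by
  rw [norm_cutoff, Real.exp_le_exp, neg_le_neg_iff]
  have h1 := half_le_cos hσ
  have h2 := Real.cosh_pos (a * (τ - 4 * n))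
  have h3 := Real.cosh_pos (a * n)
  calc _ = 1 / 2 * Real.cosh (a * (τ - 4 * n)) / Real.cosh (a * n) := by ring
    _ ≤ _ := by gcongr

theorem norm_cutoff_le_one {a n σ τ : ℝ} (hσ : |a * σ| ≤ 1) :
    ‖cutoff a n (σ + τ * Complex.I)‖ ≤ 1 := by
  refine (norm_cutoff_le hσ).trans (Real.exp_le_one_iff.2 ?_)
  have h2 := Real.cosh_pos (a * (τ - 4 * n))
  have h3 := Real.cosh_pos (a * n)
  have : 0 ≤ Real.cosh (a * (τ - 4 * n)) / Real.cosh (a * n) / 2 := by positivity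
  linarith

theorem norm_cutoff_le_of_two_mul_le {a n σ τ : ℝ} (ha : 0 ≤ a) (hn : 0 ≤ n)
    (hσ : |a * σ| ≤ 1) (hτ : 2 * n ≤ |τ - 4 * n|) :
    ‖cutoff a n (σ + τ * Complex.I)‖ ≤ Real.exp (-(Real.exp (a * n) / 4)) := by
  refine (norm_cutoff_le hσ).trans (Real.exp_le_exp.2 (neg_le_neg ?_))
  have h3 := Real.cosh_pos (a * n)
  have h1 : Real.cosh (2 * (a * n)) ≤ Real.cosh (a * (τ - 4 * n)) := by
    rw [Real.cosh_le_cosh, abs_of_nonneg (by positivity), abs_mul, abs_of_nonneg ha]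
    calc 2 * (a * n) = a * (2 * n) := by ring
      _ ≤ _ := by gcongr
  have h2 : Real.exp (a * n) / 2 * Real.cosh (a * n) ≤ Real.cosh (2 * (a * n)) := by
    rw [Real.cosh_eq, Real.cosh_eq, two_mul, neg_add, Real.exp_add, Real.exp_add, Real.exp_neg]
    have h4 : 1 ≤ Real.exp (a * n) := Real.one_le_exp (by positivity)
    have h5 : Real.exp (a * n) * (Real.exp (a * n))⁻¹ = 1 := mul_inv_cancel₀ (by positivity)
    have h6 : 0 ≤ (Real.exp (a * n))⁻¹ * (Real.exp (a * n))⁻¹ := by positivity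
    nlinarith
  have h4 : Real.exp (a * n) / 2 ≤ Real.cosh (a * (τ - 4 * n)) / Real.cosh (a * n) := by
    rw [le_div_iff₀ h3]; linarith
  linarith

theorem cutoff_axis (a n τ : ℝ) : cutoff a n ((0 : ℝ) + τ * Complex.I) =
    (Real.exp (-(Real.cosh (a * (τ - 4 * n)) / Real.cosh (a * n))) : ℝ) := by
  unfold cutoff
  rw [cutoff_arg, mul_zero, Complex.ofReal_zero, zero_add, Complex.cos_mul_I]
  push_cast
  rfl

theorem hasDerivAt_cutoff_line (a n σ τ : ℝ) :
    HasDerivAt (fun τ : ℝ => cutoff a n (σ + τ * Complex.I))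
      (cutoff a n (σ + τ * Complex.I) * (Complex.sin (((a * σ : ℝ) : ℂ) +
        ((a * (τ - 4 * n) : ℝ) : ℂ) * Complex.I) * (a * Complex.I) / (Real.cosh (a * n) : ℝ))) τ := by
  have h1 : HasDerivAt (fun τ : ℝ => (a : ℂ) * ((σ : ℂ) + τ * Complex.I - 4 * n * Complex.I))
      (a * Complex.I) τ := by
    have h0 : HasDerivAt (fun τ : ℝ => (τ : ℂ)) 1 τ := Complex.ofRealCLM.hasDerivAt
    simpa using ((((h0.mul_const Complex.I).const_add (σ : ℂ)).sub_const
      (4 * n * Complex.I)).const_mul (a : ℂ))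
  have h2 := ((((Complex.hasDerivAt_cos _).comp τ h1).div_const ((Real.cosh (a * n) : ℝ) : ℂ)).neg).cexp
  refine h2.congr_deriv ?_
  simp only [Function.comp_apply, Pi.neg_apply, cutoff, cutoff_arg]
  ring

/-- The total variation of the cutoff along a vertical line is bounded by an absolute constant. -/
theorem integral_norm_deriv_cutoff_le {a n σ : ℝ} (ha : 0 ≤ a) (hn : 0 ≤ n) (hσ : |a * σ| ≤ 1) :
    ∫ τ in n..(7 * n), ‖cutoff a n (σ + τ * Complex.I) * (Complex.sin (((a * σ : ℝ) : ℂ) +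
      ((a * (τ - 4 * n) : ℝ) : ℂ) * Complex.I) * (a * Complex.I) / (Real.cosh (a * n) : ℝ))‖ ≤
      14 := by
  have hc := Real.cosh_pos (a * n)
  set c := Real.cosh (a * n) with hcdef
  set k : ℝ → ℝ := fun u => a / c + 2 * (a * Real.sinh (a * u) / c *
    Real.exp (-(Real.cosh (a * u) / c / 2))) with hk
  have hkc : Continuous k := by rw [hk]; fun_prop
  have hbound : ∀ τ : ℝ, ‖cutoff a n (σ + τ * Complex.I) * (Complex.sin (((a * σ : ℝ) : ℂ) +
      ((a * (τ - 4 * n) : ℝ) : ℂ) * Complex.I) * (a * Complex.I) / (c : ℝ))‖ ≤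
      k |τ - 4 * n| := by
    intro τ
    set y := a * (τ - 4 * n) with hy
    have hy' : a * |τ - 4 * n| = |y| := by rw [hy, abs_mul, abs_of_nonneg ha]
    have h1 : ‖cutoff a n (σ + τ * Complex.I)‖ ≤ Real.exp (-(Real.cosh y / c / 2)) :=
      norm_cutoff_le hσ
    have h2 : ‖Complex.sin (((a * σ : ℝ) : ℂ) + ((y : ℝ) : ℂ) * Complex.I)‖ ≤
        1 + 2 * Real.sinh |y| := by
      rw [Complex.sin_add_mul_I, ← Complex.ofReal_cos, ← Complex.ofReal_sin, ← Complex.ofReal_cosh,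
        ← Complex.ofReal_sinh]
      refine (norm_add_le _ _).trans ?_
      simp only [norm_mul, Complex.norm_I, mul_one, Complex.norm_real, Real.norm_eq_abs]
      have e1 : |Real.cosh y| ≤ 1 + |Real.sinh y| := by
        rw [abs_of_pos (Real.cosh_pos y)]
        have := Real.cosh_sq y
        nlinarith [abs_nonneg (Real.sinh y), sq_abs (Real.sinh y), Real.cosh_pos y]
      have e2 := Real.abs_sin_le_one (a * σ)
      have e3 := Real.abs_cos_le_one (a * σ)
      rw [← Real.abs_sinh]
      calc _ ≤ 1 * (1 + |Real.sinh y|) + 1 * |Real.sinh y| := by gcongr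
        _ = _ := by ring
    have h3 : ‖cutoff a n (σ + τ * Complex.I)‖ ≤ 1 := norm_cutoff_le_one hσ
    have h4 : 0 ≤ Real.sinh |y| := Real.sinh_nonneg_iff.2 (abs_nonneg y)
    rw [norm_mul, norm_div, norm_mul, norm_mul, Complex.norm_I, mul_one, Complex.norm_real,
      Complex.norm_real, Real.norm_of_nonneg ha, Real.norm_of_nonneg hc.le, hk]
    simp only
    rw [hy', Real.cosh_abs]
    calc _ ≤ ‖cutoff a n (σ + τ * Complex.I)‖ * ((1 + 2 * Real.sinh |y|) * a / c) := by gcongr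
      _ = ‖cutoff a n (σ + τ * Complex.I)‖ * (a / c) +
          2 * (a * Real.sinh |y| / c * ‖cutoff a n (σ + τ * Complex.I)‖) := by ring
      _ ≤ 1 * (a / c) + 2 * (a * Real.sinh |y| / c * Real.exp (-(Real.cosh y / c / 2))) := by gcongr
      _ = _ := by ring
  have h7 : n ≤ 7 * n := by linarith
  have hcontL : Continuous fun τ : ℝ => ‖cutoff a n (σ + τ * Complex.I) *
      (Complex.sin (((a * σ : ℝ) : ℂ) + ((a * (τ - 4 * n) : ℝ) : ℂ) * Complex.I) *
        (a * Complex.I) / (c : ℝ))‖ := by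
    have := (differentiable_cutoff a n).continuous
    fun_prop
  have hk3 : ∫ u in (0 : ℝ)..(3 * n), k u ≤ 7 := by
    have hder : ∀ u ∈ uIcc 0 (3 * n), HasDerivAt
        (fun u => a / c * u - 4 * Real.exp (-(Real.cosh (a * u) / c / 2))) (k u) u := by
      intro u _
      have h1 : HasDerivAt (fun u : ℝ => a * u) a u := by
        simpa using (hasDerivAt_id u).const_mul a
      have h2 := (((h1.cosh.div_const c).div_const 2).neg.exp.const_mul 4)
      have h3 : HasDerivAt (fun u : ℝ => a / c * u) (a / c) u := by
        simpa using (hasDerivAt_id u).const_mul (a / c)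
      refine (h3.sub h2).congr_deriv ?_
      rw [hk]; simp only [Pi.neg_apply]; ring
    rw [intervalIntegral.integral_eq_sub_of_hasDerivAt hder (hkc.intervalIntegrable _ _)]
    have e1 : a * n ≤ c := by
      have := Real.add_one_le_exp (a * n)
      have h2 := Real.quadratic_le_exp_of_nonneg (x := a * n) (by positivity)
      rw [hcdef, Real.cosh_eq]
      have := Real.exp_pos (-(a * n))
      nlinarith [sq_nonneg (a * n - 1)]
    have e2 : a / c * (3 * n) ≤ 3 := by
      rw [div_mul_eq_mul_div, div_le_iff₀ hc]; linarith
    have e3 : Real.exp (-(Real.cosh (a * 0) / c / 2)) ≤ 1 := by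
      rw [Real.exp_le_one_iff, mul_zero, Real.cosh_zero]
      have : 0 ≤ 1 / c / 2 := by positivity
      linarith
    have e4 := Real.exp_pos (-(Real.cosh (a * (3 * n)) / c / 2))
    linarith
  calc _ ≤ ∫ τ in n..(7 * n), k |τ - 4 * n| := by
        refine intervalIntegral.integral_mono_on h7 (hcontL.intervalIntegrable _ _)
          (Continuous.intervalIntegrable (by fun_prop) _ _) fun τ _ => hbound τ
    _ = ∫ u in (-(3 * n))..(3 * n), k |u| := by
        rw [intervalIntegral.integral_comp_sub_right (fun u => k |u|)]
        congr 1 <;> ring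
    _ = 2 * ∫ u in (0 : ℝ)..(3 * n), k u :=
        (intervalIntegrable_comp_abs (by positivity) (hkc.intervalIntegrable _ _)).2
    _ ≤ 14 := by linarith

/-! ### Cauchy integrals over a vertical segment -/

/-- Cauchy's theorem for a rectangle: the difference of the integrals over the vertical sides. -/
theorem vertical_integral_sub {F : ℂ → ℂ} {c d p q : ℝ} (hcd : c ≤ d) (hpq : p ≤ q)
    (hF : DifferentiableOn ℂ F (Icc c d ×ℂ Icc p q)) :
    (∫ v in p..q, F (d + v * Complex.I)) - ∫ v in p..q, F (c + v * Complex.I) =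
      Complex.I * ((∫ x in c..d, F (x + p * Complex.I)) - ∫ x in c..d, F (x + q * Complex.I)) := by
  have h := Complex.integral_boundary_rect_eq_zero_of_continuousOn_of_differentiableOn F
    ⟨c, p⟩ ⟨d, q⟩ ?_ ?_
  · simp only [smul_eq_mul] at h
    linear_combination (-Complex.I) * h + ((∫ v in p..q, F (d + v * Complex.I)) -
      ∫ v in p..q, F (c + v * Complex.I)) * Complex.I_mul_I
  · simp only [uIcc_of_le hcd, uIcc_of_le hpq]
    exact hF.continuousOn
  · simp only [min_eq_left hcd, max_eq_right hcd, min_eq_left hpq, max_eq_right hpq]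
    exact hF.mono (inter_subset_inter (preimage_mono Ioo_subset_Icc_self)
      (preimage_mono Ioo_subset_Icc_self))

theorem norm_vertical_integral_sub_le {F : ℂ → ℂ} {c d p q H : ℝ} (hcd : c ≤ d) (hpq : p ≤ q)
    (hF : DifferentiableOn ℂ F (Icc c d ×ℂ Icc p q))
    (hp : ∀ x ∈ Icc c d, ‖F (x + p * Complex.I)‖ ≤ H)
    (hq : ∀ x ∈ Icc c d, ‖F (x + q * Complex.I)‖ ≤ H) :
    ‖(∫ v in p..q, F (d + v * Complex.I)) - ∫ v in p..q, F (c + v * Complex.I)‖ ≤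
      2 * (d - c) * H := by
  have e : ∀ r : ℝ, (∀ x ∈ Icc c d, ‖F (x + r * Complex.I)‖ ≤ H) →
      ‖∫ x in c..d, F (x + r * Complex.I)‖ ≤ H * (d - c) := by
    intro r hr
    have := intervalIntegral.norm_integral_le_of_norm_le_const (a := c) (b := d) (C := H)
      (f := fun x : ℝ => F (x + r * Complex.I)) fun x hx => by
        rw [uIoc_of_le hcd] at hx
        exact hr x (Ioc_subset_Icc_self hx)
    rwa [abs_of_nonneg (by linarith)] at this
  rw [vertical_integral_sub hcd hpq hF, norm_mul, Complex.norm_I, one_mul]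
  refine (norm_sub_le _ _).trans ((add_le_add (e p hp) (e q hq)).trans (le_of_eq ?_))
  ring

/-- The integral of `1 / z` over a vertical segment that neither passes close to `0` at its ends
nor is long compared with the distance of its ends to `0` is bounded, however close to `0` the
segment passes: it is a difference of logarithms. -/
theorem norm_integral_inv_vertical_le {n p v κ : ℝ} (hp : 0 < p) (hpn : p ≤ n / 2)
    (hκ : κ * κ = 1) (hv : v ∈ Icc (3 / 2 * n) (13 / 2 * n)) :
    ‖∫ τ in n..(7 * n), ((p : ℂ) + (κ * (τ - v) : ℝ) * Complex.I)⁻¹‖ ≤ 18 := by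
  set z : ℝ → ℂ := fun τ => (p : ℂ) + (κ * (τ - v) : ℝ) * Complex.I with hz
  have hzre : ∀ τ, (z τ).re = p := fun τ => by simp [hz]
  have hzim : ∀ τ, (z τ).im = κ * (τ - v) := fun τ => by
    simp only [hz, Complex.add_im, Complex.ofReal_im, Complex.mul_im, Complex.I_im,
      Complex.ofReal_re, Complex.I_re]
    ring
  have hz0 : ∀ τ, z τ ≠ 0 := fun τ h => by
    have := hzre τ
    rw [h, Complex.zero_re] at this
    linarith
  have hzd : ∀ τ, HasDerivAt z (κ * Complex.I) τ := by
    intro τ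
    have h0 : HasDerivAt (fun τ : ℝ => κ * (τ - v)) κ τ := by
      simpa using ((hasDerivAt_id τ).sub_const v).const_mul κ
    have h1 := (h0.ofReal_comp.mul_const Complex.I).const_add (p : ℂ)
    exact h1
  have hderiv : ∀ τ, HasDerivAt (fun τ => -(κ * Complex.I) * Complex.log (z τ)) ((z τ)⁻¹) τ := by
    intro τ
    have h1 := ((hzd τ).clog_real (Or.inl (by rw [hzre]; exact hp))).const_mul (-(κ * Complex.I))
    refine h1.congr_deriv ?_
    have : (κ : ℂ) * κ = 1 := by exact_mod_cast hκ
    have hI := Complex.I_mul_I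
    rw [div_eq_mul_inv]
    linear_combination (-(z τ)⁻¹ * Complex.I * Complex.I) * this - (z τ)⁻¹ * hI
  have hzc : Continuous z := by rw [hz]; fun_prop
  rw [intervalIntegral.integral_eq_sub_of_hasDerivAt (fun τ _ => hderiv τ)
    ((hzc.inv₀ hz0).intervalIntegrable _ _), ← mul_sub, norm_mul]
  have hκ1 : |κ| = 1 := by
    rw [← sq_eq_sq₀ (abs_nonneg _) zero_le_one, sq_abs]; linarith
  have e1 : ‖-((κ : ℂ) * Complex.I)‖ = 1 := by simp [hκ1]
  rw [e1, one_mul]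
  have hnorm : ∀ τ, n / 2 ≤ |τ - v| → |τ - v| ≤ 11 / 2 * n → n / 2 ≤ ‖z τ‖ ∧ ‖z τ‖ ≤ 6 * n := by
    intro τ h1 h2
    have h3 := Complex.abs_im_le_norm (z τ)
    have h4 := Complex.norm_le_abs_re_add_abs_im (z τ)
    rw [hzim, abs_mul, hκ1, one_mul] at h3 h4
    rw [hzre, abs_of_pos hp] at h4
    constructor <;> linarith
  obtain ⟨a1, a2⟩ := hnorm (7 * n) (by rw [abs_of_nonneg (by linarith [hv.2])]; linarith [hv.2])
    (by rw [abs_of_nonneg (by linarith [hv.2])]; linarith [hv.1])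
  obtain ⟨b1, b2⟩ := hnorm n (by rw [abs_of_nonpos (by linarith [hv.1])]; linarith [hv.1])
    (by rw [abs_of_nonpos (by linarith [hv.1])]; linarith [hv.2])
  have hlog : ∀ r₁ r₂ : ℝ, n / 2 ≤ r₁ → r₂ ≤ 6 * n → 0 < r₂ → Real.log r₂ - Real.log r₁ ≤ 11 := by
    intro r₁ r₂ h1 h2 h3
    have hr₁ : 0 < r₁ := by linarith
    rw [← Real.log_div h3.ne' hr₁.ne']
    refine (Real.log_le_sub_one_of_pos (by positivity)).trans ?_
    have : r₂ / r₁ ≤ 12 := by rw [div_le_iff₀ hr₁]; linarith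
    linarith
  refine (Complex.norm_le_abs_re_add_abs_im _).trans ?_
  rw [Complex.sub_re, Complex.sub_im, Complex.log_re, Complex.log_re, Complex.log_im,
    Complex.log_im]
  have l1 := hlog _ _ a1 b2 (by linarith)
  have l2 := hlog _ _ b1 a2 (by linarith)
  have h5 : |Real.log ‖z (7 * n)‖ - Real.log ‖z n‖| ≤ 11 := abs_le.2 ⟨by linarith, by linarith⟩
  have h6 : |(z (7 * n)).arg - (z n).arg| ≤ 2 * Real.pi := by
    have := Complex.abs_arg_le_pi (z (7 * n))
    have := Complex.abs_arg_le_pi (z n)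
    exact (abs_sub _ _).trans (by linarith)
  have := Real.pi_lt_d2
  linarith

theorem integral_inv_sq_add_sq_le {δ v p q : ℝ} (hδ : 0 < δ) :
    ∫ τ in p..q, (δ ^ 2 + (τ - v) ^ 2)⁻¹ ≤ 4 / δ := by
  have hpos : ∀ τ : ℝ, δ ^ 2 + (τ - v) ^ 2 ≠ 0 := fun τ => by positivity
  have hd : ∀ τ ∈ uIcc p q, HasDerivAt (fun τ => Real.arctan ((τ - v) / δ) / δ)
      ((δ ^ 2 + (τ - v) ^ 2)⁻¹) τ := by
    intro τ _
    have h1 : HasDerivAt (fun τ : ℝ => (τ - v) / δ) (1 / δ) τ :=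
      ((hasDerivAt_id τ).sub_const v).div_const δ
    refine (h1.arctan.div_const δ).congr_deriv ?_
    have := hpos τ
    have h2 : 1 + ((τ - v) / δ) ^ 2 ≠ 0 := by positivity
    field_simp
  rw [intervalIntegral.integral_eq_sub_of_hasDerivAt hd
    ((Continuous.inv₀ (by fun_prop) hpos).intervalIntegrable _ _), ← sub_div]
  gcongr
  have h1 := Real.arctan_lt_pi_div_two ((q - v) / δ)
  have h2 := Real.neg_pi_div_two_lt_arctan ((p - v) / δ)
  have := Real.pi_lt_d2
  linarith

theorem norm_add_mul_I_ge {δ p v τ : ℝ} (hδ : 0 < δ) (hp : δ ≤ p) :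
    δ ≤ ‖(p : ℂ) + (τ - v : ℝ) * Complex.I‖ ∧
      δ ^ 2 + (τ - v) ^ 2 ≤ ‖(p : ℂ) + (τ - v : ℝ) * Complex.I‖ ^ 2 := by
  have h : ‖(p : ℂ) + (τ - v : ℝ) * Complex.I‖ ^ 2 = p ^ 2 + (τ - v) ^ 2 := by
    rw [Complex.sq_norm, Complex.normSq_add_mul_I]
  have h2 : δ ^ 2 ≤ p ^ 2 := by gcongr
  refine ⟨?_, by linarith⟩
  rw [← abs_of_pos hδ, ← abs_of_nonneg (norm_nonneg ((p : ℂ) + (τ - v : ℝ) * Complex.I)),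
    ← sq_le_sq]
  nlinarith [sq_nonneg (τ - v)]

/-- An oscillating Cauchy integral along the line `Re w = 2 δ`: since the cutoff has bounded
variation, one integration by parts shows that there is no logarithmic loss. -/
theorem norm_integral_cutoff_oscillating_le {a n δ p v X : ℝ} (ha : 0 ≤ a) (hn : 0 ≤ n)
    (hδ : 0 < δ) (haδ : |a * (2 * δ)| ≤ 1) (hp : δ ≤ p) (hX : 0 < X) :
    ‖∫ τ in n..(7 * n), cutoff a n ((2 * δ : ℝ) + τ * Complex.I) *
      ((p : ℂ) + (τ - v : ℝ) * Complex.I)⁻¹ * Complex.exp (-(τ * X) * Complex.I)‖ ≤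
      20 / (δ * X) := by
  set f : ℝ → ℂ := fun τ => cutoff a n ((2 * δ : ℝ) + τ * Complex.I) with hf
  set f' : ℝ → ℂ := fun τ => cutoff a n ((2 * δ : ℝ) + τ * Complex.I) *
    (Complex.sin (((a * (2 * δ) : ℝ) : ℂ) + ((a * (τ - 4 * n) : ℝ) : ℂ) * Complex.I) *
      (a * Complex.I) / (Real.cosh (a * n) : ℝ)) with hf'
  set z : ℝ → ℂ := fun τ => (p : ℂ) + (τ - v : ℝ) * Complex.I with hz
  have hzn : ∀ τ, δ ≤ ‖z τ‖ ∧ δ ^ 2 + (τ - v) ^ 2 ≤ ‖z τ‖ ^ 2 :=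
    fun τ => norm_add_mul_I_ge hδ hp
  have hz0 : ∀ τ, z τ ≠ 0 := fun τ h => by
    have := (hzn τ).1
    rw [h, norm_zero] at this
    linarith
  have hcut := (differentiable_cutoff a n).continuous
  have hfc : Continuous f := by rw [hf]; fun_prop
  have hf'c : Continuous f' := by rw [hf']; fun_prop
  have hzc : Continuous z := by rw [hz]; fun_prop
  have hfd : ∀ τ, HasDerivAt f (f' τ) τ := fun τ => hasDerivAt_cutoff_line a n (2 * δ) τ
  have hzd : ∀ τ, HasDerivAt z Complex.I τ := by
    intro τ
    have h0 : HasDerivAt (fun τ : ℝ => τ - v) 1 τ := (hasDerivAt_id τ).sub_const v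
    exact ((h0.ofReal_comp.mul_const Complex.I).const_add (p : ℂ)).congr_deriv (by simp)
  have hud : ∀ τ, HasDerivAt (fun τ => f τ * (z τ)⁻¹)
      (f' τ * (z τ)⁻¹ + f τ * (-Complex.I / (z τ) ^ 2)) τ := fun τ =>
    (hfd τ).mul ((hzd τ).inv (hz0 τ))
  set e : ℝ → ℂ := fun τ => Complex.exp (-(τ * X) * Complex.I) with he
  have hen : ∀ τ, ‖e τ‖ = 1 := fun τ => by
    have := Complex.norm_exp_ofReal_mul_I (-(τ * X))
    push_cast at this
    exact this
  have hX' : (X : ℂ) ≠ 0 := by exact_mod_cast hX.ne'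
  have hed : ∀ τ, HasDerivAt (fun τ => e τ * (Complex.I / X)) (e τ) τ := by
    intro τ
    have h0 : HasDerivAt (fun τ : ℝ => (τ : ℂ)) 1 τ := Complex.ofRealCLM.hasDerivAt
    have h1 : HasDerivAt (fun τ : ℝ => -((τ : ℂ) * X) * Complex.I) (-(1 * (X : ℂ)) * Complex.I) τ :=
      ((h0.mul_const (X : ℂ)).neg).mul_const Complex.I
    refine (h1.cexp.mul_const (Complex.I / X)).congr_deriv ?_
    rw [he]
    field_simp
    rw [Complex.I_sq]; ring
  have hec : Continuous e := by rw [he]; fun_prop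
  have hu'c : Continuous fun τ => f' τ * (z τ)⁻¹ + f τ * (-Complex.I / (z τ) ^ 2) := by
    refine (hf'c.mul (hzc.inv₀ hz0)).add (hfc.mul (continuous_const.div (hzc.pow 2) fun τ => ?_))
    exact pow_ne_zero 2 (hz0 τ)
  have h7 : n ≤ 7 * n := by linarith
  have hf1 : ∀ τ, ‖f τ‖ ≤ 1 := fun τ => norm_cutoff_le_one haδ
  have hIX : ‖Complex.I / (X : ℂ)‖ = 1 / X := by
    rw [norm_div, Complex.norm_I, Complex.norm_real, Real.norm_of_nonneg hX.le]
  rw [intervalIntegral.integral_mul_deriv_eq_deriv_mul (fun τ _ => hud τ) (fun τ _ => hed τ)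
    (hu'c.intervalIntegrable _ _) (hec.intervalIntegrable _ _)]
  have hbdry : ∀ τ, ‖f τ * (z τ)⁻¹ * (e τ * (Complex.I / X))‖ ≤ 1 / (δ * X) := by
    intro τ
    rw [norm_mul, norm_mul, norm_mul, hen, hIX, norm_inv, one_mul]
    have h1 : ‖z τ‖⁻¹ ≤ δ⁻¹ := inv_anti₀ hδ (hzn τ).1
    calc _ ≤ 1 * δ⁻¹ * (1 / X) := by gcongr; exact hf1 τ
      _ = _ := by field_simp
  have hint : ‖∫ τ in n..(7 * n), (f' τ * (z τ)⁻¹ + f τ * (-Complex.I / (z τ) ^ 2)) *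
      (e τ * (Complex.I / X))‖ ≤ 18 / (δ * X) := by
    have h1 : ∀ τ, ‖(f' τ * (z τ)⁻¹ + f τ * (-Complex.I / (z τ) ^ 2)) *
        (e τ * (Complex.I / X))‖ ≤ (‖f' τ‖ * δ⁻¹ + (δ ^ 2 + (τ - v) ^ 2)⁻¹) * (1 / X) := by
      intro τ
      rw [norm_mul, norm_mul, hen, hIX, one_mul]
      gcongr
      refine (norm_add_le _ _).trans ?_
      have hB : ‖f τ * (-Complex.I / (z τ) ^ 2)‖ = ‖f τ‖ * (‖z τ‖ ^ 2)⁻¹ := by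
        rw [norm_mul, norm_div, norm_neg, Complex.norm_I, norm_pow, one_div]
      rw [hB, norm_mul (f' τ), norm_inv]
      have h2 : ‖z τ‖⁻¹ ≤ δ⁻¹ := inv_anti₀ hδ (hzn τ).1
      have h3 : (‖z τ‖ ^ 2)⁻¹ ≤ (δ ^ 2 + (τ - v) ^ 2)⁻¹ := inv_anti₀ (by positivity) (hzn τ).2
      have h4 : ‖f τ‖ * (‖z τ‖ ^ 2)⁻¹ ≤ 1 * (δ ^ 2 + (τ - v) ^ 2)⁻¹ := by
        gcongr; exact hf1 τ
      rw [one_mul] at h4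
      gcongr
    have hc1 : Continuous fun τ => ‖f' τ‖ * δ⁻¹ := hf'c.norm.mul continuous_const
    have hc2 : Continuous fun τ : ℝ => (δ ^ 2 + (τ - v) ^ 2)⁻¹ :=
      Continuous.inv₀ (by fun_prop) fun τ => by positivity
    refine (intervalIntegral.norm_integral_le_of_norm_le h7 (ae_of_all _ fun τ _ => h1 τ)
      (((hc1.add hc2).mul continuous_const).intervalIntegrable _ _)).trans ?_
    rw [intervalIntegral.integral_mul_const, intervalIntegral.integral_add
      (hc1.intervalIntegrable _ _) (hc2.intervalIntegrable _ _),
      intervalIntegral.integral_mul_const]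
    have h5 : ∫ τ in n..(7 * n), ‖f' τ‖ ≤ 14 := integral_norm_deriv_cutoff_le ha hn haδ
    have h6 : ∫ τ in n..(7 * n), (δ ^ 2 + (τ - v) ^ 2)⁻¹ ≤ 4 / δ := integral_inv_sq_add_sq_le hδ
    calc _ ≤ (14 * δ⁻¹ + 4 / δ) * (1 / X) := by gcongr
      _ = _ := by field_simp; ring
  refine (norm_sub_le _ _).trans ((add_le_add (norm_sub_le _ _) hint).trans ?_)
  have b1 := hbdry (7 * n)
  have b2 := hbdry n
  have : 20 / (δ * X) = 1 / (δ * X) + 1 / (δ * X) + 18 / (δ * X) := by ring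
  rw [this]
  linarith

/-! ### The Laplace transform of a wave packet -/

/-- The Cauchy integral of `cutoff · e^{-w X}` over the segment `[-2 δ + n i, -2 δ + 7 n i]`, which
will be the Laplace transform of a wave packet that is concentrated near `X` and has frequencies
near `4 n`. -/
noncomputable def packetTransform (a n δ X : ℝ) (s : ℂ) : ℂ :=
  ∫ τ in n..(7 * n), cutoff a n ((-(2 * δ) : ℝ) + τ * Complex.I) *
    Complex.exp (-(((-(2 * δ) : ℝ) + τ * Complex.I) * X)) *
    (s - ((-(2 * δ) : ℝ) + τ * Complex.I))⁻¹

section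

variable {a n δ X : ℝ}

theorem abs_mul_le_one_of_abs_le {x : ℝ} (ha : 0 ≤ a) (haδ : a * (2 * δ) ≤ 1)
    (hx : |x| ≤ 2 * δ) : |a * x| ≤ 1 := by
  rw [abs_mul, abs_of_nonneg ha]
  exact (mul_le_mul_of_nonneg_left hx ha).trans haδ

/-- At the frequencies of the packet the pole of the integrand can be close to the segment of
integration. Splitting off the divided difference at `s`, which is entire, moves the integral past
`s` to the line `Re w = 2 δ`, where it is bounded by an integration by parts; the remaining
integrals of `1 / (s - w)` are differences of logarithms, and the factor `e^{-s X}` contributes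
`e^{δ X}`. -/
theorem norm_packetTransform_le_inside (ha : 0 ≤ a) (hn : 0 < n) (hδ : 0 < δ)
    (haδ : a * (2 * δ) ≤ 1) (hδX : 1 ≤ δ * X) (hδn : 16 * δ ≤ n) {s : ℂ} (hs : |s.re| ≤ δ)
    (him : s.im ∈ Icc (3 / 2 * n) (13 / 2 * n)) :
    ‖packetTransform a n δ X s‖ ≤ 37 * Real.exp (δ * X) + 20 +
      Real.exp (-(Real.exp (a * n) / 4)) * Real.exp (2 * δ * X) := by
  have hX : 0 < X := by
    by_contra h
    have := mul_nonpos_of_nonneg_of_nonpos hδ.le (not_lt.1 h)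
    linarith
  obtain ⟨hs1, hs2⟩ := abs_le.1 hs
  set v := s.im with hv
  set ε := Real.exp (-(Real.exp (a * n) / 4)) with hε
  set E := Real.exp (2 * δ * X) with hE
  set q : ℂ → ℂ := fun w => cutoff a n w * Complex.exp (-(w * X)) with hq
  have hqd : Differentiable ℂ q := (differentiable_cutoff a n).mul (by fun_prop)
  have hcut := (differentiable_cutoff a n).continuous
  have hdsd : Differentiable ℂ (dslope q s) := by
    rw [← differentiableOn_univ]
    exact (Complex.differentiableOn_dslope univ_mem).2 hqd.differentiableOn
  have hds : ∀ w, w ≠ s → q w * (s - w)⁻¹ = q s * (s - w)⁻¹ - dslope q s w := by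
    intro w hw
    rw [dslope_of_ne _ hw, slope_def_field]
    have h1 : w - s ≠ 0 := sub_ne_zero.2 hw
    have h2 : s - w ≠ 0 := sub_ne_zero.2 hw.symm
    rw [show s - w = -(w - s) by ring] at h2 ⊢
    field_simp
    ring
  have hqn : ∀ x τ : ℝ, ‖q (x + τ * Complex.I)‖ =
      ‖cutoff a n (x + τ * Complex.I)‖ * Real.exp (-(x * X)) := by
    intro x τ
    have : (-(((x : ℂ) + τ * Complex.I) * X)).re = -(x * X) := by simp
    rw [hq]; simp only [norm_mul, Complex.norm_exp, this]
  have hse : s = (s.re : ℂ) + (v : ℂ) * Complex.I := (Complex.re_add_im s).symm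
  have hQ : ‖q s‖ ≤ Real.exp (δ * X) := by
    rw [hse, hqn]
    have h1 : ‖cutoff a n (s.re + v * Complex.I)‖ ≤ 1 :=
      norm_cutoff_le_one (abs_mul_le_one_of_abs_le ha haδ (by linarith))
    have h2 : Real.exp (-(s.re * X)) ≤ Real.exp (δ * X) := by
      rw [Real.exp_le_exp]; nlinarith
    calc _ ≤ 1 * Real.exp (δ * X) := by gcongr
      _ = _ := one_mul _
  -- the difference of the integrals of the divided difference over the two vertical lines
  have hhor : ∀ r : ℝ, 2 * n ≤ |r - 4 * n| → n / 2 ≤ |r - v| →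
      ∀ x ∈ Icc (-(2 * δ)) (2 * δ), ‖dslope q s (x + r * Complex.I)‖ ≤
        2 / n * (ε * E + Real.exp (δ * X)) := by
    intro r hr hrv x hx
    set w : ℂ := (x : ℂ) + r * Complex.I with hw
    have him' : (w - s).im = r - v := by simp [hw, hv]
    have h1 : n / 2 ≤ ‖w - s‖ := by
      have := Complex.abs_im_le_norm (w - s)
      rw [him'] at this
      linarith
    have hws : w ≠ s := fun h => by
      rw [h, sub_self, norm_zero] at h1; linarith
    rw [dslope_of_ne _ hws, slope_def_field, norm_div, div_le_iff₀ (by linarith)]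
    have h2 : ‖q w‖ ≤ ε * E := by
      rw [hw, hqn]
      have h3 := norm_cutoff_le_of_two_mul_le (τ := r) ha hn.le
        (abs_mul_le_one_of_abs_le ha haδ (abs_le.2 hx)) hr
      have h4 : Real.exp (-(x * X)) ≤ E := by
        rw [hE, Real.exp_le_exp]; nlinarith [hx.1]
      gcongr
    have h5 : 0 ≤ ε * E + Real.exp (δ * X) := by positivity
    calc ‖q w - q s‖ ≤ ε * E + Real.exp (δ * X) := (norm_sub_le _ _).trans (add_le_add h2 hQ)
      _ = 2 / n * (ε * E + Real.exp (δ * X)) * (n / 2) := by field_simp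
      _ ≤ _ := by gcongr
  have hD := norm_vertical_integral_sub_le (F := dslope q s) (c := -(2 * δ)) (d := 2 * δ) (p := n)
    (q := 7 * n) (by linarith) (by linarith) hdsd.differentiableOn
    (hhor n (by rw [abs_of_nonpos (by linarith)]; linarith)
      (by rw [abs_of_nonpos (by linarith [him.1])]; linarith [him.1]))
    (hhor (7 * n) (by rw [abs_of_nonneg (by linarith)]; linarith)
      (by rw [abs_of_nonneg (by linarith [him.2])]; linarith [him.2]))
  have hD' : 2 * (2 * δ - -(2 * δ)) * (2 / n * (ε * E + Real.exp (δ * X))) ≤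
      ε * E + Real.exp (δ * X) := by
    have h5 : 0 ≤ ε * E + Real.exp (δ * X) := by positivity
    calc _ = (16 * δ / n) * (ε * E + Real.exp (δ * X)) := by ring
      _ ≤ 1 * (ε * E + Real.exp (δ * X)) := by
        gcongr
        exact (div_le_one hn).2 hδn
      _ = _ := one_mul _
  -- splitting off the divided difference
  have hsplit : ∀ c : ℝ, s.re ≠ c →
      ∫ τ in n..(7 * n), q (c + τ * Complex.I) * (s - (c + τ * Complex.I))⁻¹ =
        q s * (∫ τ in n..(7 * n), (s - (c + τ * Complex.I))⁻¹) -
          ∫ τ in n..(7 * n), dslope q s (c + τ * Complex.I) := by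
    intro c hc
    have hne : ∀ τ : ℝ, (c : ℂ) + τ * Complex.I ≠ s := fun τ h => hc (by rw [← h]; simp)
    rw [← intervalIntegral.integral_const_mul, ← intervalIntegral.integral_sub]
    · exact intervalIntegral.integral_congr fun τ _ => hds _ (hne τ)
    · refine Continuous.intervalIntegrable ?_ _ _
      exact continuous_const.mul (Continuous.inv₀ (by fun_prop) fun τ => sub_ne_zero.2 (hne τ).symm)
    · have := hdsd.continuous
      exact Continuous.intervalIntegrable (by fun_prop) _ _
  have hL := hsplit (-(2 * δ)) (by linarith)
  have hR := hsplit (2 * δ) (by linarith)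
  have hJL : ‖∫ τ in n..(7 * n), (s - ((-(2 * δ) : ℝ) + τ * Complex.I))⁻¹‖ ≤ 18 := by
    have h1 := norm_integral_inv_vertical_le (n := n) (p := s.re + 2 * δ) (v := v) (κ := -1)
      (by linarith) (by linarith) (by norm_num) him
    convert h1 using 5 with τ
    apply Complex.ext
    · simp
    · simp [hv]
  have hJR : ‖∫ τ in n..(7 * n), (s - ((2 * δ : ℝ) + τ * Complex.I))⁻¹‖ ≤ 18 := by
    have h1 := norm_integral_inv_vertical_le (n := n) (p := 2 * δ - s.re) (v := v) (κ := 1)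
      (by linarith) (by linarith) (by norm_num) him
    have h2 : ∀ τ : ℝ, (s - ((2 * δ : ℝ) + τ * Complex.I))⁻¹ =
        -(((2 * δ - s.re : ℝ) : ℂ) + (1 * (τ - v) : ℝ) * Complex.I)⁻¹ := by
      intro τ
      rw [← inv_neg]
      congr 1
      apply Complex.ext
      · simp
      · simp [hv]
    simp only [h2, intervalIntegral.integral_neg, norm_neg]
    exact h1
  have hIR : ‖∫ τ in n..(7 * n), q ((2 * δ : ℝ) + τ * Complex.I) *
      (s - ((2 * δ : ℝ) + τ * Complex.I))⁻¹‖ ≤ 20 := by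
    have h1 := norm_integral_cutoff_oscillating_le (n := n) (p := 2 * δ - s.re) (v := v) (X := X)
      ha hn.le hδ (abs_mul_le_one_of_abs_le ha haδ (by rw [abs_of_pos (by linarith)]))
      (by linarith) hX
    have h2 : ∀ τ : ℝ, q ((2 * δ : ℝ) + τ * Complex.I) *
        (s - ((2 * δ : ℝ) + τ * Complex.I))⁻¹ = -(Real.exp (-(2 * δ * X)) : ℂ) *
        (cutoff a n ((2 * δ : ℝ) + τ * Complex.I) *
      (((2 * δ - s.re : ℝ) : ℂ) + (τ - v : ℝ) * Complex.I)⁻¹ *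
        Complex.exp (-(τ * X) * Complex.I)) := by
      intro τ
      have e1 : (s - ((2 * δ : ℝ) + τ * Complex.I))⁻¹ =
          -(((2 * δ - s.re : ℝ) : ℂ) + (τ - v : ℝ) * Complex.I)⁻¹ := by
        rw [← inv_neg]
        congr 1
        apply Complex.ext
        · simp
        · simp [hv]
      have e2 : Complex.exp (-((((2 * δ : ℝ) : ℂ) + τ * Complex.I) * X)) =
          (Real.exp (-(2 * δ * X)) : ℂ) * Complex.exp (-(τ * X) * Complex.I) := by
        rw [Complex.ofReal_exp, ← Complex.exp_add]
        congr 1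
        push_cast; ring
      rw [e1, hq]
      simp only [e2]
      ring
    simp only [h2, intervalIntegral.integral_const_mul, norm_mul, norm_neg, Complex.norm_real,
      Real.norm_of_nonneg (Real.exp_pos _).le]
    have h3 : Real.exp (-(2 * δ * X)) ≤ 1 := Real.exp_le_one_iff.2 (by nlinarith)
    have h4 : 20 / (δ * X) ≤ 20 := div_le_self (by norm_num) hδX
    exact (mul_le_mul h3 (h1.trans h4) (norm_nonneg _) zero_le_one).trans (one_mul _).le
  have hGL : packetTransform a n δ X s = ∫ τ in n..(7 * n),
      q ((-(2 * δ) : ℝ) + τ * Complex.I) * (s - ((-(2 * δ) : ℝ) + τ * Complex.I))⁻¹ := rfl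
  rw [hGL, hL]
  set JL := ∫ τ in n..(7 * n), (s - ((-(2 * δ) : ℝ) + τ * Complex.I))⁻¹
  set JR := ∫ τ in n..(7 * n), (s - ((2 * δ : ℝ) + τ * Complex.I))⁻¹
  set IR := ∫ τ in n..(7 * n), q ((2 * δ : ℝ) + τ * Complex.I) *
      (s - ((2 * δ : ℝ) + τ * Complex.I))⁻¹
  set DL := ∫ τ in n..(7 * n), dslope q s ((-(2 * δ) : ℝ) + τ * Complex.I)
  set DR := ∫ τ in n..(7 * n), dslope q s ((2 * δ : ℝ) + τ * Complex.I)
  have hfin : q s * JL - DL = q s * JL - q s * JR + IR + (DR - DL) := by rw [hR]; ring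
  rw [hfin]
  have m1 : ‖q s * JL‖ ≤ Real.exp (δ * X) * 18 := by rw [norm_mul]; gcongr
  have m2 : ‖q s * JR‖ ≤ Real.exp (δ * X) * 18 := by rw [norm_mul]; gcongr
  have m3 := hD.trans hD'
  have m4 := norm_add_le (q s * JL - q s * JR + IR) (DR - DL)
  have m5 := norm_add_le (q s * JL - q s * JR) IR
  have m6 := norm_sub_le (q s * JL) (q s * JR)
  linarith

/-- Integrals of the cutoff against a function that is analytic to the left of the imaginary axis
can be moved to the imaginary axis, up to a double exponentially small error. -/
theorem norm_integral_cutoff_mul_sub_le (ha : 0 ≤ a) (hn : 0 < n) (hδ : 0 < δ)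
    (haδ : a * (2 * δ) ≤ 1) (hδn : 16 * δ ≤ n) {φ : ℂ → ℂ} {E : ℝ}
    (hφ : DifferentiableOn ℂ φ (Icc (-(2 * δ)) 0 ×ℂ Icc (2 * n) (6 * n)))
    (hφc : ContinuousOn (fun τ : ℝ => φ ((-(2 * δ) : ℝ) + τ * Complex.I)) (Icc n (7 * n)))
    (hv : ∀ τ ∈ Icc n (7 * n), ‖φ ((-(2 * δ) : ℝ) + τ * Complex.I)‖ ≤ E)
    (hh : ∀ x ∈ Icc (-(2 * δ)) 0, ∀ τ ∈ Icc (2 * n) (6 * n), ‖φ (x + τ * Complex.I)‖ ≤ E) :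
    ‖(∫ τ in (2 * n)..(6 * n), cutoff a n ((0 : ℝ) + τ * Complex.I) *
        φ ((0 : ℝ) + τ * Complex.I)) -
      ∫ τ in n..(7 * n), cutoff a n ((-(2 * δ) : ℝ) + τ * Complex.I) *
        φ ((-(2 * δ) : ℝ) + τ * Complex.I)‖ ≤
      3 * n * Real.exp (-(Real.exp (a * n) / 4)) * E := by
  set ε := Real.exp (-(Real.exp (a * n) / 4)) with hε
  set F : ℂ → ℂ := fun w => cutoff a n w * φ w with hF
  have hcut := (differentiable_cutoff a n).continuous
  have hE : 0 ≤ E := (norm_nonneg _).trans (hv n ⟨le_rfl, by linarith⟩)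
  have hFL : ∀ p ∈ Icc n (7 * n), ∀ q ∈ Icc n (7 * n),
      IntervalIntegrable (fun τ : ℝ => F ((-(2 * δ) : ℝ) + τ * Complex.I)) volume p q := by
    intro p hp q hq
    refine ContinuousOn.intervalIntegrable (ContinuousOn.mono ?_ (uIcc_subset_Icc hp hq))
    rw [hF]
    exact ContinuousOn.mul (Continuous.continuousOn (by fun_prop)) hφc
  have hm1 : n ∈ Icc n (7 * n) := ⟨le_rfl, by linarith⟩
  have hm2 : 2 * n ∈ Icc n (7 * n) := ⟨by linarith, by linarith⟩
  have hm6 : 6 * n ∈ Icc n (7 * n) := ⟨by linarith, by linarith⟩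
  have hm7 : 7 * n ∈ Icc n (7 * n) := ⟨by linarith, le_rfl⟩
  have hsmall : ∀ x ∈ Icc (-(2 * δ)) 0, ∀ τ : ℝ, 2 * n ≤ |τ - 4 * n| →
      ‖φ (x + τ * Complex.I)‖ ≤ E → ‖F (x + τ * Complex.I)‖ ≤ ε * E := by
    intro x hx τ hτ h
    rw [hF]; simp only [norm_mul]
    have h3 := norm_cutoff_le_of_two_mul_le (τ := τ) ha hn.le
      (abs_mul_le_one_of_abs_le ha haδ (abs_le.2 ⟨hx.1, by linarith [hx.2]⟩)) hτ
    gcongr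
  have hl : -(2 * δ) ∈ Icc (-(2 * δ)) 0 := ⟨le_rfl, by linarith⟩
  have h2n : 2 * n ≤ |2 * n - 4 * n| := by rw [abs_of_nonpos (by linarith)]; linarith
  have h6n : 2 * n ≤ |6 * n - 4 * n| := by rw [abs_of_nonneg (by linarith)]; linarith
  have h1 := norm_vertical_integral_sub_le (F := F) (c := -(2 * δ)) (d := 0) (p := 2 * n)
    (q := 6 * n) (H := ε * E) (by linarith) (by linarith)
    ((differentiable_cutoff a n).differentiableOn.mul hφ)
    (fun x hx => hsmall x hx (2 * n) h2n (hh x hx _ ⟨le_rfl, by linarith⟩))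
    (fun x hx => hsmall x hx (6 * n) h6n (hh x hx _ ⟨by linarith, le_rfl⟩))
  have hlow : ‖∫ τ in n..(2 * n), F ((-(2 * δ) : ℝ) + τ * Complex.I)‖ ≤ ε * E * |2 * n - n| := by
    apply intervalIntegral.norm_integral_le_of_norm_le_const
    intro τ hτ
    rw [uIoc_of_le (by linarith)] at hτ
    refine hsmall _ hl τ ?_ (hv τ ⟨hτ.1.le, by linarith [hτ.2]⟩)
    rw [abs_of_nonpos (by linarith [hτ.2])]; linarith [hτ.2]
  have hhigh : ‖∫ τ in (6 * n)..(7 * n), F ((-(2 * δ) : ℝ) + τ * Complex.I)‖ ≤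
      ε * E * |7 * n - 6 * n| := by
    apply intervalIntegral.norm_integral_le_of_norm_le_const
    intro τ hτ
    rw [uIoc_of_le (by linarith)] at hτ
    refine hsmall _ hl τ ?_ (hv τ ⟨by linarith [hτ.1], hτ.2⟩)
    rw [abs_of_nonneg (by linarith [hτ.1])]; linarith [hτ.1]
  rw [show 2 * n - n = n by ring, abs_of_pos hn] at hlow
  rw [show 7 * n - 6 * n = n by ring, abs_of_pos hn] at hhigh
  have hsum : ∫ τ in n..(7 * n), F ((-(2 * δ) : ℝ) + τ * Complex.I) =
      (∫ τ in n..(2 * n), F ((-(2 * δ) : ℝ) + τ * Complex.I)) +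
      (∫ τ in (2 * n)..(6 * n), F ((-(2 * δ) : ℝ) + τ * Complex.I)) +
      ∫ τ in (6 * n)..(7 * n), F ((-(2 * δ) : ℝ) + τ * Complex.I) := by
    rw [intervalIntegral.integral_add_adjacent_intervals (hFL _ hm1 _ hm2) (hFL _ hm2 _ hm6),
      intervalIntegral.integral_add_adjacent_intervals (hFL _ hm1 _ hm6) (hFL _ hm6 _ hm7)]
  change ‖(∫ τ in (2 * n)..(6 * n), F ((0 : ℝ) + τ * Complex.I)) -
    ∫ τ in n..(7 * n), F ((-(2 * δ) : ℝ) + τ * Complex.I)‖ ≤ _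
  rw [hsum]
  set I0 := ∫ τ in (2 * n)..(6 * n), F ((0 : ℝ) + τ * Complex.I)
  set I1 := ∫ τ in n..(2 * n), F ((-(2 * δ) : ℝ) + τ * Complex.I)
  set I2 := ∫ τ in (2 * n)..(6 * n), F ((-(2 * δ) : ℝ) + τ * Complex.I)
  set I3 := ∫ τ in (6 * n)..(7 * n), F ((-(2 * δ) : ℝ) + τ * Complex.I)
  have e : I0 - (I1 + I2 + I3) = I0 - I2 - I1 - I3 := by ring
  rw [e]
  have m1 := norm_sub_le (I0 - I2 - I1) I3
  have m2 := norm_sub_le (I0 - I2) I1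
  have h4 : 2 * (0 - -(2 * δ)) * (ε * E) ≤ n * (ε * E) := by gcongr; linarith
  linarith

/-- The same as a bound for the integral over the shifted line. -/
theorem norm_integral_cutoff_mul_le (ha : 0 ≤ a) (hn : 0 < n) (hδ : 0 < δ)
    (haδ : a * (2 * δ) ≤ 1) (hδn : 16 * δ ≤ n) {φ : ℂ → ℂ} {E A : ℝ}
    (hφ : DifferentiableOn ℂ φ (Icc (-(2 * δ)) 0 ×ℂ Icc (2 * n) (6 * n)))
    (hφc : ContinuousOn (fun τ : ℝ => φ ((-(2 * δ) : ℝ) + τ * Complex.I)) (Icc n (7 * n)))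
    (hv : ∀ τ ∈ Icc n (7 * n), ‖φ ((-(2 * δ) : ℝ) + τ * Complex.I)‖ ≤ E)
    (hh : ∀ x ∈ Icc (-(2 * δ)) 0, ∀ τ ∈ Icc (2 * n) (6 * n), ‖φ (x + τ * Complex.I)‖ ≤ E)
    (hA : ∀ τ ∈ Icc (2 * n) (6 * n), ‖φ ((0 : ℝ) + τ * Complex.I)‖ ≤ A) :
    ‖∫ τ in n..(7 * n), cutoff a n ((-(2 * δ) : ℝ) + τ * Complex.I) *
        φ ((-(2 * δ) : ℝ) + τ * Complex.I)‖ ≤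
      4 * n * A + 3 * n * Real.exp (-(Real.exp (a * n) / 4)) * E := by
  have h1 := norm_integral_cutoff_mul_sub_le ha hn hδ haδ hδn hφ hφc hv hh
  have h2 : ‖∫ τ in (2 * n)..(6 * n), cutoff a n ((0 : ℝ) + τ * Complex.I) *
      φ ((0 : ℝ) + τ * Complex.I)‖ ≤ A * |6 * n - 2 * n| := by
    apply intervalIntegral.norm_integral_le_of_norm_le_const
    intro τ hτ
    rw [uIoc_of_le (by linarith)] at hτ
    rw [norm_mul]
    have h3 : ‖cutoff a n ((0 : ℝ) + τ * Complex.I)‖ ≤ 1 := norm_cutoff_le_one (by simp)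
    have h4 := hA τ (Ioc_subset_Icc_self hτ)
    calc _ ≤ 1 * A := by gcongr
      _ = A := one_mul A
  rw [show 6 * n - 2 * n = 4 * n by ring, abs_of_pos (by linarith)] at h2
  have h3 := norm_sub_norm_le (∫ τ in n..(7 * n), cutoff a n ((-(2 * δ) : ℝ) + τ * Complex.I) *
        φ ((-(2 * δ) : ℝ) + τ * Complex.I)) (∫ τ in (2 * n)..(6 * n),
        cutoff a n ((0 : ℝ) + τ * Complex.I) * φ ((0 : ℝ) + τ * Complex.I))
  rw [norm_sub_rev] at h3
  linarith

/-- Away from the frequencies of the packet the segment of integration is moved to the imaginary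
axis, where `e^{-w X}` is bounded. -/
theorem norm_packetTransform_le_outside (ha : 0 ≤ a) (hn : 0 < n) (hδ : 0 < δ)
    (haδ : a * (2 * δ) ≤ 1) (hδn : 16 * δ ≤ n) (hX : 0 ≤ X) {s : ℂ} {H : ℝ} (hH : 16 ≤ H)
    (hv : ∀ τ ∈ Icc n (7 * n), 1 + ‖s‖ ≤ H * ‖s - ((-(2 * δ) : ℝ) + τ * Complex.I)‖)
    (hh : ∀ x : ℝ, ∀ τ ∈ Icc (2 * n) (6 * n), 1 + ‖s‖ ≤ 16 * ‖s - (x + τ * Complex.I)‖) :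
    ‖packetTransform a n δ X s‖ ≤ (64 * n + 3 * n * Real.exp (-(Real.exp (a * n) / 4)) *
      (Real.exp (2 * δ * X) * H)) / (1 + ‖s‖) := by
  have hs : 0 < 1 + ‖s‖ := by positivity
  have hexp : ∀ x τ : ℝ, ‖Complex.exp (-(((x : ℂ) + τ * Complex.I) * X))‖ =
      Real.exp (-(x * X)) := by
    intro x τ
    have : (-(((x : ℂ) + τ * Complex.I) * X)).re = -(x * X) := by simp
    rw [Complex.norm_exp, this]
  have hexp2 : ∀ x ∈ Icc (-(2 * δ)) 0, Real.exp (-(x * X)) ≤ Real.exp (2 * δ * X) := by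
    intro x hx
    rw [Real.exp_le_exp]; nlinarith [hx.1]
  have hinv : ∀ (w : ℂ) (H' : ℝ), 0 < H' → 1 + ‖s‖ ≤ H' * ‖s - w‖ →
      ‖(s - w)⁻¹‖ ≤ H' / (1 + ‖s‖) := by
    intro w H' hH' h
    have h0 : 0 < ‖s - w‖ := by
      by_contra hc
      have := mul_nonpos_of_nonneg_of_nonpos hH'.le (not_lt.1 hc)
      linarith
    rw [norm_inv, inv_eq_one_div, div_le_div_iff₀ h0 hs]
    linarith
  have hE : ∀ x ∈ Icc (-(2 * δ)) 0, ∀ τ : ℝ, 1 + ‖s‖ ≤ H * ‖s - (x + τ * Complex.I)‖ →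
      ‖Complex.exp (-(((x : ℂ) + τ * Complex.I) * X)) * (s - (x + τ * Complex.I))⁻¹‖ ≤
        Real.exp (2 * δ * X) * H / (1 + ‖s‖) := by
    intro x hx τ h
    rw [norm_mul, hexp, mul_div_assoc]
    have h1 := hinv _ H (by linarith) h
    have h2 := hexp2 x hx
    gcongr
  have hne : ∀ x τ : ℝ, τ ∈ Icc (2 * n) (6 * n) → s - (x + τ * Complex.I) ≠ 0 := by
    intro x τ hτ h
    have := hh x τ hτ
    rw [h, norm_zero] at this
    linarith
  have key := norm_integral_cutoff_mul_le ha hn hδ haδ hδn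
    (φ := fun w => Complex.exp (-(w * X)) * (s - w)⁻¹)
    (E := Real.exp (2 * δ * X) * H / (1 + ‖s‖)) (A := 16 / (1 + ‖s‖)) ?_ ?_ ?_ ?_ ?_
  · unfold packetTransform
    simp only [mul_assoc] at key ⊢
    refine key.trans (le_of_eq ?_)
    ring
  · refine DifferentiableOn.mul (by fun_prop) (DifferentiableOn.inv (by fun_prop) fun w hw => ?_)
    rw [Complex.mem_reProdIm] at hw
    have := hne w.re w.im hw.2
    rwa [Complex.re_add_im] at this
  · refine ContinuousOn.mul (Continuous.continuousOn (by fun_prop))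
      (ContinuousOn.inv₀ (Continuous.continuousOn (by fun_prop)) fun τ hτ h => ?_)
    have := hv τ hτ
    rw [h, norm_zero] at this
    linarith
  · intro τ hτ
    exact hE _ ⟨le_rfl, by linarith⟩ τ (hv τ hτ)
  · intro x hx τ hτ
    refine hE x hx τ ((hh x τ hτ).trans ?_)
    gcongr
  · intro τ hτ
    rw [norm_mul, hexp]
    simp only [zero_mul, neg_zero, Real.exp_zero, one_mul]
    exact hinv _ 16 (by norm_num) (hh 0 τ hτ)

end

/-! ### The wave packet -/

/-- A complex wave packet centred at `0`, with frequencies near `4 n`. -/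
noncomputable def complexPacket (a n δ y : ℝ) : ℂ :=
  ∫ τ in n..(7 * n), cutoff a n ((-(2 * δ) : ℝ) + τ * Complex.I) *
    Complex.exp (((-(2 * δ) : ℝ) + τ * Complex.I) * y)

/-- The real wave packet centred at `X`, normalized such that its Lipschitz constant is bounded. -/
noncomputable def packet (a n δ X x : ℝ) : ℝ := (complexPacket a n δ (x - X)).re / n ^ 2

/-- The extension of the Laplace transform of `packet a n δ X`. -/
noncomputable def packetExtension (a n δ X : ℝ) (s : ℂ) : ℂ :=
  (packetTransform a n δ X s +
    (starRingEnd ℂ) (packetTransform a n δ X ((starRingEnd ℂ) s))) / (2 * n ^ 2)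

section

variable {a n δ X : ℝ}

theorem continuous_complexPacket (a n δ : ℝ) : Continuous (complexPacket a n δ) := by
  have := (differentiable_cutoff a n).continuous
  unfold complexPacket
  apply intervalIntegral.continuous_parametric_intervalIntegral_of_continuous'
  simp only [Function.uncurry_def]
  fun_prop

theorem norm_exp_line (x τ y : ℝ) : ‖Complex.exp (((x : ℂ) + τ * Complex.I) * y)‖ =
    Real.exp (x * y) := by
  have : (((x : ℂ) + τ * Complex.I) * y).re = x * y := by simp
  rw [Complex.norm_exp, this]

theorem norm_complexPacket_le (ha : 0 ≤ a) (hn : 0 < n) (hδ : 0 < δ) (haδ : a * (2 * δ) ≤ 1)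
    {y : ℝ} (hy : -X ≤ y) : ‖complexPacket a n δ y‖ ≤ Real.exp (2 * δ * X) * (6 * n) := by
  have h1 : ‖complexPacket a n δ y‖ ≤ Real.exp (2 * δ * X) * |7 * n - n| := by
    apply intervalIntegral.norm_integral_le_of_norm_le_const
    intro τ _
    rw [norm_mul, norm_exp_line]
    have h1 : ‖cutoff a n ((-(2 * δ) : ℝ) + τ * Complex.I)‖ ≤ 1 := norm_cutoff_le_one
      (abs_mul_le_one_of_abs_le ha haδ (by rw [abs_neg, abs_of_pos (by linarith)]))
    have h2 : Real.exp (-(2 * δ) * y) ≤ Real.exp (2 * δ * X) := by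
      rw [Real.exp_le_exp]; nlinarith
    calc _ ≤ 1 * Real.exp (2 * δ * X) := by gcongr
      _ = _ := one_mul _
  rwa [show 7 * n - n = 6 * n by ring, abs_of_pos (by linarith)] at h1

theorem integrableOn_exp_mul_complexPacket (ha : 0 ≤ a) (hn : 0 < n) (hδ : 0 < δ)
    (haδ : a * (2 * δ) ≤ 1) {s : ℂ} (hs : 0 < s.re) :
    IntegrableOn (fun x : ℝ => Complex.exp (-s * x) * complexPacket a n δ (x - X)) (Ioi 0) := by
  have h1 : IntegrableOn (fun x : ℝ => Complex.exp (-s * x)) (Ioi 0) :=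
    integrableOn_exp_mul_complex_Ioi (by simpa using hs) 0
  have h2 := Integrable.bdd_mul (c := Real.exp (2 * δ * X) * (6 * n)) h1
    (f := fun x => complexPacket a n δ (x - X))
    ((continuous_complexPacket a n δ).comp (by fun_prop : Continuous fun x => x - X)
      |>.aestronglyMeasurable) ?_
  · exact h2.congr (ae_of_all _ fun x => mul_comm _ _)
  · refine (ae_restrict_iff' measurableSet_Ioi).2 (ae_of_all _ fun x hx => ?_)
    have : 0 < x := hx
    exact norm_complexPacket_le ha hn hδ haδ (by linarith)

theorem integral_exp_mul_complexPacket (ha : 0 ≤ a) (hδ : 0 < δ)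
    (haδ : a * (2 * δ) ≤ 1) {s : ℂ} (hs : 0 < s.re) :
    ∫ x in Ioi (0 : ℝ), Complex.exp (-s * x) * complexPacket a n δ (x - X) =
      packetTransform a n δ X s := by
  have hcut := (differentiable_cutoff a n).continuous
  set w : ℝ → ℂ := fun τ => (-(2 * δ) : ℝ) + τ * Complex.I with hw
  have hwre : ∀ τ, (w τ).re = -(2 * δ) := fun τ => by simp [hw]
  have hwc : Continuous w := by rw [hw]; fun_prop
  have hsw : ∀ τ, (-(s - w τ)).re < 0 := fun τ => by
    rw [Complex.neg_re, Complex.sub_re, hwre]; linarith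
  have : IsFiniteMeasure (volume.restrict (uIoc n (7 * n))) :=
    ⟨by rw [Measure.restrict_apply_univ, uIoc]; exact measure_Ioc_lt_top⟩
  have hint : Integrable (Function.uncurry fun (τ x : ℝ) =>
      (cutoff a n (w τ) * Complex.exp (-(w τ * X)) * Complex.exp (τ * x * Complex.I)) *
        Complex.exp (-(s + 2 * δ) * x))
      ((volume.restrict (Set.uIoc n (7 * n))).prod (volume.restrict (Ioi (0 : ℝ)))) := by
    have h0 : Integrable (fun x : ℝ => Complex.exp (-(s + 2 * δ) * x))
        (volume.restrict (Ioi (0 : ℝ))) :=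
      integrableOn_exp_mul_complex_Ioi (by simp; linarith) 0
    have h1 : Integrable (fun z : ℝ × ℝ => Complex.exp (-(s + 2 * δ) * z.2))
        ((volume.restrict (Set.uIoc n (7 * n))).prod (volume.restrict (Ioi (0 : ℝ)))) :=
      Integrable.comp_snd h0 _
    refine Integrable.bdd_mul (c := Real.exp (2 * δ * X)) h1 ?_ (ae_of_all _ ?_)
    · apply Continuous.aestronglyMeasurable
      fun_prop
    · rintro ⟨τ, x⟩
      have e1 : ‖Complex.exp (τ * x * Complex.I)‖ = 1 := by
        have := Complex.norm_exp_ofReal_mul_I (τ * x)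
        rwa [Complex.ofReal_mul] at this
      have e2 : ‖Complex.exp (-(w τ * X))‖ = Real.exp (2 * δ * X) := by
        rw [Complex.norm_exp]
        congr 1
        simp [hw]
      have e3 : ‖cutoff a n (w τ)‖ ≤ 1 := norm_cutoff_le_one
        (abs_mul_le_one_of_abs_le ha haδ (by rw [abs_neg, abs_of_pos (by linarith)]))
      simp only [norm_mul]
      rw [e1, e2, mul_one]
      exact mul_le_of_le_one_left (Real.exp_pos _).le e3
  have hF : ∀ τ x : ℝ, Complex.exp (-s * x) * (cutoff a n (w τ) *
      Complex.exp (w τ * (x - X : ℝ))) = (cutoff a n (w τ) * Complex.exp (-(w τ * X)) *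
      Complex.exp (τ * x * Complex.I)) * Complex.exp (-(s + 2 * δ) * x) := by
    intro τ x
    have : Complex.exp (-s * x) * Complex.exp (w τ * (x - X : ℝ)) =
        Complex.exp (-(w τ * X)) * Complex.exp (τ * x * Complex.I) *
          Complex.exp (-(s + 2 * δ) * x) := by
      rw [← Complex.exp_add, ← Complex.exp_add, ← Complex.exp_add]
      congr 1
      rw [hw]; push_cast; ring
    linear_combination cutoff a n (w τ) * this
  have hinner : ∀ τ : ℝ, ∫ x in Ioi (0 : ℝ), (cutoff a n (w τ) * Complex.exp (-(w τ * X)) *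
      Complex.exp (τ * x * Complex.I)) * Complex.exp (-(s + 2 * δ) * x) =
      cutoff a n (w τ) * Complex.exp (-(w τ * X)) * (s - w τ)⁻¹ := by
    intro τ
    have h1 : ∀ x : ℝ, (cutoff a n (w τ) * Complex.exp (-(w τ * X)) *
        Complex.exp (τ * x * Complex.I)) * Complex.exp (-(s + 2 * δ) * x) =
        cutoff a n (w τ) * Complex.exp (-(w τ * X)) * Complex.exp (-(s - w τ) * x) := by
      intro x
      rw [mul_assoc, ← Complex.exp_add]
      congr 2
      rw [hw]; push_cast; ring
    simp only [h1]
    rw [integral_const_mul, integral_exp_mul_complex_Ioi (hsw τ)]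
    congr 1
    simp only [Complex.ofReal_zero, mul_zero, Complex.exp_zero, neg_div_neg_eq, one_div]
  have hswap := intervalIntegral_integral_swap hint
  simp only [hinner] at hswap
  refine Eq.trans ?_ hswap.symm
  refine integral_congr_ae (ae_of_all _ fun x => ?_)
  simp only
  unfold complexPacket
  rw [← intervalIntegral.integral_const_mul]
  exact intervalIntegral.integral_congr fun τ _ => hF τ x

theorem laplace_packet (ha : 0 ≤ a) (hn : 0 < n) (hδ : 0 < δ) (haδ : a * (2 * δ) ≤ 1) {s : ℂ}
    (hs : 0 < s.re) : laplace (packet a n δ X) s = packetExtension a n δ X s := by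
  unfold laplace packetExtension
  have hs' : 0 < ((starRingEnd ℂ) s).re := by rwa [Complex.conj_re]
  rw [← integral_exp_mul_complexPacket ha hδ haδ hs,
    ← integral_exp_mul_complexPacket ha hδ haδ hs', ← integral_conj]
  have h1 := integrableOn_exp_mul_complexPacket (X := X) ha hn hδ haδ hs
  have h2 : IntegrableOn (fun x : ℝ => (starRingEnd ℂ) (Complex.exp (-(starRingEnd ℂ) s * x) *
      complexPacket a n δ (x - X))) (Ioi 0) :=
    (Complex.conjCLE : ℂ →L[ℝ] ℂ).integrable_comp
      (integrableOn_exp_mul_complexPacket (X := X) ha hn hδ haδ hs')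
  rw [← integral_add h1 h2, ← integral_div]
  refine integral_congr_ae (ae_of_all _ fun x => ?_)
  simp only [map_mul, ← Complex.exp_conj, map_neg, Complex.conj_conj, Complex.conj_ofReal, packet]
  rw [← mul_add, Complex.add_conj]
  push_cast
  ring

theorem norm_exp_mul_sub_exp_mul_le {w : ℂ} (hw : w.re ≤ 0) {y y' : ℝ} (hy : -X ≤ y)
    (hy' : -X ≤ y') : ‖Complex.exp (w * y) - Complex.exp (w * y')‖ ≤
      ‖w‖ * Real.exp (-(w.re * X)) * |y - y'| := by
  have hd : ∀ u ∈ Ici (-X), HasDerivWithinAt (fun u : ℝ => Complex.exp (w * u))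
      (Complex.exp (w * u) * (w * 1)) (Ici (-X)) u := fun u _ => by
    have h0 : HasDerivAt (fun τ : ℝ => (τ : ℂ)) 1 u := Complex.ofRealCLM.hasDerivAt
    exact (h0.const_mul w).cexp.hasDerivWithinAt
  refine Convex.norm_image_sub_le_of_norm_hasDerivWithin_le hd (fun u hu => ?_) (convex_Ici _)
    hy' hy
  have hu' : -X ≤ u := hu
  rw [norm_mul, mul_one, mul_comm, Complex.norm_exp]
  gcongr
  have : (w * u).re = w.re * u := by simp
  rw [this]
  nlinarith

/-- The smallness of the cutoff near the ends of the segment of integration compensates all other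
factors. -/
theorem small_consequences (hδ : 0 < δ) (hδn : 16 * δ ≤ n) (hX : 0 ≤ X) {ε : ℝ}
    (hε : 0 < ε) (hsmall : 12 * (n / δ) * Real.exp (2 * δ * X) * ε ≤ 1) :
    ε * Real.exp (2 * δ * X) ≤ 1 / 192 ∧ ε ≤ 1 / 192 := by
  have h1 : 16 ≤ n / δ := (le_div_iff₀ hδ).2 hδn
  have h2 : 1 ≤ Real.exp (2 * δ * X) := Real.one_le_exp (by positivity)
  have h3 : 192 * (ε * Real.exp (2 * δ * X)) ≤ 1 := by
    refine le_trans ?_ hsmall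
    calc _ = 12 * 16 * Real.exp (2 * δ * X) * ε := by ring
      _ ≤ _ := by gcongr
  refine ⟨by linarith, ?_⟩
  have : ε * 1 ≤ ε * Real.exp (2 * δ * X) := by gcongr
  linarith

/-- On the imaginary axis the derivative of `e^{w x}` is of size at most `6 n`; the shift of the
segment to the axis is paid for by the smallness of the cutoff. -/
theorem lipschitzOnWith_packet (ha : 0 ≤ a) (hn : 1 ≤ n) (hδ : 0 < δ) (haδ : a * (2 * δ) ≤ 1)
    (hδn : 16 * δ ≤ n) (hX : 0 ≤ X)
    (hsmall : 12 * (n / δ) * Real.exp (2 * δ * X) * Real.exp (-(Real.exp (a * n) / 4)) ≤ 1) :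
    LipschitzOnWith 48 (packet a n δ X) (Ici 0) := by
  have hcut := (differentiable_cutoff a n).continuous
  have hn0 : 0 < n := by linarith
  obtain ⟨he, -⟩ := small_consequences hδ hδn hX (Real.exp_pos _) hsmall
  set ε := Real.exp (-(Real.exp (a * n) / 4)) with hε
  set E := Real.exp (2 * δ * X) with hE
  refine LipschitzOnWith.of_dist_le_mul fun x hx x' hx' => ?_
  have hx0 : 0 ≤ x := hx
  have hx0' : 0 ≤ x' := hx'
  have hbd : ∀ u ∈ Icc (-(2 * δ)) 0, ∀ τ ∈ Icc n (7 * n),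
      ‖Complex.exp (((u : ℂ) + τ * Complex.I) * (x - X : ℝ)) -
        Complex.exp (((u : ℂ) + τ * Complex.I) * (x' - X : ℝ))‖ ≤ 8 * n * E * |x - x'| := by
    intro u hu τ hτ
    have e1 : ((u : ℂ) + τ * Complex.I).re = u := by simp
    have e2 : ((u : ℂ) + τ * Complex.I).im = τ := by simp
    refine (norm_exp_mul_sub_exp_mul_le (X := X) (by rw [e1]; exact hu.2) (by linarith)
      (by linarith)).trans ?_
    rw [e1, show x - X - (x' - X) = x - x' by ring]
    have h1 : ‖(u : ℂ) + τ * Complex.I‖ ≤ 8 * n := by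
      refine (Complex.norm_le_abs_re_add_abs_im _).trans ?_
      rw [e1, e2, abs_of_nonpos hu.2, abs_of_nonneg (by linarith [hτ.1])]
      linarith [hu.1, hτ.2]
    have h2 : Real.exp (-(u * X)) ≤ E := by
      rw [hE, Real.exp_le_exp]; nlinarith [hu.1]
    gcongr
  have key := norm_integral_cutoff_mul_le ha hn0 hδ haδ hδn
    (φ := fun w => Complex.exp (w * (x - X : ℝ)) - Complex.exp (w * (x' - X : ℝ)))
    (E := 8 * n * E * |x - x'|) (A := 6 * n * |x - x'|) (by fun_prop) (Continuous.continuousOn (by fun_prop))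
    (fun τ hτ => hbd _ ⟨le_rfl, by linarith⟩ τ hτ)
    (fun u hu τ hτ => hbd u hu τ ⟨by linarith [hτ.1], by linarith [hτ.2]⟩) ?_
  · have hsub : complexPacket a n δ (x - X) - complexPacket a n δ (x' - X) =
        ∫ τ in n..(7 * n), cutoff a n ((-(2 * δ) : ℝ) + τ * Complex.I) *
          (Complex.exp (((-(2 * δ) : ℝ) + τ * Complex.I) * (x - X : ℝ)) -
            Complex.exp (((-(2 * δ) : ℝ) + τ * Complex.I) * (x' - X : ℝ))) := by
      unfold complexPacket
      rw [← intervalIntegral.integral_sub (Continuous.intervalIntegrable (by fun_prop) _ _)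
        (Continuous.intervalIntegrable (by fun_prop) _ _)]
      exact intervalIntegral.integral_congr fun τ _ => (mul_sub _ _ _).symm
    rw [← hsub] at key
    rw [Real.dist_eq, Real.dist_eq]
    unfold packet
    rw [← sub_div, abs_div, abs_of_pos (by positivity : 0 < n ^ 2), div_le_iff₀ (by positivity),
      ← Complex.sub_re]
    refine (Complex.abs_re_le_norm _).trans (key.trans ?_)
    calc _ = 24 * |x - x'| * n ^ 2 * (1 + ε * E) := by ring
      _ ≤ 24 * |x - x'| * n ^ 2 * 2 := by gcongr; linarith
      _ = _ := by rw [show ((48 : NNReal) : ℝ) = 48 by norm_num]; ring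
  · intro τ hτ
    have e1 : (((0 : ℝ) : ℂ) + τ * Complex.I).re = 0 := by simp
    have e2 : (((0 : ℝ) : ℂ) + τ * Complex.I).im = τ := by simp
    refine (norm_exp_mul_sub_exp_mul_le (X := X) (by rw [e1]) (by linarith)
      (by linarith)).trans ?_
    rw [e1, show x - X - (x' - X) = x - x' by ring, zero_mul, neg_zero, Real.exp_zero, mul_one]
    gcongr
    refine (Complex.norm_le_abs_re_add_abs_im _).trans ?_
    rw [e1, e2, abs_zero, zero_add, abs_of_nonneg (by linarith [hτ.1])]
    exact hτ.2

theorem abs_packet_zero_le (ha : 0 ≤ a) (hn : 1 ≤ n) (hδ : 0 < δ) (haδ : a * (2 * δ) ≤ 1)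
    (hδn : 16 * δ ≤ n) (hX : 0 ≤ X)
    (hsmall : 12 * (n / δ) * Real.exp (2 * δ * X) * Real.exp (-(Real.exp (a * n) / 4)) ≤ 1) :
    |packet a n δ X 0| ≤ 7 := by
  have hn0 : 0 < n := by linarith
  obtain ⟨he, -⟩ := small_consequences hδ hδn hX (Real.exp_pos _) hsmall
  set ε := Real.exp (-(Real.exp (a * n) / 4)) with hε
  set E := Real.exp (2 * δ * X) with hE
  have hbd : ∀ u ∈ Icc (-(2 * δ)) 0, ∀ τ : ℝ,
      ‖Complex.exp (((u : ℂ) + τ * Complex.I) * (0 - X : ℝ))‖ ≤ E := by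
    intro u hu τ
    rw [norm_exp_line, hE, Real.exp_le_exp]
    nlinarith [hu.1]
  have key := norm_integral_cutoff_mul_le ha hn0 hδ haδ hδn
    (φ := fun w => Complex.exp (w * (0 - X : ℝ))) (E := E) (A := 1) (by fun_prop) (Continuous.continuousOn (by fun_prop))
    (fun τ hτ => hbd _ ⟨le_rfl, by linarith⟩ τ) (fun u hu τ hτ => hbd u hu τ)
    (fun τ _ => by rw [norm_exp_line, zero_mul, Real.exp_zero])
  unfold packet
  rw [abs_div, abs_of_pos (by positivity : 0 < n ^ 2), div_le_iff₀ (by positivity)]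
  refine (Complex.abs_re_le_norm _).trans (key.trans ?_)
  have h2 : 1 * n ≤ n * n := by gcongr
  calc _ = n * (4 + 3 * (ε * E)) := by ring
    _ ≤ n * 7 := by gcongr; linarith
    _ ≤ _ := by linarith

/-- At its centre the packet is essentially the integral of the cutoff over the imaginary axis,
where the cutoff is positive, and at least `1 / e` for `3 n ≤ τ ≤ 5 n`. -/
theorem le_packet_self (ha : 0 ≤ a) (hn : 1 ≤ n) (hδ : 0 < δ) (haδ : a * (2 * δ) ≤ 1)
    (hδn : 16 * δ ≤ n) (hX : 0 ≤ X)
    (hsmall : 12 * (n / δ) * Real.exp (2 * δ * X) * Real.exp (-(Real.exp (a * n) / 4)) ≤ 1) :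
    1 / (2 * n) ≤ packet a n δ X X := by
  have hn0 : 0 < n := by linarith
  obtain ⟨-, he⟩ := small_consequences hδ hδn hX (Real.exp_pos _) hsmall
  set ε := Real.exp (-(Real.exp (a * n) / 4)) with hε
  have key := norm_integral_cutoff_mul_sub_le ha hn0 hδ haδ hδn
    (φ := fun w => Complex.exp (w * (X - X : ℝ))) (E := 1) (by fun_prop) (Continuous.continuousOn (by fun_prop))
    (fun τ _ => by rw [norm_exp_line]; simp) (fun u _ τ _ => by rw [norm_exp_line]; simp)
  set k : ℝ → ℝ := fun τ => Real.exp (-(Real.cosh (a * (τ - 4 * n)) / Real.cosh (a * n))) with hk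
  have hkc : Continuous k := by rw [hk]; fun_prop
  have hI0 : (∫ τ in (2 * n)..(6 * n), cutoff a n ((0 : ℝ) + τ * Complex.I) *
        Complex.exp (((0 : ℝ) + τ * Complex.I) * (X - X : ℝ))) =
      ((∫ τ in (2 * n)..(6 * n), k τ : ℝ) : ℂ) := by
    rw [← intervalIntegral.integral_ofReal]
    refine intervalIntegral.integral_congr fun τ _ => ?_
    rw [cutoff_axis, sub_self, Complex.ofReal_zero, mul_zero, Complex.exp_zero, mul_one]
  have hk1 : 0.36 * (2 * n) ≤ ∫ τ in (2 * n)..(6 * n), k τ := by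
    have h1 : ∫ τ in (3 * n)..(5 * n), (0.36 : ℝ) ≤ ∫ τ in (3 * n)..(5 * n), k τ := by
      refine intervalIntegral.integral_mono_on (by linarith) (by simp)
        (hkc.intervalIntegrable _ _) fun τ hτ => ?_
      have h2 : Real.cosh (a * (τ - 4 * n)) ≤ Real.cosh (a * n) := by
        rw [Real.cosh_le_cosh, abs_mul, abs_mul, abs_of_pos hn0]
        exact mul_le_mul_of_nonneg_left
          (abs_le.2 ⟨by linarith [hτ.1], by linarith [hτ.2]⟩) (abs_nonneg a)
      have h3 : Real.cosh (a * (τ - 4 * n)) / Real.cosh (a * n) ≤ 1 :=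
        (div_le_one (Real.cosh_pos _)).2 h2
      have h4 : Real.exp (-1) ≤ k τ := Real.exp_le_exp.2 (by linarith)
      have := Real.exp_neg_one_gt_d9
      linarith
    have h2 : ∫ τ in (3 * n)..(5 * n), k τ ≤ ∫ τ in (2 * n)..(6 * n), k τ :=
      intervalIntegral.integral_mono_interval (by linarith) (by linarith) (by linarith)
        (ae_of_all _ fun τ => (Real.exp_pos _).le) (hkc.intervalIntegrable _ _)
    rw [intervalIntegral.integral_const, smul_eq_mul] at h1
    linarith
  rw [hI0] at key
  have h5 := (Complex.abs_re_le_norm _).trans key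
  rw [Complex.sub_re, Complex.ofReal_re] at h5
  have h6 := (le_abs_self _).trans h5
  unfold packet
  rw [div_le_div_iff₀ (by positivity) (by positivity)]
  change _ - (complexPacket a n δ (X - X)).re ≤ _ at h6
  have h7 : 3 * n * ε ≤ 3 * n * (1 / 192) := by gcongr
  have h8 : n / 2 ≤ (complexPacket a n δ (X - X)).re := by linarith
  nlinarith

end

/-! ### Analytic extension and bounds for the packets -/

section

variable {M K : ℝ → ℝ} {a n δ X t : ℝ}

theorem differentiableAt_packetTransform {s₀ : ℂ} {r : ℝ} (hr : 0 < r) (hn : 0 ≤ n)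
    (hs : ∀ τ ∈ Icc n (7 * n), 2 * r ≤ ‖s₀ - ((-(2 * δ) : ℝ) + τ * Complex.I)‖) :
    DifferentiableAt ℂ (packetTransform a n δ X) s₀ := by
  have hcut := (differentiable_cutoff a n).continuous
  set w : ℝ → ℂ := fun τ => (-(2 * δ) : ℝ) + τ * Complex.I with hw
  have hwc : Continuous w := by rw [hw]; fun_prop
  set k : ℝ → ℂ := fun τ => cutoff a n (w τ) * Complex.exp (-(w τ * X)) with hk
  have hkc : Continuous k := by rw [hk]; fun_prop
  have hdist : ∀ s ∈ Metric.ball s₀ r, ∀ τ ∈ Icc n (7 * n), r ≤ ‖s - w τ‖ := by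
    intro s hs' τ hτ
    rw [mem_ball_iff_norm] at hs'
    have h1 := hs τ hτ
    have h2 : ‖s₀ - w τ‖ ≤ ‖s - s₀‖ + ‖s - w τ‖ := by
      rw [norm_sub_rev s s₀]
      exact norm_sub_le_norm_sub_add_norm_sub _ _ _
    linarith
  have hne : ∀ s ∈ Metric.ball s₀ r, ∀ τ ∈ Icc n (7 * n), s - w τ ≠ 0 := by
    intro s hs' τ hτ h
    have := hdist s hs' τ hτ
    rw [h, norm_zero] at this
    linarith
  have hmem : s₀ ∈ Metric.ball s₀ r := Metric.mem_ball_self hr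
  have h7 : n ≤ 7 * n := by linarith
  have huIoc : ∀ τ ∈ uIoc n (7 * n), τ ∈ Icc n (7 * n) := fun τ hτ => by
    rw [uIoc_of_le h7] at hτ
    exact Ioc_subset_Icc_self hτ
  have main := intervalIntegral.hasDerivAt_integral_of_dominated_loc_of_deriv_le (𝕜 := ℂ)
    (F := fun s τ => k τ * (s - w τ)⁻¹) (F' := fun s τ => k τ * (-1 / (s - w τ) ^ 2)) (x₀ := s₀)
    (a := n) (b := 7 * n) (μ := volume) (s := Metric.ball s₀ r)
    (bound := fun τ => ‖k τ‖ * (1 / r ^ 2)) (Metric.ball_mem_nhds s₀ hr) ?_ ?_ ?_ ?_ ?_ ?_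
  · exact main.2.differentiableAt
  · refine Eventually.of_forall fun s => ?_
    exact (by fun_prop : Measurable fun τ => k τ * (s - w τ)⁻¹).aestronglyMeasurable
  · refine ContinuousOn.intervalIntegrable ?_
    rw [uIcc_of_le h7]
    exact hkc.continuousOn.mul (ContinuousOn.inv₀ (by fun_prop) fun τ hτ => hne s₀ hmem τ hτ)
  · exact (by fun_prop : Measurable fun τ => k τ * (-1 / (s₀ - w τ) ^ 2)).aestronglyMeasurable
  · refine ae_of_all _ fun τ hτ s hs' => ?_
    rw [norm_mul, norm_div, norm_neg, norm_one, norm_pow]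
    have := hdist s hs' τ (huIoc τ hτ)
    gcongr
  · exact (hkc.norm.mul continuous_const).intervalIntegrable _ _
  · refine ae_of_all _ fun τ hτ s hs' => ?_
    have h1 : HasDerivAt (fun s => s - w τ) 1 s := (hasDerivAt_id s).sub_const _
    exact (h1.inv (hne s hs' τ (huIoc τ hτ))).const_mul (k τ)

theorem conj_mem_Omega {s : ℂ} (hs : s ∈ Omega M) : (starRingEnd ℂ) s ∈ Omega M := by
  unfold Omega at hs ⊢
  simpa using hs

/-- The segment of integration keeps a distance from `Ω_M`. -/
theorem le_norm_sub_of_mem_Omega (hM : IsGrowthFunction M) (ht : 0 < t) (htM : 1 / M t ≤ t)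
    (hn : 2 * t ≤ n) {s : ℂ} (hs : s ∈ Omega M) {τ : ℝ} (hτ : n ≤ τ) :
    1 / M t ≤ ‖s - ((-(2 * (1 / M t)) : ℝ) + τ * Complex.I)‖ := by
  set w : ℂ := (-(2 * (1 / M t)) : ℝ) + τ * Complex.I with hw
  have e1 : (s - w).re = s.re + 2 * (1 / M t) := by
    rw [Complex.sub_re, hw]; simp
  have e2 : (s - w).im = s.im - τ := by simp [hw]
  rcases le_total t |s.im| with h | h
  · have h1 := Complex.abs_re_le_norm (s - w)
    rw [e1] at h1
    have h2 : |s.re| ≤ 1 / M |s.im| := hs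
    have h3 : 1 / M |s.im| ≤ 1 / M t := one_div_le_one_div_of_le (hM.pos t ht.le)
      (hM.monotoneOn (mem_Ici.2 ht.le) (mem_Ici.2 (abs_nonneg _)) h)
    have h4 := le_abs_self (s.re + 2 * (1 / M t))
    have h5 := neg_abs_le s.re
    linarith
  · have h1 := Complex.abs_im_le_norm (s - w)
    rw [e2] at h1
    have h2 := neg_abs_le (s.im - τ)
    have h3 := le_abs_self s.im
    linarith

theorem norm_le_of_mem_Omega (hM : IsGrowthFunction M) {s : ℂ} (hs : s ∈ Omega M) :
    ‖s‖ ≤ 1 / M 0 + |s.im| := by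
  have h2 : |s.re| ≤ 1 / M |s.im| := hs
  have h3 : 1 / M |s.im| ≤ 1 / M 0 := one_div_le_one_div_of_le (hM.pos 0 le_rfl)
    (hM.monotoneOn (mem_Ici.2 le_rfl) (mem_Ici.2 (abs_nonneg _)) (abs_nonneg _))
  exact (Complex.norm_le_abs_re_add_abs_im s).trans (by linarith)

theorem isLaplaceExtension_packet (hM : IsGrowthFunction M) (ha : 0 ≤ a) (ht : 0 < t)
    (htM : 1 / M t ≤ t) (hn : 2 * t ≤ n) (haδ : a * (2 * (1 / M t)) ≤ 1) :
    IsLaplaceExtension M (packet a n (1 / M t) X) (packetExtension a n (1 / M t) X) := by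
  have hδ : 0 < 1 / M t := one_div_pos.2 (hM.pos t ht.le)
  have hd : ∀ s ∈ Omega M, DifferentiableAt ℂ (packetTransform a n (1 / M t) X) s := fun s hs =>
    differentiableAt_packetTransform (r := 1 / M t / 2) (by positivity) (by linarith)
      fun τ hτ => by
        have := le_norm_sub_of_mem_Omega hM ht htM hn hs hτ.1
        linarith
  have hdiff : ∀ s ∈ Omega M, DifferentiableAt ℂ (packetExtension a n (1 / M t) X) s := by
    intro s hs
    have h1 := (hd _ (conj_mem_Omega hs)).conj_conj
    rw [Complex.conj_conj] at h1
    exact ((hd s hs).add h1).div_const _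
  refine ⟨fun s hs => (hdiff s hs).continuousAt.continuousWithinAt,
    fun s hs => (hdiff s (interior_subset hs)).differentiableWithinAt, fun s _ hre => ?_⟩
  exact (laplace_packet ha (by linarith) hδ haδ hre).symm

/-- Since `X = M_K(t)`, the factor `e^{X / M(t)}` equals `t K(t)`, which the bound for the
transform admits at the frequencies near `4 n`. -/
theorem norm_packetTransform_le (hM : IsGrowthFunction M) (hK : IsGrowthFunction K) (ha : 0 ≤ a)
    (ht : 1 ≤ t) (htM : 1 / M t ≤ t) (hn : 2 * t ≤ n) (haδ : a * (2 * (1 / M t)) ≤ 1)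
    (hδn : 16 * (1 / M t) ≤ n) (hnM : 2 / M 0 ≤ n) (hX : X = MK M K t)
    (hlog : 1 ≤ Real.log t + Real.log (K t))
    (hsmall : 12 * (n / (1 / M t)) * Real.exp (2 * (1 / M t) * X) *
      Real.exp (-(Real.exp (a * n) / 4)) ≤ 1) {s : ℂ} (hs : s ∈ Omega M) :
    ‖packetTransform a n (1 / M t) X s‖ ≤
      n ^ 2 * ((296 + 168 / K 0) * (K ‖s‖ / (1 + ‖s‖))) := by
  have ht0 : 0 < t := by linarith
  have hn0 : 0 < n := by linarith
  have hMt := hM.pos t ht0.le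
  have hM0 := hM.pos 0 le_rfl
  have hK0 := hK.pos 0 le_rfl
  have hKt := hK.pos t ht0.le
  have hKs := hK.pos ‖s‖ (norm_nonneg s)
  have hK0s : K 0 ≤ K ‖s‖ :=
    hK.monotoneOn (mem_Ici.2 le_rfl) (mem_Ici.2 (norm_nonneg s)) (norm_nonneg s)
  set δ := 1 / M t with hδdef
  have hδ : 0 < δ := one_div_pos.2 hMt
  have hδX' : δ * X = Real.log t + Real.log (K t) := by
    rw [hX, hδdef]; unfold MK; field_simp
  have hδX : 1 ≤ δ * X := by rw [hδX']; exact hlog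
  have hX0 : 0 ≤ X := by
    by_contra h
    have := mul_nonpos_of_nonneg_of_nonpos hδ.le (not_le.1 h).le
    linarith
  have hexp : Real.exp (δ * X) = t * K t := by
    rw [hδX', Real.exp_add, Real.exp_log ht0, Real.exp_log hKt]
  have hsn := norm_le_of_mem_Omega hM hs
  have hM0n : 1 / M 0 ≤ n / 2 := by
    have : 2 / M 0 = 2 * (1 / M 0) := by ring
    linarith
  have h1s : 0 < 1 + ‖s‖ := by positivity
  obtain ⟨hsm, -⟩ := small_consequences hδ hδn hX0 (Real.exp_pos _) hsmall
  set ε := Real.exp (-(Real.exp (a * n) / 4)) with hε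
  set E := Real.exp (2 * δ * X) with hE
  by_cases him : s.im ∈ Icc (3 / 2 * n) (13 / 2 * n)
  · have habs : |s.im| = s.im := abs_of_nonneg (by linarith [him.1])
    have hsre : |s.re| ≤ δ := by
      have h2 : |s.re| ≤ 1 / M |s.im| := hs
      refine h2.trans (one_div_le_one_div_of_le hMt (hM.monotoneOn (mem_Ici.2 ht0.le)
        (mem_Ici.2 (abs_nonneg _)) ?_))
      rw [habs]; linarith [him.1]
    have h1 := norm_packetTransform_le_inside (X := X) ha hn0 hδ haδ hδX hδn hsre him
    refine h1.trans ?_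
    rw [hexp]
    have hts : t ≤ ‖s‖ := by
      have := Complex.abs_im_le_norm s
      rw [habs] at this
      linarith [him.1]
    have hKts : K t ≤ K ‖s‖ := hK.monotoneOn (mem_Ici.2 ht0.le) (mem_Ici.2 (norm_nonneg s)) hts
    have h8 : 1 + ‖s‖ ≤ 8 * n := by rw [habs] at hsn; linarith [him.2]
    have h9 : (37 * K ‖s‖ + 21) * 8 ≤ (296 + 168 / K 0) * K ‖s‖ := by
      have : 168 ≤ 168 / K 0 * K ‖s‖ := by
        rw [div_mul_eq_mul_div, le_div_iff₀ hK0]; gcongr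
      linarith
    have h10 : 37 * (t * K t) + 20 + ε * E ≤ n * (37 * K ‖s‖ + 21) := by
      have e1 : t * K t ≤ n * K ‖s‖ := by gcongr; linarith
      nlinarith
    calc _ ≤ n * (37 * K ‖s‖ + 21) := h10
      _ = n * (37 * K ‖s‖ + 21) * (1 + ‖s‖) / (1 + ‖s‖) := by field_simp
      _ ≤ n * (37 * K ‖s‖ + 21) * (8 * n) / (1 + ‖s‖) := by gcongr
      _ = n ^ 2 * ((37 * K ‖s‖ + 21) * 8) / (1 + ‖s‖) := by ring
      _ ≤ n ^ 2 * ((296 + 168 / K 0) * K ‖s‖) / (1 + ‖s‖) := by gcongr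
      _ = _ := by ring
  · have hfar : ∀ τ ∈ Icc (2 * n) (6 * n), n / 2 ≤ |s.im - τ| := by
      intro τ hτ
      by_contra hc
      obtain ⟨h1, h2⟩ := abs_lt.1 (not_le.1 hc)
      exact him ⟨by linarith [hτ.1], by linarith [hτ.2]⟩
    have himn : ∀ x τ : ℝ, |s.im - τ| ≤ ‖s - (x + τ * Complex.I)‖ := by
      intro x τ
      have := Complex.abs_im_le_norm (s - (x + τ * Complex.I))
      simpa using this
    have habs_im : ∀ τ, 0 ≤ τ → |s.im| ≤ |s.im - τ| + τ := by
      intro τ hτ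
      have := abs_add_le (s.im - τ) τ
      rwa [sub_add_cancel, abs_of_nonneg hτ] at this
    have hnδ : 1 ≤ n / δ := (le_div_iff₀ hδ).2 (by linarith)
    have h1 := norm_packetTransform_le_outside (a := a) (H := 16 * (n / δ)) ha hn0 hδ haδ hδn hX0
      (s := s) (by linarith) ?_ ?_
    · refine h1.trans ?_
      have e1 : 3 * n * ε * (E * (16 * (n / δ))) ≤ 4 * n := by
        calc _ = 4 * n * (12 * (n / δ) * E * ε) := by ring
          _ ≤ 4 * n * 1 := by gcongr
          _ = _ := mul_one _
      have e2 : 68 * n ≤ n ^ 2 * ((296 + 168 / K 0) * K ‖s‖) := by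
        have : 168 ≤ 168 / K 0 * K ‖s‖ := by
          rw [div_mul_eq_mul_div, le_div_iff₀ hK0]; gcongr
        calc 68 * n = n * 1 * 68 := by ring
          _ ≤ n * n * ((296 + 168 / K 0) * K ‖s‖) := by
            gcongr
            · linarith
            · linarith
          _ = _ := by ring
      calc _ ≤ (64 * n + 4 * n) / (1 + ‖s‖) := by gcongr
        _ = 68 * n / (1 + ‖s‖) := by ring
        _ ≤ n ^ 2 * ((296 + 168 / K 0) * K ‖s‖) / (1 + ‖s‖) := by gcongr
        _ = _ := by ring
    · intro τ hτ
      have hd := le_norm_sub_of_mem_Omega hM ht0 htM hn hs hτ.1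
      rw [← hδdef] at hd
      rcases le_total |s.im| (14 * n) with h | h
      · calc 1 + ‖s‖ ≤ 16 * n := by linarith
          _ = 16 * (n / δ) * δ := by field_simp
          _ ≤ _ := by gcongr
      · have h2 := habs_im τ (by linarith [hτ.1])
        have h3 := himn (-(2 * δ)) τ
        calc 1 + ‖s‖ ≤ 16 * 1 * |s.im - τ| := by linarith [hτ.2]
          _ ≤ _ := by gcongr
    · intro x τ hτ
      have h2 := habs_im τ (by linarith [hτ.1])
      have h3 := himn x τ
      have h4 := hfar τ hτ
      linarith [hτ.2]

theorem norm_packetExtension_le (hM : IsGrowthFunction M) (hK : IsGrowthFunction K) (ha : 0 ≤ a)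
    (ht : 1 ≤ t) (htM : 1 / M t ≤ t) (hn : 2 * t ≤ n) (haδ : a * (2 * (1 / M t)) ≤ 1)
    (hδn : 16 * (1 / M t) ≤ n) (hnM : 2 / M 0 ≤ n) (hX : X = MK M K t)
    (hlog : 1 ≤ Real.log t + Real.log (K t))
    (hsmall : 12 * (n / (1 / M t)) * Real.exp (2 * (1 / M t) * X) *
      Real.exp (-(Real.exp (a * n) / 4)) ≤ 1) {s : ℂ} (hs : s ∈ Omega M) :
    ‖packetExtension a n (1 / M t) X s‖ ≤ (296 + 168 / K 0) * (K ‖s‖ / (1 + ‖s‖)) := by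
  have h1 := norm_packetTransform_le hM hK ha ht htM hn haδ hδn hnM hX hlog hsmall hs
  have h2 := norm_packetTransform_le hM hK ha ht htM hn haδ hδn hnM hX hlog hsmall
    (conj_mem_Omega hs)
  rw [Complex.norm_conj] at h2
  have hn0 : 0 < n := by linarith
  have e : ‖(2 * (n : ℂ) ^ 2)‖ = 2 * n ^ 2 := by
    rw [norm_mul, norm_pow, Complex.norm_real, Real.norm_of_nonneg hn0.le]; simp
  unfold packetExtension
  rw [norm_div, e, div_le_iff₀ (by positivity)]
  refine (norm_add_le _ _).trans ?_
  rw [Complex.norm_conj]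
  linarith

/-- The growth restriction on `K` makes the cutoff small enough, if the frequency is a large
multiple of `t`. -/
theorem eventually_cutoff_small (hM : IsGrowthFunction M) (hK : IsGrowthFunction K) {c : ℝ}
    (hc : 0 < c) (hKe : ∀ᶠ t in atTop, K t ≤ Real.exp (Real.exp (c * t * M t))) :
    ∀ᶠ t in atTop, 12 * (2 * (c + 3) * t / (1 / M t)) * Real.exp (2 * (1 / M t) * MK M K t) *
      Real.exp (-(Real.exp (M t / 2 * (2 * (c + 3) * t)) / 4)) ≤ 1 := by
  have hM0 := hM.pos 0 le_rfl
  set D := 24 * (c + 3) / M 0 ^ 2 * 6 with hD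
  have hD0 : 0 < D := by positivity
  filter_upwards [hKe, eventually_gt_atTop 0, eventually_ge_atTop (2 / M 0),
    eventually_ge_atTop (Real.log D / M 0)] with t hKt ht0 ht2 htD
  have hKt0 := hK.pos t ht0.le
  have hMt := hM.pos t ht0.le
  have hMM : M 0 ≤ M t := hM.monotoneOn (mem_Ici.2 le_rfl) (mem_Ici.2 ht0.le) ht0.le
  set y := t * M t with hy
  have hty : t * M 0 ≤ y := by rw [hy]; gcongr
  have hy2 : 2 ≤ y := by
    rw [div_le_iff₀ hM0] at ht2; linarith
  have hyD : Real.log D ≤ y := by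
    rw [div_le_iff₀ hM0] at htD; linarith
  have hexp : Real.exp (2 * (1 / M t) * MK M K t) = (t * K t) ^ 2 := by
    have : 2 * (1 / M t) * MK M K t = (2 : ℕ) * (Real.log t + Real.log (K t)) := by
      unfold MK; push_cast; field_simp
    rw [this, Real.exp_nat_mul, Real.exp_add, Real.exp_log ht0, Real.exp_log hKt0]
  have e1 : 12 * (2 * (c + 3) * t / (1 / M t)) * Real.exp (2 * (1 / M t) * MK M K t) ≤
      Real.exp (Real.log D + y + 2 * Real.exp (c * y)) := by
    rw [hexp, Real.exp_add, Real.exp_add, Real.exp_log hD0,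
      show 2 * Real.exp (c * y) = (2 : ℕ) * Real.exp (c * y) by norm_num, Real.exp_nat_mul]
    have h1 : K t ≤ Real.exp (Real.exp (c * y)) := by
      rw [hy, ← mul_assoc]; exact hKt
    have h2 : y ^ 3 / 6 ≤ Real.exp y := by
      have := Real.pow_div_factorial_le_exp y (by linarith) 3
      simpa [Nat.factorial] using this
    calc _ = 24 * (c + 3) / M 0 ^ 2 * (y * (t * M 0) ^ 2) * K t ^ 2 := by
          rw [hy]; field_simp; ring
      _ ≤ 24 * (c + 3) / M 0 ^ 2 * (y * y ^ 2) * Real.exp (Real.exp (c * y)) ^ 2 := by gcongr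
      _ = D * (y ^ 3 / 6) * Real.exp (Real.exp (c * y)) ^ 2 := by rw [hD]; ring
      _ ≤ _ := by gcongr
  have e2 : Real.log D + y + 2 * Real.exp (c * y) ≤
      Real.exp (M t / 2 * (2 * (c + 3) * t)) / 4 := by
    have h1 : M t / 2 * (2 * (c + 3) * t) = c * y + 3 * y := by rw [hy]; ring
    have h2 : 1 ≤ Real.exp (c * y) := Real.one_le_exp (by positivity)
    have h3 := Real.quadratic_le_exp_of_nonneg (x := 3 * y) (by positivity)
    have h4 : 2 + 2 * y ≤ Real.exp (3 * y) / 4 := by nlinarith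
    rw [h1, Real.exp_add]
    calc _ ≤ 1 * (2 * y) + 2 * Real.exp (c * y) := by linarith
      _ ≤ Real.exp (c * y) * (2 * y) + 2 * Real.exp (c * y) := by gcongr
      _ = Real.exp (c * y) * (2 + 2 * y) := by ring
      _ ≤ Real.exp (c * y) * (Real.exp (3 * y) / 4) := by gcongr
      _ = _ := by ring
  calc _ ≤ Real.exp (Real.exp (M t / 2 * (2 * (c + 3) * t)) / 4) *
        Real.exp (-(Real.exp (M t / 2 * (2 * (c + 3) * t)) / 4)) := by
        gcongr
        exact e1.trans (Real.exp_le_exp.2 e2)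
    _ = 1 := by rw [← Real.exp_add, add_neg_cancel, Real.exp_zero]

/-- For every large `t` there is a function that satisfies the assumptions with uniform constants
and has size at least `c / t` at `M_K(t)`. -/
theorem exists_extremal_packet (hM : IsGrowthFunction M) (hK : IsGrowthFunction K) {c : ℝ}
    (hc : 0 < c) (hKe : ∀ᶠ t in atTop, K t ≤ Real.exp (Real.exp (c * t * M t))) :
    ∃ C c', 0 < C ∧ 0 < c' ∧ ∀ᶠ t in atTop, ∃ (S : ℝ → ℝ) (g : ℂ → ℂ),
      LipschitzOnWith 48 S (Ici 0) ∧ |S 0| ≤ 7 ∧ IsLaplaceExtension M S g ∧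
      (∀ s ∈ Omega M, ‖g s‖ ≤ C * (K ‖s‖ / (1 + ‖s‖))) ∧ c' / t ≤ S (MK M K t) := by
  have hM0 := hM.pos 0 le_rfl
  have hK0 := hK.pos 0 le_rfl
  refine ⟨296 + 168 / K 0, 1 / (4 * (c + 3)), by positivity, by positivity, ?_⟩
  filter_upwards [eventually_cutoff_small hM hK hc hKe, eventually_ge_atTop 1,
    eventually_ge_atTop (16 / M 0), (tendsto_log_add_log hK).eventually_ge_atTop 1]
    with t hsmall ht1 htM hlog
  have ht0 : 0 < t := by linarith
  have hMt := hM.pos t ht0.le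
  have hMM : M 0 ≤ M t := hM.monotoneOn (mem_Ici.2 le_rfl) (mem_Ici.2 ht0.le) ht0.le
  have hδ : 0 < 1 / M t := one_div_pos.2 hMt
  have hδM : 16 * (1 / M t) ≤ t := by
    have : 1 / M t ≤ 1 / M 0 := one_div_le_one_div_of_le hM0 hMM
    have e : 16 / M 0 = 16 * (1 / M 0) := by ring
    linarith
  have htM' : 2 / M 0 ≤ t := le_trans (by gcongr; norm_num) htM
  set n := 2 * (c + 3) * t with hn
  have hn2 : 2 * t ≤ n := by
    rw [hn]
    gcongr
    linarith
  have ha : 0 ≤ M t / 2 := by positivity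
  have haδ : M t / 2 * (2 * (1 / M t)) ≤ 1 := le_of_eq (by field_simp)
  have hX : 0 ≤ MK M K t := mul_nonneg hMt.le (by linarith)
  have hn1 : 1 ≤ n := by linarith
  refine ⟨packet (M t / 2) n (1 / M t) (MK M K t), packetExtension (M t / 2) n (1 / M t) (MK M K t),
    lipschitzOnWith_packet ha hn1 hδ haδ (by linarith) hX hsmall,
    abs_packet_zero_le ha hn1 hδ haδ (by linarith) hX hsmall,
    isLaplaceExtension_packet hM ha ht0 (by linarith) hn2 haδ,
    fun s hs => norm_packetExtension_le hM hK ha ht1 (by linarith) hn2 haδ (by linarith)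
      (by linarith) rfl hlog hsmall hs, ?_⟩
  refine le_trans (le_of_eq ?_) (le_packet_self ha hn1 hδ haδ (by linarith) hX hsmall)
  rw [hn]; field_simp; ring

end

/-! ### Condensation of singularities -/

/-- The functional on `ℓ¹` that is given by a bounded sequence. -/
theorem exists_functional_lp_one {β : ℕ → ℝ} {D : ℝ} (hβ : ∀ j, |β j| ≤ D) :
    ∃ φ : lp (fun _ : ℕ => ℝ) 1 →L[ℝ] ℝ, ∀ a, φ a = ∑' j, a j * β j := by
  have hs : ∀ a : lp (fun _ : ℕ => ℝ) 1, Summable fun j => |a j| := fun a => by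
    simpa using (lp.memℓp a).summable (by simp)
  have hsβ : ∀ a : lp (fun _ : ℕ => ℝ) 1, Summable fun j => a j * β j := fun a => by
    refine Summable.of_norm_bounded ((hs a).mul_right D) fun j => ?_
    rw [norm_mul, Real.norm_eq_abs, Real.norm_eq_abs]
    exact mul_le_mul_of_nonneg_left (hβ j) (abs_nonneg _)
  refine ⟨LinearMap.mkContinuous
    { toFun := fun a => ∑' j, a j * β j
      map_add' := fun a b => ?_
      map_smul' := fun c a => ?_ } D fun a => ?_, fun a => rfl⟩
  · rw [← (hsβ a).tsum_add (hsβ b)]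
    refine tsum_congr fun j => ?_
    rw [lp.coeFn_add, Pi.add_apply, add_mul]
  · rw [RingHom.id_apply, smul_eq_mul, ← tsum_mul_left]
    refine tsum_congr fun j => ?_
    rw [lp.coeFn_smul, Pi.smul_apply, smul_eq_mul, mul_assoc]
  · have hn : ‖a‖ = ∑' j, |a j| := by
      rw [lp.norm_eq_tsum_rpow (by simp)]
      simp
    rw [hn, ← tsum_mul_left]
    refine tsum_of_norm_bounded ((hs a).mul_left D).hasSum fun j => ?_
    rw [norm_mul, Real.norm_eq_abs, Real.norm_eq_abs, mul_comm]
    exact mul_le_mul_of_nonneg_right (hβ j) (abs_nonneg _)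

section

variable {M K : ℝ → ℝ} {S : ℕ → ℝ → ℝ} {g : ℕ → ℂ → ℂ} {C : ℝ} {b : ℕ → ℝ}

theorem abs_le_of_lipschitz {S : ℝ → ℝ} (hL : LipschitzOnWith 48 S (Ici 0)) (h0 : |S 0| ≤ 7)
    {x : ℝ} (hx : 0 ≤ x) : |S x| ≤ 7 + 48 * x := by
  have h1 := hL.dist_le_mul x hx 0 (mem_Ici.2 le_rfl)
  rw [Real.dist_eq, Real.dist_eq, sub_zero, abs_of_nonneg hx] at h1
  have h2 := abs_sub_abs_le_abs_sub (S x) (S 0)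
  have h3 : ((48 : NNReal) : ℝ) = 48 := by norm_num
  rw [h3] at h1
  linarith

theorem integrableOn_exp_mul_of_lipschitz {S : ℝ → ℝ} (hL : LipschitzOnWith 48 S (Ici 0))
    (h0 : |S 0| ≤ 7) {s : ℂ} (hs : 0 < s.re) :
    IntegrableOn (fun x : ℝ => Complex.exp (-s * x) * (S x : ℂ)) (Ioi 0) ∧
      ∫ x in Ioi (0 : ℝ), ‖Complex.exp (-s * x) * (S x : ℂ)‖ ≤
        ∫ x in Ioi (0 : ℝ), (7 + 96 / s.re) * Real.exp (-(s.re / 2) * x) := by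
  have hint : IntegrableOn (fun x : ℝ => (7 + 96 / s.re) * Real.exp (-(s.re / 2) * x)) (Ioi 0) :=
    (integrableOn_exp_mul_Ioi (by linarith) 0).const_mul _
  have hbd : ∀ x ∈ Ioi (0 : ℝ), ‖Complex.exp (-s * x) * (S x : ℂ)‖ ≤
      (7 + 96 / s.re) * Real.exp (-(s.re / 2) * x) := by
    intro x hx
    have hx0 : 0 < x := hx
    have h1 := abs_le_of_lipschitz hL h0 hx0.le
    have e : (-s * (x : ℂ)).re = -(s.re / 2) * x + -(s.re / 2) * x := by simp; ring
    rw [norm_mul, Complex.norm_exp, Complex.norm_real, Real.norm_eq_abs, e, Real.exp_add]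
    have h2 : |S x| ≤ (7 + 96 / s.re) * Real.exp (s.re / 2 * x) := by
      have h3 : s.re / 2 * x ≤ Real.exp (s.re / 2 * x) := by
        linarith [Real.add_one_le_exp (s.re / 2 * x)]
      have h4 : 1 ≤ Real.exp (s.re / 2 * x) := Real.one_le_exp (by positivity)
      calc |S x| ≤ 7 * 1 + 96 / s.re * (s.re / 2 * x) := by
            refine h1.trans (le_of_eq ?_); field_simp; ring
        _ ≤ 7 * Real.exp (s.re / 2 * x) + 96 / s.re * Real.exp (s.re / 2 * x) := by gcongr
        _ = _ := by ring
    have h5 : Real.exp (-(s.re / 2) * x) * Real.exp (s.re / 2 * x) = 1 := by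
      rw [← Real.exp_add]; simp
    calc _ ≤ Real.exp (-(s.re / 2) * x) * Real.exp (-(s.re / 2) * x) *
          ((7 + 96 / s.re) * Real.exp (s.re / 2 * x)) := by gcongr
      _ = (Real.exp (-(s.re / 2) * x) * Real.exp (s.re / 2 * x)) *
          ((7 + 96 / s.re) * Real.exp (-(s.re / 2) * x)) := by ring
      _ = _ := by rw [h5, one_mul]
  have hmeas : AEStronglyMeasurable (fun x : ℝ => Complex.exp (-s * x) * (S x : ℂ))
      (volume.restrict (Ioi 0)) := by
    refine ContinuousOn.aestronglyMeasurable ?_ measurableSet_Ioi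
    refine ContinuousOn.mul (by fun_prop) ?_
    exact Complex.continuous_ofReal.comp_continuousOn (hL.continuousOn.mono Ioi_subset_Ici_self)
  have h1 : IntegrableOn (fun x : ℝ => Complex.exp (-s * x) * (S x : ℂ)) (Ioi 0) :=
    Integrable.mono' hint hmeas ((ae_restrict_iff' measurableSet_Ioi).2 (ae_of_all _ hbd))
  exact ⟨h1, setIntegral_mono_on h1.norm hint measurableSet_Ioi hbd⟩

/-- Small `ℓ¹` combinations of functions with uniform constants belong to the class. -/
theorem lipschitzClass_tsum (hK : IsGrowthFunction K)
    (hL : ∀ j, LipschitzOnWith 48 (S j) (Ici 0)) (h0 : ∀ j, |S j 0| ≤ 7)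
    (hg : ∀ j, IsLaplaceExtension M (S j) (g j)) (hC : 0 < C)
    (hgC : ∀ j, ∀ s ∈ Omega M, ‖g j s‖ ≤ C * (K ‖s‖ / (1 + ‖s‖)))
    (hb : Summable fun j => |b j|) (hbC : C * ∑' j, |b j| ≤ 1) :
    LipschitzClass M K fun x => ∑' j, b j * S j x := by
  have hsum : ∀ x, 0 ≤ x → Summable fun j => b j * S j x := by
    intro x hx
    refine Summable.of_norm_bounded (hb.mul_right (7 + 48 * x)) fun j => ?_
    rw [norm_mul, Real.norm_eq_abs, Real.norm_eq_abs]
    exact mul_le_mul_of_nonneg_left (abs_le_of_lipschitz (hL j) (h0 j) hx) (abs_nonneg _)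
  have hloc : ∀ R, 0 ≤ R → ∀ j, ∀ s ∈ Omega M ∩ Metric.ball 0 R,
      ‖(b j : ℂ) * g j s‖ ≤ |b j| * (C * K R) := by
    intro R hR j s hs
    rw [norm_mul, Complex.norm_real, Real.norm_eq_abs]
    refine mul_le_mul_of_nonneg_left ((hgC j s hs.1).trans ?_) (abs_nonneg _)
    have h1 : ‖s‖ ≤ R := (mem_ball_zero_iff.1 hs.2).le
    have h2 : K ‖s‖ ≤ K R := hK.monotoneOn (mem_Ici.2 (norm_nonneg s)) (mem_Ici.2 hR) h1
    gcongr
    exact (div_le_self (hK.pos _ (norm_nonneg s)).le (by linarith [norm_nonneg s])).trans h2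
  refine ⟨⟨48 * Real.toNNReal (∑' j, |b j|), LipschitzOnWith.of_dist_le_mul fun x hx y hy => ?_⟩,
    fun s => ∑' j, (b j : ℂ) * g j s, ⟨fun s hs => ?_, fun s hs => ?_, fun s hs hre => ?_⟩,
    fun s hs => ?_⟩
  · rw [Real.dist_eq, ← (hsum x hx).tsum_sub (hsum y hy)]
    push_cast
    rw [Real.coe_toNNReal _ (tsum_nonneg fun j => abs_nonneg _)]
    have h1 : (48 : ℝ) * (∑' j, |b j|) * dist x y = ∑' j, |b j| * (48 * dist x y) := by
      rw [tsum_mul_right]; ring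
    rw [h1, ← Real.norm_eq_abs]
    refine tsum_of_norm_bounded (hb.mul_right _).hasSum fun j => ?_
    rw [← mul_sub, norm_mul, Real.norm_eq_abs]
    have h2 := (hL j).dist_le_mul x hx y hy
    have h3 : ((48 : NNReal) : ℝ) = 48 := by norm_num
    rw [h3, dist_eq_norm (S j x)] at h2
    gcongr
  · have h1 : ContinuousOn (fun s => ∑' j, (b j : ℂ) * g j s)
        (Omega M ∩ Metric.ball 0 (‖s‖ + 1)) :=
      continuousOn_tsum (fun j => continuousOn_const.mul
        ((hg j).continuousOn.mono inter_subset_left)) (hb.mul_right _) (hloc _ (by positivity))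
    have hball : Metric.ball (0 : ℂ) (‖s‖ + 1) ∈ 𝓝 s :=
      Metric.isOpen_ball.mem_nhds (by rw [mem_ball_zero_iff]; linarith)
    have h2 := h1 s ⟨hs, mem_of_mem_nhds hball⟩
    exact (continuousWithinAt_inter hball).1 h2
  · have h1 : DifferentiableOn ℂ (fun s => ∑' j, (b j : ℂ) * g j s)
        (interior (Omega M) ∩ Metric.ball 0 (‖s‖ + 1)) :=
      Complex.differentiableOn_tsum_of_summable_norm (hb.mul_right (C * K (‖s‖ + 1)))
        (fun j => ((hg j).differentiableOn.mono inter_subset_left).const_mul _)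
        (isOpen_interior.inter Metric.isOpen_ball)
        (fun j w hw => hloc _ (by positivity) j w ⟨interior_subset hw.1, hw.2⟩)
    have hball : Metric.ball (0 : ℂ) (‖s‖ + 1) ∈ 𝓝 s :=
      Metric.isOpen_ball.mem_nhds (by rw [mem_ball_zero_iff]; linarith)
    exact (h1.differentiableAt (inter_mem (isOpen_interior.mem_nhds hs)
      hball)).differentiableWithinAt
  · have hF : ∀ j, IntegrableOn (fun x : ℝ => (b j : ℂ) * (Complex.exp (-s * x) * (S j x : ℂ)))
        (Ioi 0) := fun j => (integrableOn_exp_mul_of_lipschitz (hL j) (h0 j) hre).1.const_mul _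
    have hF2 : Summable fun j => ∫ x in Ioi (0 : ℝ),
        ‖(b j : ℂ) * (Complex.exp (-s * x) * (S j x : ℂ))‖ := by
      refine Summable.of_nonneg_of_le (fun j => integral_nonneg fun x => norm_nonneg _)
        (fun j => ?_) (hb.mul_right
          (∫ x in Ioi (0 : ℝ), (7 + 96 / s.re) * Real.exp (-(s.re / 2) * x)))
      simp only [norm_mul (b j : ℂ), Complex.norm_real, Real.norm_eq_abs]
      rw [integral_const_mul]
      exact mul_le_mul_of_nonneg_left
        (integrableOn_exp_mul_of_lipschitz (hL j) (h0 j) hre).2 (abs_nonneg _)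
    have h1 := hasSum_integral_of_summable_integral_norm hF hF2
    have h2 : laplace (fun x => ∑' j, b j * S j x) s = ∫ x in Ioi (0 : ℝ),
        ∑' j, (b j : ℂ) * (Complex.exp (-s * x) * (S j x : ℂ)) := by
      unfold laplace
      refine integral_congr_ae (ae_of_all _ fun x => ?_)
      simp only
      rw [Complex.ofReal_tsum, ← tsum_mul_left]
      refine tsum_congr fun j => ?_
      push_cast
      ring
    rw [h2, ← h1.tsum_eq]
    refine tsum_congr fun j => ?_
    rw [integral_const_mul, (hg j).eq_laplace s hs hre]
    rfl
  · have hKs : 0 ≤ K ‖s‖ / (1 + ‖s‖) :=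
      div_nonneg (hK.pos _ (norm_nonneg s)).le (by linarith [norm_nonneg s])
    have h1 : ‖∑' j, (b j : ℂ) * g j s‖ ≤ ∑' j, |b j| * (C * (K ‖s‖ / (1 + ‖s‖))) := by
      refine tsum_of_norm_bounded (hb.mul_right _).hasSum fun j => ?_
      rw [norm_mul, Complex.norm_real, Real.norm_eq_abs]
      exact mul_le_mul_of_nonneg_left (hgC j s hs) (abs_nonneg _)
    refine h1.trans ?_
    rw [tsum_mul_right]
    calc _ = (C * ∑' j, |b j|) * (K ‖s‖ / (1 + ‖s‖)) := by ring
      _ ≤ 1 * (K ‖s‖ / (1 + ‖s‖)) := by gcongr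
      _ = _ := one_mul _

/-- If every function in the class is `O(r)`, then so is `1 / M_K⁻¹`: otherwise some `ℓ¹`
combination of the wave packets would violate the assumption, by the uniform boundedness
principle. -/
theorem isBigO_of_forall_lipschitzClass (hM : IsGrowthFunction M) (hK : IsGrowthFunction K)
    {c : ℝ} (hc : 0 < c) (hKe : ∀ᶠ t in atTop, K t ≤ Real.exp (Real.exp (c * t * M t)))
    {r : ℝ → ℝ} (hr : ∀ S : ℝ → ℝ, LipschitzClass M K S → S =O[atTop] r) :
    (fun x : ℝ => 1 / MKInv M K x) =O[atTop] r := by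
  obtain ⟨C, c', hC, hc', hex⟩ := exists_extremal_packet hM hK hc hKe
  by_contra hO
  have hpick : ∀ k : ℕ, ∃ x : ℝ, (k : ℝ) ≤ x ∧ 0 < x ∧
      ((k : ℝ) + 1) * |r x| < 1 / MKInv M K x ∧ ∃ (S : ℝ → ℝ) (g : ℂ → ℂ),
      LipschitzOnWith 48 S (Ici 0) ∧ |S 0| ≤ 7 ∧ IsLaplaceExtension M S g ∧
      (∀ s ∈ Omega M, ‖g s‖ ≤ C * (K ‖s‖ / (1 + ‖s‖))) ∧ c' / MKInv M K x ≤ S x := by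
    intro k
    have h1 : ∃ᶠ x in atTop, ¬ ‖1 / MKInv M K x‖ ≤ ((k : ℝ) + 1) * ‖r x‖ := by
      intro h
      apply hO
      refine IsBigO.of_bound ((k : ℝ) + 1) ?_
      filter_upwards [h] with x hx
      exact not_not.1 hx
    obtain ⟨x, hx1, hx2, hx3, S, g, hS⟩ := (h1.and_eventually ((eventually_ge_atTop (k : ℝ)).and
      ((eventually_gt_atTop 0).and ((tendsto_MKInv hM hK).eventually hex)))).exists
    obtain ⟨hT1, hT2⟩ := MKInv_spec hM hK hx3
    refine ⟨x, hx2, hx3, ?_, S, g, hS.1, hS.2.1, hS.2.2.1, hS.2.2.2.1, ?_⟩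
    · rw [Real.norm_eq_abs, Real.norm_eq_abs, abs_of_pos (one_div_pos.2 hT1)] at hx1
      exact not_le.1 hx1
    · have := hS.2.2.2.2
      rwa [hT2] at this
  choose x hxk hx0 hxr S g hL h0 hg hgC hSx using hpick
  have hxtop : Tendsto x atTop atTop := tendsto_atTop_mono hxk tendsto_natCast_atTop_atTop
  set T : ℕ → ℝ := fun k => MKInv M K (x k) with hT
  have hT0 : ∀ k, 0 < T k := fun k => (MKInv_spec hM hK (hx0 k)).1
  -- the second summand keeps the weights positive where `r` vanishes
  set ρ : ℕ → ℝ := fun k => |r (x k)| + 1 / (((k : ℝ) + 1) * T k) with hρ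
  have hρ1 : ∀ k : ℕ, 0 < 1 / (((k : ℝ) + 1) * T k) := fun k => by
    have := hT0 k
    positivity
  have hρ0 : ∀ k, 0 < ρ k := fun k => add_pos_of_nonneg_of_pos (abs_nonneg _) (hρ1 k)
  have hρ2 : ∀ k : ℕ, ρ k ≤ 2 / (((k : ℝ) + 1) * T k) := by
    intro k
    have h1 : |r (x k)| ≤ 1 / (((k : ℝ) + 1) * T k) := by
      have h2 := (hxr k).le
      rw [le_div_iff₀ (hT0 k)] at h2
      rw [le_div_iff₀ (mul_pos (by positivity) (hT0 k))]
      linarith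
    have e : 2 / (((k : ℝ) + 1) * T k) = 1 / (((k : ℝ) + 1) * T k) + 1 / (((k : ℝ) + 1) * T k) := by
      ring
    rw [e]
    exact add_le_add h1 le_rfl
  have hβ : ∀ k j, |S j (x k) / ρ k| ≤ (7 + 48 * x k) / ρ k := by
    intro k j
    rw [abs_div, abs_of_pos (hρ0 k)]
    have := hρ0 k
    have := abs_le_of_lipschitz (hL j) (h0 j) (hx0 k).le
    gcongr
  choose φ hφ using fun k => exists_functional_lp_one (hβ k)
  have hbdd : ∀ a : lp (fun _ : ℕ => ℝ) 1, ∃ D, ∀ k, ‖φ k a‖ ≤ D := by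
    intro a
    have ha : Summable fun j => |a j| := by simpa using (lp.memℓp a).summable (by simp)
    set A := ∑' j, |a j| with hA
    have hA0 : 0 ≤ A := tsum_nonneg fun j => abs_nonneg _
    set l := 1 / (C * (A + 1)) with hl
    have hl0 : 0 < l := by positivity
    have hb : Summable fun j => |l * a j| := by
      simp only [abs_mul]
      exact ha.mul_left _
    have hcls : LipschitzClass M K fun x => ∑' j, l * a j * S j x := by
      refine lipschitzClass_tsum hK hL h0 hg hC hgC hb ?_
      simp only [abs_mul, tsum_mul_left, abs_of_pos hl0]
      rw [← hA, hl]
      have : C * (1 / (C * (A + 1)) * A) = A / (A + 1) := by field_simp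
      rw [this, div_le_one (by positivity)]
      linarith
    obtain ⟨D, hD⟩ := (hr _ hcls).bound
    have hev : ∀ᶠ k in atTop, ‖φ k a‖ ≤ |D| / l := by
      filter_upwards [hxtop.eventually hD] with k hk
      have e1 : φ k a = (∑' j, l * a j * S j (x k)) / ρ k / l := by
        rw [hφ, ← tsum_div_const, ← tsum_div_const]
        refine tsum_congr fun j => ?_
        field_simp
      rw [e1, norm_div, norm_div, Real.norm_of_nonneg hl0.le, Real.norm_of_nonneg (hρ0 k).le]
      gcongr
      rw [div_le_iff₀ (hρ0 k)]
      refine hk.trans ?_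
      have h1 : ‖r (x k)‖ ≤ ρ k := by
        rw [Real.norm_eq_abs]
        linarith [hρ1 k, show ρ k = |r (x k)| + 1 / (((k : ℝ) + 1) * T k) from rfl]
      have h2 := le_abs_self D
      gcongr
    obtain ⟨N, hN⟩ := eventually_atTop.1 hev
    refine ⟨|D| / l + ∑ k ∈ Finset.range N, ‖φ k a‖, fun k => ?_⟩
    have hs0 : 0 ≤ ∑ k ∈ Finset.range N, ‖φ k a‖ := Finset.sum_nonneg fun _ _ => norm_nonneg _
    rcases le_or_gt N k with h | h
    · linarith [hN k h]
    · have h1 := Finset.single_le_sum (f := fun k => ‖φ k a‖) (fun _ _ => norm_nonneg _)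
        (Finset.mem_range.2 h)
      have h2 : 0 ≤ |D| / l := by positivity
      linarith
  obtain ⟨D, hD⟩ := banach_steinhaus hbdd
  -- the `k`-th functional is large at the `k`-th unit vector
  have hlow : ∀ k : ℕ, c' * ((k : ℝ) + 1) / 2 ≤ D := by
    intro k
    have h1 : φ k (lp.single 1 k (1 : ℝ)) = S k (x k) / ρ k := by
      rw [hφ, tsum_eq_single k]
      · rw [lp.single_apply_self, one_mul]
      · intro j hj
        rw [lp.single_apply_ne _ _ _ hj, zero_mul]
    have h2 : ‖φ k (lp.single 1 k (1 : ℝ))‖ ≤ D * 1 := by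
      refine ((φ k).le_opNorm _).trans ?_
      rw [lp.norm_single one_pos, norm_one]
      linarith [hD k]
    rw [h1, mul_one] at h2
    refine le_trans ?_ ((le_abs_self _).trans h2)
    rw [le_div_iff₀ (hρ0 k)]
    refine le_trans ?_ (hSx k)
    have h3 := hT0 k
    calc c' * ((k : ℝ) + 1) / 2 * ρ k
        ≤ c' * ((k : ℝ) + 1) / 2 * (2 / (((k : ℝ) + 1) * T k)) := by gcongr; exact hρ2 k
      _ = c' / T k := by field_simp
  obtain ⟨k, hk⟩ := exists_nat_gt (2 * D / c')
  have := hlow k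
  rw [div_lt_iff₀ hc'] at hk
  linarith

end

theorem theorem1p3 (M K : ℝ → ℝ) (hM : IsGrowthFunction M) (hK : IsGrowthFunction K) :
    (∀ S : ℝ → ℝ, TauberianClass M K S →
      (∀ c : ℝ, 0 < c → c < 1 →
        S =O[atTop] fun x : ℝ => 1 / MKlogInv M K (c * x)) ∧
      (RegularGrowth (fun t => M t * t / 675) (MKlog M K) →
        (S =O[atTop] fun x : ℝ => 1 / MKlogInv M K x) ∧
        (PositiveIncrease K ∨
            (LogPowerIncrease M ∧ RegularGrowth (fun t => M t * t / 1350) (MKlog M K)) →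
          S =O[atTop] fun x : ℝ => 1 / MKInv M K x))) ∧
    ((∃ C'' : ℝ, 0 < C'' ∧ ∀ᶠ t : ℝ in atTop, K t ≤ Real.exp (Real.exp (C'' * t * M t))) →
      ∀ r : ℝ → ℝ, (∀ S : ℝ → ℝ, LipschitzClass M K S → S =O[atTop] r) →
        (fun x : ℝ => 1 / MKInv M K x) =O[atTop] r) := by
  refine ⟨fun S hS => ⟨fun c hc0 hc1 => isBigO_MKlogInv_mul hM hK hS hc0 hc1,
    fun hV => ⟨isBigO_MKlogInv hM hK hS hV, fun h => isBigO_MKInv hM hK hS hV ?_⟩⟩, ?_⟩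
  · exact h.imp_right And.left
  · rintro ⟨c, hc, hKe⟩ r hr
    exact isBigO_of_forall_lipschitzClass hM hK hc hKe hr
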